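/- For a nonzero rational number $n$, let $E_n$ be the elliptic curve over $\mathbb{Q}$ defined by the projective equation $x^3+y^3=nz^3$ with origin $(1:-1:0)$; it has the Weierstrass equation $y^2=x^3-2^4\cdot 3^3\cdot n^2$. Let $$\mathrm{Sel}_3(E_n)=\ker\Bigl(H^1(\mathbb{Q},E_n[3])\longrightarrow\prod_v H^1(\mathbb{Q}_v,E_n)\Bigr)$$ be its $3$-Selmer group, where $v$ runs over all places of $\mathbb{Q}$ (including the real one) and $H^1$ denotes continuous Galois cohomology; it is a vector space over $\mathbb{F}_3$. Let $p$ be an odd prime with $p\equiv 2$ or $5 \pmod 9$. Then $$\dim_{\mathbb{F}_3}\mathrm{Sel}_3(E_{3p})=1,\qquad \dim_{\mathbb{F}_3}\mathrm{Sel}_3(E_{9p^2})=0,$$ $$\dim_{\mathbb{F}_3}\mathrm{Sel}_3(E_{3p^2})=1,\qquad \dim_{\mathbb{F}_3}\mathrm{Sel}_3(E_{9p})=0.$$ -/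

import Mathlib

noncomputable section

namespace CubeSum

/-! ### First continuous cohomology of a topological group with discrete coefficients -/

section Cohomology

variable (G M : Type*) [Group G] [TopologicalSpace G] [AddCommGroup M] [DistribMulAction G M]

/-- Continuous 1-cocycles `G → M`, where `M` carries the discrete topology
(so that continuous means locally constant). -/
def cocycles : AddSubgroup (G → M) where
  carrier := {c | IsLocallyConstant c ∧ ∀ σ τ : G, c (σ * τ) = c σ + σ • c τ}
  zero_mem' := ⟨IsLocallyConstant.const 0, fun σ τ => by simp⟩
  add_mem' := by
    rintro a b ⟨ha, ha'⟩ ⟨hb, hb'⟩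
    refine ⟨ha.add hb, fun σ τ => ?_⟩
    simp only [Pi.add_apply, ha', hb', smul_add]
    abel
  neg_mem' := by
    rintro a ⟨ha, ha'⟩
    refine ⟨ha.neg, fun σ τ => ?_⟩
    simp only [Pi.neg_apply, ha', smul_neg]
    abel

/-- 1-coboundaries `σ ↦ σ • m - m`. -/
def coboundaries : AddSubgroup (G → M) where
  carrier := {c | ∃ m : M, ∀ σ : G, c σ = σ • m - m}
  zero_mem' := ⟨0, fun σ => by simp⟩
  add_mem' := by
    rintro a b ⟨m, hm⟩ ⟨n, hn⟩
    refine ⟨m + n, fun σ => ?_⟩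
    simp only [Pi.add_apply, hm, hn, smul_add]
    abel
  neg_mem' := by
    rintro a ⟨m, hm⟩
    refine ⟨-m, fun σ => ?_⟩
    simp only [Pi.neg_apply, hm, smul_neg]
    abel

/-- The first continuous cohomology group `H¹(G, M)`: continuous cocycles modulo coboundaries. -/
abbrev H1 : Type _ := cocycles G M ⧸ (coboundaries G M).addSubgroupOf (cocycles G M)

variable {G M} {G' M' : Type*} [Group G'] [TopologicalSpace G'] [AddCommGroup M']
  [DistribMulAction G' M']

/-- The map on cocycles induced by a continuous homomorphism `φ : G' → G` and a homomorphism
`f : M → M'` compatible with `φ`. -/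
def cocyclesMap (φ : G' →ₜ* G) (f : M →+ M') (hf : ∀ (σ : G') (m : M), f (φ σ • m) = σ • f m) :
    cocycles G M →+ cocycles G' M' where
  toFun c := ⟨fun σ => f (c.1 (φ σ)),
    (c.2.1.comp_continuous φ.continuous_toFun).comp f, fun σ τ => by
      change f (c.1 (φ (σ * τ))) = _
      rw [map_mul, c.2.2, map_add, hf]⟩
  map_zero' := by ext; simp
  map_add' a b := by ext; simp

/-- The map `H¹(G, M) → H¹(G', M')` induced by a continuous homomorphism `φ : G' → G` and a
homomorphism `f : M → M'` compatible with `φ`. -/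
def H1.map (φ : G' →ₜ* G) (f : M →+ M') (hf : ∀ (σ : G') (m : M), f (φ σ • m) = σ • f m) :
    H1 G M →+ H1 G' M' :=
  QuotientAddGroup.map _ _ (cocyclesMap φ f hf) <| by
    rintro c ⟨m, hm⟩
    refine ⟨f m, fun σ => ?_⟩
    change f (c.1 (φ σ)) = _
    rw [← hf, ← map_sub]
    exact congrArg f (hm (φ σ))

theorem H1.nsmul_eq_zero {m : ℕ} (hM : ∀ x : M, m • x = 0) (x : H1 G M) : m • x = 0 := by
  induction x using QuotientAddGroup.induction_on with
  | H c =>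
    rw [← QuotientAddGroup.mk_nsmul]
    have : m • c = 0 := by
      ext σ
      simpa using hM (c.1 σ)
    rw [this]
    rfl

end Cohomology

/-! ### Galois action on the points of a Weierstrass curve -/

section Galois

open WeierstrassCurve.Affine

variable {K : Type*} [Field K] (W : WeierstrassCurve K)

/-- The coordinatewise action of `Gal(F/L)` on the `F`-points of a curve over `K`, for `F/L/K`. -/
instance galoisAction (L F : Type*) [Field L] [Field F] [Algebra K L] [Algebra L F] [Algebra K F]
    [IsScalarTower K L F] [DecidableEq F] :
    DistribMulAction Gal(F/L) (W.baseChange F).toAffine.Point where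
  smul σ P := Point.map (W' := W) σ.toAlgHom P
  one_smul P := by cases P <;> rfl
  mul_smul σ τ P := by cases P <;> rfl
  smul_zero σ := rfl
  smul_add σ P Q := map_add (Point.map (W' := W) σ.toAlgHom) P Q

end Galois

/-- The action of `G` on the `m`-torsion subgroup `M[m]` of a `G`-module `M`. -/
instance torsionAction (G M : Type*) [Group G] [AddCommGroup M] [DistribMulAction G M] (m : ℤ) :
    DistribMulAction G (AddSubgroup.torsionBy M m) where
  smul σ x := ⟨σ • (x : M), by
    change m • σ • (x : M) = 0
    rw [← smul_comm σ m (x : M), show m • (x : M) = 0 from x.2, smul_zero]⟩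
  one_smul x := Subtype.ext (one_smul G (x : M))
  mul_smul σ τ x := Subtype.ext (mul_smul σ τ (x : M))
  smul_zero σ := Subtype.ext (smul_zero σ)
  smul_add σ x y := Subtype.ext (smul_add σ (x : M) (y : M))

/-! ### Restriction to a decomposition group -/

section Localization

variable (K L : Type*) [Field K] [Field L] [Algebra K L]

/-- A fixed `K`-embedding of an algebraic closure of `K` into an algebraic closure of `L`. -/
def closureEmbedding : AlgebraicClosure K →ₐ[K] AlgebraicClosure L :=
  IsAlgClosed.lift

/-- Restriction of automorphisms `Gal(L̄/L) → Gal(K̄/K)` along the fixed embedding `K̄ → L̄`. -/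
def galoisRestrictionHom :
    Gal(AlgebraicClosure L/L) →* Gal(AlgebraicClosure K/K) :=
  letI : Algebra (AlgebraicClosure K) (AlgebraicClosure L) :=
    (closureEmbedding K L).toRingHom.toAlgebra
  haveI : IsScalarTower K (AlgebraicClosure K) (AlgebraicClosure L) :=
    IsScalarTower.of_algebraMap_eq fun x => ((closureEmbedding K L).commutes x).symm
  IntermediateField.restrictRestrictAlgEquivMapHom K (AlgebraicClosure K) L (AlgebraicClosure L)

theorem closureEmbedding_restriction (σ : Gal(AlgebraicClosure L/L)) (x : AlgebraicClosure K) :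
    closureEmbedding K L (galoisRestrictionHom K L σ x) = σ (closureEmbedding K L x) := by
  let : Algebra (AlgebraicClosure K) (AlgebraicClosure L) :=
    (closureEmbedding K L).toRingHom.toAlgebra
  have : IsScalarTower K (AlgebraicClosure K) (AlgebraicClosure L) :=
    IsScalarTower.of_algebraMap_eq fun x => ((closureEmbedding K L).commutes x).symm
  exact AlgEquiv.restrictNormal_commutes
    (MulSemiringAction.toAlgAut Gal(AlgebraicClosure L/L) K (AlgebraicClosure L) σ)
    (AlgebraicClosure K) x

theorem continuous_galoisRestrictionHom : Continuous (galoisRestrictionHom K L) := by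
  apply continuous_of_continuousAt_one _ (continuousAt_def.mpr _)
  intro U hU
  rw [map_one, krullTopology_mem_nhds_one_iff] at hU
  obtain ⟨E, hE, hEU⟩ := hU
  obtain ⟨S, rfl⟩ := IntermediateField.essFiniteType_iff.mp (inferInstance : Algebra.EssFiniteType K E)
  have hopen : IsOpen (⋂ x ∈ S, (MulAction.stabilizer Gal(AlgebraicClosure L/L)
      (closureEmbedding K L x) : Set Gal(AlgebraicClosure L/L))) :=
    isOpen_biInter_finset fun x _ => stabilizer_isOpen_of_isIntegral _
  refine Filter.mem_of_superset (hopen.mem_nhds ?_) fun σ hσ => hEU ?_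
  · simp only [Set.mem_iInter]
    exact fun x _ => one_mem _
  · have hle : IntermediateField.adjoin K (S : Set (AlgebraicClosure K)) ≤
        IntermediateField.fixedField (Subgroup.zpowers (galoisRestrictionHom K L σ)) := by
      rw [IntermediateField.adjoin_le_iff]
      intro x hx
      have hx' : galoisRestrictionHom K L σ ∈
          MulAction.stabilizer Gal(AlgebraicClosure K/K) x := by
        apply (closureEmbedding K L).injective
        have := Set.mem_iInter₂.mp hσ x hx
        exact (closureEmbedding_restriction K L σ x).trans this
      rintro ⟨g, hg⟩
      exact (Subgroup.zpowers_le.mpr hx') hg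
    exact (IntermediateField.le_iff_le _ _).mp hle (Subgroup.mem_zpowers _)

/-- The restriction homomorphism `Gal(L̄/L) → Gal(K̄/K)` as a continuous homomorphism. -/
def galoisRestriction : Gal(AlgebraicClosure L/L) →ₜ* Gal(AlgebraicClosure K/K) where
  toMonoidHom := galoisRestrictionHom K L
  continuous_toFun := continuous_galoisRestrictionHom K L

end Localization

/-! ### Selmer groups -/

section Selmer

open WeierstrassCurve.Affine

variable {K : Type*} [Field K] (W : WeierstrassCurve K)

open scoped Classical

/-- `H¹(Gal(K̄/K), W[m])`, with `W[m]` the `m`-torsion of `W(K̄)`. -/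
abbrev torsionH1 (m : ℕ) : Type _ :=
  H1 Gal(AlgebraicClosure K/K)
    (AddSubgroup.torsionBy (W.baseChange (AlgebraicClosure K)).toAffine.Point (m : ℤ))

/-- The localization map `H¹(Gal(K̄/K), W[m]) → H¹(Gal(L̄/L), W(L̄))` for a field extension `L/K`:
restriction to `Gal(L̄/L)` followed by the map induced by `W[m] ⊆ W(K̄) → W(L̄)`. -/
def localization (m : ℕ) (L : Type*) [Field L] [Algebra K L] :
    torsionH1 W m →+
      H1 Gal(AlgebraicClosure L/L) (W.baseChange (AlgebraicClosure L)).toAffine.Point :=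
  H1.map (galoisRestriction K L)
    ((Point.map (W' := W) (closureEmbedding K L)).comp
      (AddSubgroup.torsionBy (W.baseChange (AlgebraicClosure K)).toAffine.Point (m : ℤ)).subtype)
    (by
      rintro σ ⟨P, hP⟩
      change Point.map (W' := W) (closureEmbedding K L)
          (Point.map (W' := W) (galoisRestrictionHom K L σ).toAlgHom P) =
        Point.map (W' := W) σ.toAlgHom (Point.map (W' := W) (closureEmbedding K L) P)
      cases P with
      | zero => rfl
      | some x y h =>
        simp only [Point.map_some, Point.some.injEq]
        exact ⟨closureEmbedding_restriction K L σ x, closureEmbedding_restriction K L σ y⟩)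

/-- The `m`-Selmer group of a Weierstrass curve `W` over `ℚ`: the classes in `H¹(Gal(ℚ̄/ℚ), W[m])`
that become trivial in `H¹(Gal(ℚ̄ᵥ/ℚᵥ), W(ℚ̄ᵥ))` for every place `v` of `ℚ`, i.e. for `ℚᵥ = ℚ_ℓ` with
`ℓ` any prime number and for `ℚᵥ = ℝ`. -/
def selmerGroup (W : WeierstrassCurve ℚ) (m : ℕ) : AddSubgroup (torsionH1 W m) :=
  (⨅ (ℓ : ℕ) (_ : Fact ℓ.Prime), (localization W m ℚ_[ℓ]).ker) ⊓ (localization W m ℝ).ker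

/-- The `m`-Selmer group is killed by `m`, hence is a `ℤ/m`-module. -/
instance selmerModule (W : WeierstrassCurve ℚ) (m : ℕ) : Module (ZMod m) (selmerGroup W m) :=
  AddCommGroup.zmodModule fun x =>
    Subtype.ext (H1.nsmul_eq_zero (fun y => AddSubgroup.torsionBy.nsmul y) (x : torsionH1 W m))

end Selmer

/-! ### The curves `x³ + y³ = n z³` -/

/-- The elliptic curve `Eₙ : x³ + y³ = n z³` over `ℚ` with origin `(1 : -1 : 0)`, in its Weierstrass
form `Y² = X³ - 2⁴ · 3³ · n²`. -/
def cubeSumCurve (n : ℚ) : WeierstrassCurve ℚ where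
  a₁ := 0
  a₂ := 0
  a₃ := 0
  a₄ := 0
  a₆ := -(2 ^ 4 * 3 ^ 3 * n ^ 2)

theorem cubeSumCurve_isElliptic {n : ℚ} (hn : n ≠ 0) : (cubeSumCurve n).IsElliptic := by
  refine ⟨isUnit_iff_ne_zero.mpr ?_⟩
  simp only [cubeSumCurve, WeierstrassCurve.Δ, WeierstrassCurve.b₂, WeierstrassCurve.b₄,
    WeierstrassCurve.b₆, WeierstrassCurve.b₈]
  ring_nf
  simpa using hn

/-- The change of coordinates `X = 12 n / (x + y)`, `Y = 36 n (x - y) / (x + y)` between the cubic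
`x³ + y³ = n` and its Weierstrass form, with inverse `x = (36 n + Y) / (6 X)`,
`y = (36 n - Y) / (6 X)`, valid over every extension `F` of `ℚ`. -/
theorem cubeSumCurve_equation_iff {F : Type*} [Field F] [Algebra ℚ F] {n : ℚ} (hn : n ≠ 0)
    {x y X Y : F} (hX : X * (x + y) = 12 * algebraMap ℚ F n)
    (hY : Y * (x + y) = 36 * algebraMap ℚ F n * (x - y)) :
    x ^ 3 + y ^ 3 = algebraMap ℚ F n ↔
      ((cubeSumCurve n).baseChange F).toAffine.Equation X Y := by
  have : CharZero F := algebraRat.charZero F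
  have hn' : algebraMap ℚ F n ≠ 0 := by simpa using hn
  have hs : x + y ≠ 0 := by
    intro h
    rw [h, mul_zero] at hX
    exact mul_ne_zero (by norm_num) hn' hX.symm
  obtain rfl : X = 12 * algebraMap ℚ F n / (x + y) := by rw [eq_div_iff hs, hX]
  obtain rfl : Y = 36 * algebraMap ℚ F n * (x - y) / (x + y) := by rw [eq_div_iff hs, hY]
  rw [WeierstrassCurve.Affine.equation_iff]
  simp only [cubeSumCurve, WeierstrassCurve.baseChange, WeierstrassCurve.map, map_zero, map_neg,
    map_mul, map_pow, map_ofNat]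
  generalize algebraMap ℚ F n = t at *
  field_simp
  constructor
  · rintro rfl
    ring
  · intro h
    have h2 : (1728 * t : F) ≠ 0 := mul_ne_zero (by norm_num) hn'
    apply mul_left_cancel₀ h2
    linear_combination h

end CubeSum

end

noncomputable section

namespace CubeSum

open WeierstrassCurve.Affine

/-! ### Cube roots of unity -/

section CubeRoots

variable {F : Type*} [Field F]

/-! The curve E has complex multiplication by ℤ[w], where w is a primitive cube root of unity, and
-3 is the square of √-3 = [w] - [w²]. The kernel of √-3 is μ₃ as a Galois module
(`map_kernelPoint`), and Galois acts trivially on E[3]/ker √-3 (`sqrtNegThree_map`). So E[3] is an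
extension of ℤ/3 by μ₃, and a Selmer class can be studied through these two pieces by Kummer theory.

The geometric input is that translation by the point of ker √-3 attached to z ∈ μ₃ is (u, v) ↦ (z u,
z² v) on the cubic u³ + v³ = n (`cubicPoint_add_kernelPoint`). Hence a Kummer class of d = θ³ dies
in the cohomology of E over a field exactly when d r³ + d² s³ = n is soluble there or d is a cube
(`exists_descent` and its converse `exists_trivializedBy`).

The quotient contributes nothing (`IsTorsionCocycle.sqrtNegThree_eq_zero`). The image of a Selmer
cocycle in ℤ/3 is, over ℚ(w), the Kummer character of some α³ ∈ ℚ(w) whose norm is a cube.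
Solubility at the primes ℓ ≡ 1 mod 3 makes its valuations divisible by 3, and since ℤ[w] is
principal with units ± wⁱ, α³ is a power of w times a cube. A primitive w is excluded at p: as 9
does not divide p² - 1, w is not a cube in the residue field of ℚ_p(w), and the cubic has no point
there (`padic_no_solution`).

So every Selmer class comes from μ₃ and is given by some d ∈ ℚ. Local solubility leaves d = 3ⁱ pʲ up
to cubes. The 3-torsion point (∛n, 0) makes the class of n trivial in H¹(ℚ, E[3]), and as the
exponent of p in n is prime to 3, only the powers of 3 remain (`exists_nsmul_of_mem_selmerGroup`).
The Selmer group is thus zero or the line spanned by the class of 3.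

For n = 3 p or 3 p² the cubic r³ + 3 s³ = n / 3 is soluble at each finite place where 3 is not a
cube, and 3 is a real cube (`padic_exists_solution`); the class is nonzero by comparing valuations.
For n = 9 p or 9 p² solubility over ℚ₃ would make p or p² a cube modulo 9
(`padic_three_no_solution`). -/

theorem cube_eq_one_of_sq_add {w : F} (hw : w ^ 2 + w + 1 = 0) : w ^ 3 = 1 := by
  linear_combination (w - 1) * hw

theorem sq_cube_eq_one_of_sq_add {w : F} (hw : w ^ 2 + w + 1 = 0) : (w ^ 2) ^ 3 = 1 := by
  rw [← pow_mul, mul_comm, pow_mul, cube_eq_one_of_sq_add hw, one_pow]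

theorem ne_one_of_sq_add [CharZero F] {w : F} (hw : w ^ 2 + w + 1 = 0) : w ≠ 1 := by
  rintro rfl
  norm_num at hw

theorem sq_add_of_cube_eq_one {w : F} (hw : w ^ 3 = 1) (h1 : w ≠ 1) : w ^ 2 + w + 1 = 0 :=
  (mul_eq_zero.mp (by linear_combination hw : (w - 1) * (w ^ 2 + w + 1) = 0)).resolve_left
    (sub_ne_zero.mpr h1)

theorem sq_cube {w : F} (hw : w ^ 3 = 1) : (w ^ 2) ^ 3 = 1 := by
  rw [← pow_mul, mul_comm, pow_mul, hw, one_pow]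

end CubeRoots

/-! ### Explicit geometry of the curves `Y² = X³ - 432 n²` -/

section Geometry

/-- The group of `F`-points of the curve `Y² = X³ - 432 n²`. -/
abbrev EPoint (n : ℚ) (F : Type*) [Field F] [Algebra ℚ F] : Type _ :=
  ((cubeSumCurve n).baseChange F).toAffine.Point

variable {n : ℚ} {F : Type*} [Field F] [Algebra ℚ F]

theorem equation_iff_sq {x y : F} :
    ((cubeSumCurve n).baseChange F).toAffine.Equation x y ↔
      y ^ 2 = x ^ 3 - 432 * algebraMap ℚ F n ^ 2 := by
  rw [equation_iff]
  simp only [cubeSumCurve, WeierstrassCurve.baseChange, WeierstrassCurve.map, map_zero, map_neg,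
    map_mul, map_pow, map_ofNat]
  ring_nf

theorem negY_eq {x y : F} : ((cubeSumCurve n).baseChange F).toAffine.negY x y = -y := by
  simp [negY, cubeSumCurve, WeierstrassCurve.baseChange, WeierstrassCurve.map]

theorem algebraMap_rat_ne_zero [NeZero n] : algebraMap ℚ F n ≠ 0 := by
  simpa only [ne_eq, map_eq_zero] using NeZero.ne n

theorem nonsingular_of_sq [NeZero n] {x y : F} (h : y ^ 2 = x ^ 3 - 432 * algebraMap ℚ F n ^ 2) :
    ((cubeSumCurve n).baseChange F).toAffine.Nonsingular x y := by
  have : (cubeSumCurve n).IsElliptic := cubeSumCurve_isElliptic (NeZero.ne n)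
  have : ((cubeSumCurve n).baseChange F).IsElliptic :=
    inferInstanceAs ((cubeSumCurve n).map _).IsElliptic
  exact (equation_iff_nonsingular (W := (cubeSumCurve n).baseChange F)).mp (equation_iff_sq.mpr h)

theorem sq_of_nonsingular {x y : F}
    (h : ((cubeSumCurve n).baseChange F).toAffine.Nonsingular x y) :
    y ^ 2 = x ^ 3 - 432 * algebraMap ℚ F n ^ 2 :=
  equation_iff_sq.mp h.1

/-- The point with given affine coordinates. -/
def mkPoint [NeZero n] (x y : F) (h : y ^ 2 = x ^ 3 - 432 * algebraMap ℚ F n ^ 2) : EPoint n F :=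
  .some x y (nonsingular_of_sq h)

theorem mkPoint_inj [NeZero n] {x y x' y' : F} {h : y ^ 2 = x ^ 3 - 432 * algebraMap ℚ F n ^ 2}
    {h' : y' ^ 2 = x' ^ 3 - 432 * algebraMap ℚ F n ^ 2} :
    mkPoint x y h = mkPoint x' y' h' ↔ x = x' ∧ y = y' := by
  simp [mkPoint]

theorem mkPoint_ne_zero [NeZero n] {x y : F} {h : y ^ 2 = x ^ 3 - 432 * algebraMap ℚ F n ^ 2} :
    mkPoint x y h ≠ 0 := Point.some_ne_zero _

theorem EPoint.cases [NeZero n] (P : EPoint n F) :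
    P = 0 ∨ ∃ x y h, P = mkPoint x y h := by
  cases P with
  | zero => exact .inl rfl
  | some x y h => exact .inr ⟨x, y, sq_of_nonsingular h, rfl⟩

theorem neg_mkPoint [NeZero n] {x y : F} (h : y ^ 2 = x ^ 3 - 432 * algebraMap ℚ F n ^ 2) :
    -mkPoint x y h = mkPoint x (-y) (by rw [neg_sq, h]) := by
  simp only [mkPoint, Point.neg_some, negY_eq]

theorem scale_eq {w x y : F} (hw : w ^ 3 = 1) (h : y ^ 2 = x ^ 3 - 432 * algebraMap ℚ F n ^ 2) :
    y ^ 2 = (w * x) ^ 3 - 432 * algebraMap ℚ F n ^ 2 := by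
  rw [mul_pow, hw, one_mul, h]

theorem y_ne_zero_of_x_eq_zero [NeZero n] {x y : F}
    (h : y ^ 2 = x ^ 3 - 432 * algebraMap ℚ F n ^ 2) (hx : x = 0) : y ≠ 0 := by
  have : CharZero F := algebraRat.charZero F
  rintro rfl
  have h' : (432 : F) * algebraMap ℚ F n ^ 2 = 0 := by rw [hx] at h; linear_combination h
  exact mul_ne_zero (by norm_num) (pow_ne_zero 2 algebraMap_rat_ne_zero) h'

theorem kernelPoint_eq {w : F} (hw : w ^ 2 + w + 1 = 0) :
    (12 * algebraMap ℚ F n * (w - w ^ 2)) ^ 2 = 0 ^ 3 - 432 * algebraMap ℚ F n ^ 2 := by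
  linear_combination (144 * algebraMap ℚ F n ^ 2 * (w ^ 2 - 3 * w + 3)) * hw

theorem cubicPoint_add_ne_zero [NeZero n] {u v : F} (h : u ^ 3 + v ^ 3 = algebraMap ℚ F n) :
    u + v ≠ 0 := by
  intro h0
  refine (algebraMap_rat_ne_zero : algebraMap ℚ F n ≠ 0) ?_
  linear_combination -h + (u ^ 2 - u * v + v ^ 2) * h0

theorem cubicPoint_eq [NeZero n] {u v : F} (h : u ^ 3 + v ^ 3 = algebraMap ℚ F n) :
    (36 * algebraMap ℚ F n * (u - v) / (u + v)) ^ 2 =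
      (12 * algebraMap ℚ F n / (u + v)) ^ 3 - 432 * algebraMap ℚ F n ^ 2 := by
  have h0 := cubicPoint_add_ne_zero h
  field_simp
  linear_combination (1728 * algebraMap ℚ F n ^ 2) * h

theorem cubicPoint_rotate {w u v : F} (hw : w ^ 3 = 1) (h : u ^ 3 + v ^ 3 = algebraMap ℚ F n) :
    (w * u) ^ 3 + (w ^ 2 * v) ^ 3 = algebraMap ℚ F n := by
  rw [mul_pow, mul_pow, hw, sq_cube hw, one_mul, one_mul, h]

/-- The point of `Y² = X³ - 432 n²` corresponding to the point `(u, v)` of `u³ + v³ = n`. -/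
def cubicPoint [NeZero n] (u v : F) (h : u ^ 3 + v ^ 3 = algebraMap ℚ F n) : EPoint n F :=
  mkPoint _ _ (cubicPoint_eq h)

theorem cubicPoint_inj [NeZero n] {u v u' v' : F} {h : u ^ 3 + v ^ 3 = algebraMap ℚ F n}
    {h' : u' ^ 3 + v' ^ 3 = algebraMap ℚ F n} :
    cubicPoint u v h = cubicPoint u' v' h' ↔ u = u' ∧ v = v' := by
  have : CharZero F := algebraRat.charZero F
  refine ⟨fun e => ?_, fun ⟨h₁, h₂⟩ => by subst h₁ h₂; rfl⟩
  have h0 := cubicPoint_add_ne_zero h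
  have h0' := cubicPoint_add_ne_zero h'
  have hn : algebraMap ℚ F n ≠ 0 := algebraMap_rat_ne_zero
  rw [cubicPoint, cubicPoint, mkPoint_inj] at e
  obtain ⟨e₁, e₂⟩ := e
  have hs : u + v = u' + v' := by
    field_simp at e₁
    exact e₁.symm
  rw [hs] at e₂
  have hd : u - v = u' - v' := by
    field_simp at e₂
    exact e₂
  exact ⟨by linear_combination (hs + hd) / 2, by linear_combination (hs - hd) / 2⟩

variable [DecidableEq F]

theorem mkPoint_add_of_ne [NeZero n] {x₁ y₁ x₂ y₂ x₃ y₃ : F} {h₁ h₂ h₃} (m : F) (hx : x₁ ≠ x₂)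
    (hm : m * (x₁ - x₂) = y₁ - y₂) (hx₃ : x₃ = m ^ 2 - x₁ - x₂) (hy₃ : y₃ = -(m * (x₃ - x₁) + y₁)) :
    mkPoint (n := n) x₁ y₁ h₁ + mkPoint x₂ y₂ h₂ = mkPoint x₃ y₃ h₃ := by
  have hs : ((cubeSumCurve n).baseChange F).toAffine.slope x₁ x₂ y₁ y₂ = m := by
    rw [slope_of_X_ne hx, div_eq_iff (sub_ne_zero.mpr hx), hm]
  simp only [mkPoint, Point.add_of_X_ne hx, hs, Point.some.injEq]
  have hX : ((cubeSumCurve n).baseChange F).toAffine.addX x₁ x₂ m = x₃ := by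
    simp [addX, hx₃, cubeSumCurve, WeierstrassCurve.baseChange, WeierstrassCurve.map]
  refine ⟨hX, ?_⟩
  rw [addY, negAddY, hX, negY_eq, hy₃]

theorem mkPoint_add_self [NeZero n] {x₁ y₁ x₃ y₃ : F} {h₁ h₃} (m : F) (hy : y₁ ≠ 0)
    (hm : m * (2 * y₁) = 3 * x₁ ^ 2) (hx₃ : x₃ = m ^ 2 - x₁ - x₁)
    (hy₃ : y₃ = -(m * (x₃ - x₁) + y₁)) :
    mkPoint (n := n) x₁ y₁ h₁ + mkPoint x₁ y₁ h₁ = mkPoint x₃ y₃ h₃ := by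
  have : CharZero F := algebraRat.charZero F
  have hy' : y₁ ≠ ((cubeSumCurve n).baseChange F).toAffine.negY x₁ y₁ := by
    rw [negY_eq]
    intro h
    exact hy (by linear_combination h / 2)
  have hs : ((cubeSumCurve n).baseChange F).toAffine.slope x₁ x₁ y₁ y₁ = m := by
    rw [slope_of_Y_ne rfl hy', negY_eq, div_eq_iff (by simpa [← two_mul] using hy)]
    simp [cubeSumCurve, WeierstrassCurve.baseChange, WeierstrassCurve.map]
    linear_combination -hm
  simp only [mkPoint, Point.add_self_of_Y_ne hy', hs, Point.some.injEq]
  have hX : ((cubeSumCurve n).baseChange F).toAffine.addX x₁ x₁ m = x₃ := by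
    simp [addX, hx₃, cubeSumCurve, WeierstrassCurve.baseChange, WeierstrassCurve.map]
  refine ⟨hX, ?_⟩
  rw [addY, negAddY, hX, negY_eq, hy₃]

theorem mkPoint_add_neg [NeZero n] {x₁ y₁ x₂ y₂ : F} {h₁ h₂} (hx : x₁ = x₂) (hy : y₁ = -y₂) :
    mkPoint (n := n) x₁ y₁ h₁ + mkPoint x₂ y₂ h₂ = 0 :=
  Point.add_of_Y_eq hx (by rw [negY_eq, hy])

/-- Every pair of affine points falls under one of the three cases of the addition law. -/
theorem mkPoint_trichotomy [NeZero n] {x₁ y₁ x₂ y₂ : F}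
    (h₁ : y₁ ^ 2 = x₁ ^ 3 - 432 * algebraMap ℚ F n ^ 2)
    (h₂ : y₂ ^ 2 = x₂ ^ 3 - 432 * algebraMap ℚ F n ^ 2) :
    x₁ ≠ x₂ ∨ (x₁ = x₂ ∧ y₁ = -y₂) ∨ (x₁ = x₂ ∧ y₁ = y₂ ∧ y₁ ≠ 0) := by
  by_cases hx : x₁ = x₂
  · subst hx
    have : (y₁ - y₂) * (y₁ + y₂) = 0 := by linear_combination h₁ - h₂
    rcases mul_eq_zero.mp this with h | h
    · have h' : y₁ = y₂ := sub_eq_zero.mp h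
      by_cases hy : y₁ = 0
      · refine .inr (.inl ⟨rfl, ?_⟩)
        rw [← h', hy, neg_zero]
      · exact .inr (.inr ⟨rfl, h', hy⟩)
    · exact .inr (.inl ⟨rfl, eq_neg_of_add_eq_zero_left h⟩)
  · exact .inl hx

variable {F' : Type*} [Field F'] [Algebra ℚ F'] [DecidableEq F']

theorem map_mkPoint [NeZero n] (σ : F →ₐ[ℚ] F') {x y : F}
    (h : y ^ 2 = x ^ 3 - 432 * algebraMap ℚ F n ^ 2) :
    Point.map (W' := cubeSumCurve n) σ (mkPoint x y h) =
      mkPoint (σ x) (σ y) (by rw [← map_pow, h, map_sub, map_mul, map_pow, map_pow, σ.commutes, map_ofNat]) := rfl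

/-! #### The automorphisms `(x, y) ↦ (w x, y)` for `w³ = 1` -/

/-- The automorphism `(x, y) ↦ (w x, y)` of the curve, where `w` is a cube root of unity. -/
def scale [NeZero n] (w : F) (hw : w ^ 3 = 1) : EPoint n F →+ EPoint n F where
  toFun P := match P with
    | .zero => 0
    | .some x y h => mkPoint (w * x) y (scale_eq hw (sq_of_nonsingular h))
  map_zero' := rfl
  map_add' P Q := by
    have hw0 : w ≠ 0 := by rintro rfl; simp at hw
    rcases P.cases with rfl | ⟨x₁, y₁, h₁, rfl⟩
    · rw [zero_add]; exact (zero_add _).symm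
    rcases Q.cases with rfl | ⟨x₂, y₂, h₂, rfl⟩
    · rw [add_zero]; exact (add_zero _).symm
    change _ = mkPoint _ _ (scale_eq hw h₁) + mkPoint _ _ (scale_eq hw h₂)
    rcases mkPoint_trichotomy h₁ h₂ with hx | ⟨hx, hy⟩ | ⟨rfl, rfl, hy⟩
    · obtain ⟨m, hm⟩ : ∃ m, m * (x₁ - x₂) = y₁ - y₂ :=
        ⟨(y₁ - y₂) / (x₁ - x₂), div_mul_cancel₀ _ (sub_ne_zero.mpr hx)⟩
      have h₃ : (-(m * (m ^ 2 - x₁ - x₂ - x₁) + y₁)) ^ 2 =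
          (m ^ 2 - x₁ - x₂) ^ 3 - 432 * algebraMap ℚ F n ^ 2 := by
        have key : (m * (m ^ 2 - x₁ - x₂ - x₁) + y₁) ^ 2 -
          ((m ^ 2 - x₁ - x₂) ^ 3 - 432 * algebraMap ℚ F n ^ 2) = 0 := by
          apply (mul_eq_zero.mp (?_ : (x₁ - x₂) * _ = 0)).resolve_left (sub_ne_zero.mpr hx)
          linear_combination (exp := 1) (2 * x₁ + x₂ - m ^ 2) * h₂ +
            (m ^ 2 - 2 * x₂ - x₁) * h₁ +
            ((m ^ 2 - 2 * x₁ - x₂) * (-m * (x₁ - x₂) + (y₁ + y₂))) * hm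
        linear_combination key
      -- Multiplying the abscissas by w divides the slope m by w, which gives m w².
      rw [mkPoint_add_of_ne (h₃ := h₃) m hx hm rfl rfl,
        mkPoint_add_of_ne (h₃ := scale_eq hw h₃) (m * w ^ 2) (by simpa [hw0] using hx)
          (by linear_combination m * (x₁ - x₂) * hw + hm)
          (by linear_combination -(m ^ 2 * w) * hw)
          (by linear_combination m * (m ^ 2 - x₁ - x₂ - x₁) * hw)]
      rfl
    · rw [mkPoint_add_neg hx hy, mkPoint_add_neg (by rw [hx]) hy]
    · obtain ⟨m, hm⟩ : ∃ m, m * (2 * y₁) = 3 * x₁ ^ 2 := by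
        have : CharZero F := algebraRat.charZero F
        exact ⟨3 * x₁ ^ 2 / (2 * y₁), div_mul_cancel₀ _ (by simpa using hy)⟩
      have h₃ : (-(m * (m ^ 2 - x₁ - x₁ - x₁) + y₁)) ^ 2 =
          (m ^ 2 - x₁ - x₁) ^ 3 - 432 * algebraMap ℚ F n ^ 2 := by
        linear_combination h₁ + (m ^ 2 - 3 * x₁) * hm
      rw [mkPoint_add_self (h₃ := h₃) m hy hm rfl rfl,
        mkPoint_add_self (h₃ := scale_eq hw h₃) (m * w ^ 2) hy
          (by linear_combination w ^ 2 * hm)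
          (by linear_combination -(m ^ 2 * w) * hw)
          (by linear_combination m * (m ^ 2 - x₁ - x₁ - x₁) * hw)]
      rfl

theorem scale_mkPoint [NeZero n] {w x y : F} (hw : w ^ 3 = 1)
    (h : y ^ 2 = x ^ 3 - 432 * algebraMap ℚ F n ^ 2) :
    scale w hw (mkPoint x y h) = mkPoint (w * x) y (scale_eq hw h) := rfl

theorem map_scale [NeZero n] (σ : F →ₐ[ℚ] F') {w : F} (hw : w ^ 3 = 1) (P : EPoint n F) :
    Point.map (W' := cubeSumCurve n) σ (scale w hw P) =
      scale (σ w) (by rw [← map_pow, hw, map_one]) (Point.map (W' := cubeSumCurve n) σ P) := by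
  rcases P.cases with rfl | ⟨x, y, h, rfl⟩
  · rfl
  · simp only [scale_mkPoint, map_mkPoint, map_mul]

theorem scale_scale [NeZero n] {w w' : F} (hw : w ^ 3 = 1) (hw' : w' ^ 3 = 1) (P : EPoint n F) :
    scale w hw (scale w' hw' P) = scale (w * w') (by rw [mul_pow, hw, hw', one_mul]) P := by
  rcases P.cases with rfl | ⟨x, y, h, rfl⟩
  · rfl
  · simp only [scale_mkPoint, mul_assoc]

theorem scale_one [NeZero n] (P : EPoint n F) (h1 : (1 : F) ^ 3 = 1) : scale 1 h1 P = P := by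
  rcases P.cases with rfl | ⟨x, y, h, rfl⟩
  · rfl
  · simp only [scale_mkPoint, one_mul]

/-- `1 + [w] + [w²] = 0` for a primitive cube root of unity `w`. -/
theorem add_scale_add_scale [NeZero n] {w : F} (hw : w ^ 2 + w + 1 = 0) (P : EPoint n F) :
    P + scale w (cube_eq_one_of_sq_add hw) P + scale (w ^ 2) (sq_cube_eq_one_of_sq_add hw) P = 0 := by
  have : CharZero F := algebraRat.charZero F
  rcases P.cases with rfl | ⟨x, y, h, rfl⟩
  · simp
  simp only [scale_mkPoint]
  have hneg : (-y) ^ 2 = (w ^ 2 * x) ^ 3 - 432 * algebraMap ℚ F n ^ 2 := by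
    rw [neg_sq]; exact scale_eq (sq_cube_eq_one_of_sq_add hw) h
  -- The three points (x, y), (w x, y), (w² x, y) lie on the horizontal line Y = y, whence the slope
  -- 0. For x = 0 they coincide in a flex with this line as tangent.
  have : mkPoint x y h + mkPoint (w * x) y (scale_eq (cube_eq_one_of_sq_add hw) h) =
      mkPoint (w ^ 2 * x) (-y) hneg := by
    by_cases hx : x = 0
    · subst hx
      simp only [mul_zero]
      exact mkPoint_add_self 0 (y_ne_zero_of_x_eq_zero h rfl) (by ring) (by ring) (by ring)
    · apply mkPoint_add_of_ne 0 _ (by ring) (by linear_combination x * hw) (by ring)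
      intro hxw
      exact ne_one_of_sq_add hw (mul_right_cancel₀ hx (by rw [one_mul]; exact hxw.symm))
  rw [this, mkPoint_add_neg rfl rfl]

/-- The endomorphism `[w] - [w²]`, a square root of `-3`, for a primitive cube root of unity `w`. -/
def sqrtNegThree [NeZero n] (w : F) (hw : w ^ 2 + w + 1 = 0) : EPoint n F →+ EPoint n F :=
  scale w (cube_eq_one_of_sq_add hw) - scale (w ^ 2) (sq_cube_eq_one_of_sq_add hw)

theorem sqrtNegThree_apply [NeZero n] {w : F} (hw : w ^ 2 + w + 1 = 0) (P : EPoint n F) :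
    sqrtNegThree w hw P = scale w (cube_eq_one_of_sq_add hw) P -
      scale (w ^ 2) (sq_cube_eq_one_of_sq_add hw) P := rfl

/-- This is (w - w²)² = -3 in the endomorphism ring. It follows that √-3 maps E[3] into ker √-3. -/
theorem sqrtNegThree_sqrtNegThree [NeZero n] {w : F} (hw : w ^ 2 + w + 1 = 0) (P : EPoint n F) :
    sqrtNegThree w hw (sqrtNegThree w hw P) = -((3 : ℤ) • P) := by
  have hw3 := cube_eq_one_of_sq_add hw
  have h := add_scale_add_scale hw P
  simp only [sqrtNegThree_apply, map_sub, scale_scale]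
  have e1 : scale (w * w ^ 2) (by rw [mul_pow, hw3, sq_cube_eq_one_of_sq_add hw, one_mul]) P = P := by
    simp only [show w * w ^ 2 = 1 by rw [← hw3]; ring, scale_one]
  have e2 : scale (w ^ 2 * w) (by rw [mul_pow, hw3, sq_cube_eq_one_of_sq_add hw, one_mul]) P = P := by
    simp only [show w ^ 2 * w = 1 by rw [← hw3]; ring, scale_one]
  have e3 : scale (w ^ 2 * w ^ 2)
      (by rw [mul_pow, sq_cube_eq_one_of_sq_add hw, one_mul]) P = scale w hw3 P := by
    simp only [show w ^ 2 * w ^ 2 = w by linear_combination w * hw3]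
  have e4 : scale (w * w) (by rw [mul_pow, hw3, one_mul]) P =
      scale (w ^ 2) (sq_cube_eq_one_of_sq_add hw) P := by
    simp only [← sq]
  rw [e1, e2, e3, e4]
  have h' : scale (w ^ 2) (sq_cube_eq_one_of_sq_add hw) P = -P - scale w hw3 P := by
    rw [← sub_eq_zero, ← h]; abel
  rw [h']
  abel

theorem map_sqrtNegThree [NeZero n] (σ : F →ₐ[ℚ] F') {w : F} (hw : w ^ 2 + w + 1 = 0)
    {w' : F'} (hw' : w' ^ 2 + w' + 1 = 0) (hσ : σ w = w') (P : EPoint n F) :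
    Point.map (W' := cubeSumCurve n) σ (sqrtNegThree w hw P) =
      sqrtNegThree w' hw' (Point.map (W' := cubeSumCurve n) σ P) := by
  subst hσ
  simp only [sqrtNegThree_apply, map_sub, map_scale, map_pow]

/-- The endomorphism √-3 is defined over ℚ(w) only: conjugating w interchanges [w] and [w²]. This
sign is what makes the Galois action on E[3]/ker √-3 trivial. -/
theorem map_sqrtNegThree_of_conj [NeZero n] (σ : F →ₐ[ℚ] F') {w : F} (hw : w ^ 2 + w + 1 = 0)
    {w' : F'} (hw' : w' ^ 2 + w' + 1 = 0) (hσ : σ w = w' ^ 2) (P : EPoint n F) :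
    Point.map (W' := cubeSumCurve n) σ (sqrtNegThree w hw P) =
      -sqrtNegThree w' hw' (Point.map (W' := cubeSumCurve n) σ P) := by
  have e : (w' ^ 2) ^ 2 = w' := by linear_combination w' * cube_eq_one_of_sq_add hw'
  simp only [sqrtNegThree_apply, map_sub, map_scale, map_pow, hσ, e, neg_sub]

/-! #### The kernel of `√-3` -/

/-- The isomorphism `μ₃ ≅ ker √-3`: it sends `1` to `0` and a primitive cube root of unity `w` to
`(0, 12 n (w - w²))`. (Elements `w` that are no cube roots of unity are sent to `0`.) -/
def kernelPoint (n : ℚ) [NeZero n] (w : F) : EPoint n F :=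
  if h : w ^ 2 + w + 1 = 0 then mkPoint 0 _ (kernelPoint_eq h) else 0

theorem kernelPoint_of_sq_add [NeZero n] {w : F} (hw : w ^ 2 + w + 1 = 0) :
    kernelPoint n w = mkPoint 0 _ (kernelPoint_eq hw) := dif_pos hw

theorem kernelPoint_one [NeZero n] : kernelPoint n (1 : F) = 0 := by
  have : CharZero F := algebraRat.charZero F
  exact dif_neg (by norm_num)

theorem map_kernelPoint [NeZero n] (σ : F →ₐ[ℚ] F') {w : F} (hw : w ^ 3 = 1) :
    Point.map (W' := cubeSumCurve n) σ (kernelPoint n w) = kernelPoint n (σ w) := by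
  by_cases h1 : w = 1
  · rw [h1, map_one, kernelPoint_one, kernelPoint_one, map_zero]
  · have h := sq_add_of_cube_eq_one hw h1
    have h' : (σ w) ^ 2 + σ w + 1 = 0 := by
      simpa only [map_add, map_pow, map_one, map_zero] using congrArg σ h
    rw [kernelPoint_of_sq_add h, kernelPoint_of_sq_add h', map_mkPoint, mkPoint_inj]
    simp only [map_zero, map_mul, map_sub, map_pow, AlgHom.commutes, map_ofNat, true_and]

theorem kernelPoint_injective [NeZero n] {w w' : F} (hw : w ^ 3 = 1) (hw' : w' ^ 3 = 1)
    (h : kernelPoint n w = kernelPoint n w') : w = w' := by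
  have : CharZero F := algebraRat.charZero F
  by_cases h1 : w = 1
  · by_cases h2 : w' = 1
    · rw [h1, h2]
    · rw [h1, kernelPoint_one, kernelPoint_of_sq_add (sq_add_of_cube_eq_one hw' h2)] at h
      exact absurd h.symm mkPoint_ne_zero
  · have e := sq_add_of_cube_eq_one hw h1
    by_cases h2 : w' = 1
    · rw [h2, kernelPoint_one, kernelPoint_of_sq_add e] at h
      exact absurd h mkPoint_ne_zero
    · have e' := sq_add_of_cube_eq_one hw' h2
      rw [kernelPoint_of_sq_add e, kernelPoint_of_sq_add e', mkPoint_inj] at h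
      have hn : (12 * algebraMap ℚ F n) ≠ 0 :=
        mul_ne_zero (by norm_num) algebraMap_rat_ne_zero
      have := mul_left_cancel₀ hn h.2
      linear_combination (this + e - e') / 2

theorem kernelPoint_mul [NeZero n] {w w' : F} (hw : w ^ 3 = 1) (hw' : w' ^ 3 = 1) :
    kernelPoint n (w * w') = kernelPoint n w + kernelPoint n w' := by
  have : CharZero F := algebraRat.charZero F
  by_cases h1 : w = 1
  · rw [h1, one_mul, kernelPoint_one, zero_add]
  by_cases h2 : w' = 1
  · rw [h2, mul_one, kernelPoint_one, add_zero]
  have e := sq_add_of_cube_eq_one hw h1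
  have e' := sq_add_of_cube_eq_one hw' h2
  -- Two primitive cube roots of unity are equal or inverse to each other; the first case is a
  -- doubling, the second a sum of opposite points.
  have : (w - w') * (w' - w ^ 2) = 0 := by linear_combination (w' - w + 1) * e - e'
  rcases mul_eq_zero.mp this with h | h
  · obtain rfl := sub_eq_zero.mp h
    have e2 : (w * w) ^ 2 + w * w + 1 = 0 := by linear_combination (w ^ 2 - w + 1) * e
    rw [kernelPoint_of_sq_add e, kernelPoint_of_sq_add e2]
    refine (mkPoint_add_self 0 (y_ne_zero_of_x_eq_zero (kernelPoint_eq e) rfl)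
      (by ring) (by ring) ?_).symm
    linear_combination -12 * algebraMap ℚ F n * w * hw
  · obtain rfl := sub_eq_zero.mp h
    rw [show w * w ^ 2 = 1 by rw [← hw]; ring, kernelPoint_one, kernelPoint_of_sq_add e,
      kernelPoint_of_sq_add e', mkPoint_add_neg rfl]
    linear_combination -12 * algebraMap ℚ F n * w * hw

theorem kernelPoint_sq [NeZero n] {w : F} (hw : w ^ 3 = 1) :
    kernelPoint n (w ^ 2) = -kernelPoint n w := by
  rw [eq_neg_iff_add_eq_zero, ← kernelPoint_mul (sq_cube hw) hw,
    show w ^ 2 * w = 1 by rw [← hw]; ring, kernelPoint_one]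

theorem exists_kernelPoint_of_x_eq_zero [NeZero n] {w : F} (hw : w ^ 2 + w + 1 = 0) {y : F}
    (h : y ^ 2 = 0 ^ 3 - 432 * algebraMap ℚ F n ^ 2) :
    ∃ w' : F, w' ^ 3 = 1 ∧ mkPoint 0 y h = kernelPoint n w' := by
  have h' := kernelPoint_eq (n := n) hw
  have hw3 := cube_eq_one_of_sq_add hw
  rcases sq_eq_sq_iff_eq_or_eq_neg.mp (h.trans h'.symm) with rfl | rfl
  · exact ⟨w, hw3, (kernelPoint_of_sq_add hw).symm⟩
  · refine ⟨w ^ 2, sq_cube hw3, ?_⟩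
    rw [kernelPoint_sq hw3, kernelPoint_of_sq_add hw, neg_mkPoint]

theorem exists_kernelPoint_of_sqrtNegThree_eq_zero [NeZero n] {w : F} (hw : w ^ 2 + w + 1 = 0)
    {P : EPoint n F} (hP : sqrtNegThree w hw P = 0) :
    ∃ w' : F, w' ^ 3 = 1 ∧ P = kernelPoint n w' := by
  have : CharZero F := algebraRat.charZero F
  rcases P.cases with rfl | ⟨x, y, h, rfl⟩
  · exact ⟨1, one_pow _, kernelPoint_one.symm⟩
  rw [sqrtNegThree_apply, sub_eq_zero, scale_mkPoint, scale_mkPoint, mkPoint_inj] at hP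
  have hx : x = 0 := by
    have hw0 : w ≠ 0 := by rintro rfl; simp at hw
    have : (w * (1 - w)) * x = 0 := by linear_combination hP.1
    refine (mul_eq_zero.mp this).resolve_left (mul_ne_zero hw0 ?_)
    exact sub_ne_zero.mpr (ne_one_of_sq_add hw).symm
  subst hx
  exact exists_kernelPoint_of_x_eq_zero hw h

/-! #### The parametrization by the cubic `u³ + v³ = n` -/

theorem map_cubicPoint [NeZero n] (σ : F →ₐ[ℚ] F') {u v : F}
    (h : u ^ 3 + v ^ 3 = algebraMap ℚ F n) :
    Point.map (W' := cubeSumCurve n) σ (cubicPoint u v h) =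
      cubicPoint (σ u) (σ v) (by rw [← map_pow, ← map_pow, ← map_add, h, σ.commutes]) := by
  rw [cubicPoint, cubicPoint, map_mkPoint, mkPoint_inj]
  simp only [map_div₀, map_mul, map_add, map_sub, map_ofNat, AlgHom.commutes, and_self]

/-- The points at infinity of u³ + v³ = n are those of ker √-3. All others have X ≠ 0, where the
change of coordinates can be inverted. -/
theorem exists_cubicPoint [NeZero n] {w : F} (hw : w ^ 2 + w + 1 = 0) (P : EPoint n F) :
    (∃ w' : F, w' ^ 3 = 1 ∧ P = kernelPoint n w') ∨ ∃ u v h, P = cubicPoint u v h := by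
  have : CharZero F := algebraRat.charZero F
  rcases P.cases with rfl | ⟨x, y, h, rfl⟩
  · exact .inl ⟨1, one_pow _, kernelPoint_one.symm⟩
  by_cases hx : x = 0
  · subst hx
    exact .inl (exists_kernelPoint_of_x_eq_zero hw h)
  · have hn : algebraMap ℚ F n ≠ 0 := algebraMap_rat_ne_zero
    refine .inr ⟨(36 * algebraMap ℚ F n + y) / (6 * x), (36 * algebraMap ℚ F n - y) / (6 * x), ?_, ?_⟩
    · field_simp
      linear_combination (216 * algebraMap ℚ F n) * h
    · have hs : (36 * algebraMap ℚ F n + y) / (6 * x) + (36 * algebraMap ℚ F n - y) / (6 * x) =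
          12 * algebraMap ℚ F n / x := by field_simp; ring
      have hd : (36 * algebraMap ℚ F n + y) / (6 * x) - (36 * algebraMap ℚ F n - y) / (6 * x) =
          y / (3 * x) := by field_simp; ring
      rw [cubicPoint, mkPoint_inj, hs, hd]
      constructor <;> field_simp
      ring

/-- Translation by ker √-3 is diagonal in the coordinates of the cubic. This turns the action of
Galois on a torsor under ker √-3 into Kummer theory for u and v. -/
theorem cubicPoint_add_kernelPoint [NeZero n] {w u v : F} (hw : w ^ 3 = 1)
    (h : u ^ 3 + v ^ 3 = algebraMap ℚ F n) :
    cubicPoint u v h + kernelPoint n w =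
      cubicPoint (w * u) (w ^ 2 * v) (cubicPoint_rotate hw h) := by
  have : CharZero F := algebraRat.charZero F
  have hn : algebraMap ℚ F n ≠ 0 := algebraMap_rat_ne_zero
  by_cases h1 : w = 1
  · subst h1
    rw [kernelPoint_one, add_zero, cubicPoint_inj]
    simp
  have e := sq_add_of_cube_eq_one hw h1
  have h0 := cubicPoint_add_ne_zero h
  have h0' := cubicPoint_add_ne_zero (cubicPoint_rotate hw h)
  have hw2 : w ^ 2 = -1 - w := by linear_combination e
  rw [kernelPoint_of_sq_add e, cubicPoint, cubicPoint]
  -- Factoring n = u³ + v³ into three linear forms makes all coordinates polynomial in u, v and w.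
  have hnn : algebraMap ℚ F n = (u + v) * (w * u + w ^ 2 * v) * (w ^ 2 * u + w * v) := by
    rw [← h]
    grind
  have hX : 12 * algebraMap ℚ F n / (u + v) = 12 * (w * u + w ^ 2 * v) * (w ^ 2 * u + w * v) := by
    rw [div_eq_iff h0, hnn]; ring
  have hY : 36 * algebraMap ℚ F n * (u - v) / (u + v) =
      36 * (u - v) * (w * u + w ^ 2 * v) * (w ^ 2 * u + w * v) := by
    rw [div_eq_iff h0, hnn]; ring
  have hX' : 12 * algebraMap ℚ F n / (w * u + w ^ 2 * v) = 12 * (u + v) * (w ^ 2 * u + w * v) := by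
    rw [div_eq_iff h0', hnn]; ring
  have hY' : 36 * algebraMap ℚ F n * (w * u - w ^ 2 * v) / (w * u + w ^ 2 * v) =
      36 * (w * u - w ^ 2 * v) * (u + v) * (w ^ 2 * u + w * v) := by
    rw [div_eq_iff h0', hnn]; ring
  -- The slope is (Y - 12 n (w - w²)) / X with X = 12 n / (u + v) and Y = 3 (u - v) X.
  refine mkPoint_add_of_ne (3 * (u - v) - (w - w ^ 2) * (u + v)) ?_ ?_ ?_ ?_
  · exact div_ne_zero (mul_ne_zero (by norm_num) hn) h0
  · field_simp
    ring
  · rw [hX, hX']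
    clear hX hY hX' hY'
    grind
  · rw [hX, hX', hY, hY']
    clear hX hY hX' hY'
    grind

/-! #### Three-torsion -/

/-- The tangent u = t meets the cubic in the triple point (t, 0), which is therefore a flex. Here 6
t is the slope 3 X² / (2 Y) at X = 12 t², Y = 36 t³. -/
theorem three_zsmul_cubicPoint [NeZero n] {t : F} (h : t ^ 3 + 0 ^ 3 = algebraMap ℚ F n) :
    (3 : ℤ) • cubicPoint t 0 h = 0 := by
  have : CharZero F := algebraRat.charZero F
  have hn : algebraMap ℚ F n ≠ 0 := algebraMap_rat_ne_zero
  have ht : t ≠ 0 := by simpa using cubicPoint_add_ne_zero h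
  have hn' : algebraMap ℚ F n = t ^ 3 := by rw [← h]; ring
  have hd : cubicPoint t 0 h + cubicPoint t 0 h = -cubicPoint t 0 h := by
    rw [cubicPoint, neg_mkPoint]
    refine mkPoint_add_self (6 * t) ?_ ?_ ?_ ?_
    · exact div_ne_zero (mul_ne_zero (mul_ne_zero (by norm_num) hn) (by simpa using ht))
        (by simpa using ht)
    all_goals
      simp only [hn', sub_zero, add_zero]
      field_simp
      ring
  rw [show (3 : ℤ) = 1 + 1 + 1 by norm_num, add_zsmul, add_zsmul, one_zsmul, hd, neg_add_cancel]

/-- Comparing the X-coordinates in 2 P = -P yields u v (u + v) = 0, and u + v is nonzero at affine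
points of the cubic. -/
theorem eq_zero_or_eq_zero_of_three_zsmul [NeZero n] {u v : F}
    (h : u ^ 3 + v ^ 3 = algebraMap ℚ F n) (h3 : (3 : ℤ) • cubicPoint u v h = 0) :
    u = 0 ∨ v = 0 := by
  have : CharZero F := algebraRat.charZero F
  have hn : algebraMap ℚ F n ≠ 0 := algebraMap_rat_ne_zero
  have h0 := cubicPoint_add_ne_zero h
  have hd : cubicPoint u v h + cubicPoint u v h = -cubicPoint u v h := by
    rw [eq_neg_iff_add_eq_zero, ← h3, show (3 : ℤ) = 1 + 1 + 1 by norm_num, add_zsmul, add_zsmul,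
      one_zsmul]
  have hu : u - v ≠ 0 := by
    intro e
    rw [cubicPoint, mkPoint_add_neg rfl (by rw [e]; simp), neg_mkPoint] at hd
    exact mkPoint_ne_zero hd.symm
  -- The tangent slope 3 X² / (2 Y), written in the coordinates u and v.
  set m : F := 2 * algebraMap ℚ F n * 3 / ((u + v) * (u - v)) with hm
  have h3' : (-(m * (m ^ 2 - 12 * algebraMap ℚ F n / (u + v) - 12 * algebraMap ℚ F n / (u + v)
      - 12 * algebraMap ℚ F n / (u + v)) + 36 * algebraMap ℚ F n * (u - v) / (u + v))) ^ 2 =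
      (m ^ 2 - 12 * algebraMap ℚ F n / (u + v) - 12 * algebraMap ℚ F n / (u + v)) ^ 3
        - 432 * algebraMap ℚ F n ^ 2 := by
    have hm2 : m * (2 * (36 * algebraMap ℚ F n * (u - v) / (u + v))) =
      3 * (12 * algebraMap ℚ F n / (u + v)) ^ 2 := by rw [hm]; field_simp; ring
    linear_combination cubicPoint_eq h + (m ^ 2 - 3 * (12 * algebraMap ℚ F n / (u + v))) * hm2
  rw [cubicPoint, mkPoint_add_self (h₃ := h3') m
    (div_ne_zero (mul_ne_zero (mul_ne_zero (by norm_num) hn) hu) h0)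
    (by rw [hm]; field_simp; ring) rfl rfl, neg_mkPoint, mkPoint_inj] at hd
  have hx := hd.1
  rw [hm] at hx
  field_simp at hx
  have h4 : u * v * (u + v) = 0 := by
    linear_combination h + hx / 36
  rcases mul_eq_zero.mp h4 with h5 | h5
  · exact mul_eq_zero.mp h5
  · exact absurd h5 h0

end Geometry

end CubeSum

namespace CubeSum

open WeierstrassCurve.Affine

/-! ### Descent to twisted cubics -/

section Twist

variable {n : ℚ} [NeZero n] {F : Type*} [Field F] [Algebra ℚ F] [DecidableEq F]

/-- If `P` is moved by a set of automorphisms by the `ker √-3`-valued function that describes their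
action on `θ`, then `P` descends to a point of the cubic `θ³ r³ + θ⁶ s³ = n`. -/
theorem exists_descent {w : F} (hw : w ^ 2 + w + 1 = 0) (H : Set (F →ₐ[ℚ] F)) (P : EPoint n F)
    {θ : F} (hθ : θ ≠ 0)
    (h : ∀ σ ∈ H, ∃ z : F, z ^ 3 = 1 ∧
      Point.map (W' := cubeSumCurve n) σ P = P + kernelPoint n z ∧ σ θ = z * θ) :
    (∃ r s : F, ∃ e : (θ * r) ^ 3 + (θ ^ 2 * s) ^ 3 = algebraMap ℚ F n,
      P = cubicPoint _ _ e ∧ (∀ σ ∈ H, σ r = r) ∧ ∀ σ ∈ H, σ s = s) ∨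
    ∃ g : F, θ ^ 3 = g ^ 3 ∧ ∀ σ ∈ H, σ g = g := by
  rcases exists_cubicPoint hw P with ⟨e, he, rfl⟩ | ⟨u, v, huv, rfl⟩
  -- Here P lies in ker √-3 and corresponds to e ∈ μ₃. Then σ e = e z, so θ / e is fixed and is
  -- another cube root of θ³.
  · right
    have he0 : e ≠ 0 := by rintro rfl; simp at he
    refine ⟨θ / e, by rw [div_pow, he, div_one], fun σ hσ => ?_⟩
    obtain ⟨z, hz, h₁, h₂⟩ := h σ hσ
    have hz0 : z ≠ 0 := by rintro rfl; simp at hz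
    rw [map_kernelPoint σ he, ← kernelPoint_mul he hz] at h₁
    have := kernelPoint_injective (by rw [← map_pow, he, map_one])
      (by rw [mul_pow, he, hz, one_mul]) h₁
    rw [map_div₀, h₂, this]
    field_simp
  -- Here σ u = z u and σ v = z² v, so that u / θ and v / θ² are fixed.
  · left
    have hu : θ * (u / θ) = u := by field_simp
    have hv : θ ^ 2 * (v / θ ^ 2) = v := by field_simp
    have key : ∀ σ ∈ H, σ (u / θ) = u / θ ∧ σ (v / θ ^ 2) = v / θ ^ 2 := fun σ hσ => by
      obtain ⟨z, hz, h₁, h₂⟩ := h σ hσ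
      have hz0 : z ≠ 0 := by rintro rfl; simp at hz
      rw [map_cubicPoint, cubicPoint_add_kernelPoint hz, cubicPoint_inj] at h₁
      rw [map_div₀, map_div₀, map_pow, h₁.1, h₁.2, h₂]
      constructor <;> field_simp
    refine ⟨u / θ, v / θ ^ 2, by rw [hu, hv, huv], ?_, fun σ hσ => (key σ hσ).1,
      fun σ hσ => (key σ hσ).2⟩
    rw [cubicPoint_inj, hu, hv]
    exact ⟨rfl, rfl⟩

/-- Converse of the first alternative of `exists_descent`: a point of the twisted cubic with fixed
coordinates trivializes the Kummer cocycle of θ. -/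
theorem map_cubicPoint_eq_add {θ r s z : F} (hz : z ^ 3 = 1)
    (e : (θ * r) ^ 3 + (θ ^ 2 * s) ^ 3 = algebraMap ℚ F n) (σ : F →ₐ[ℚ] F) (hθ : σ θ = z * θ)
    (hr : σ r = r) (hs : σ s = s) :
    Point.map (W' := cubeSumCurve n) σ (cubicPoint _ _ e) = cubicPoint _ _ e + kernelPoint n z := by
  rw [map_cubicPoint, cubicPoint_add_kernelPoint hz, cubicPoint_inj, map_mul, map_mul, map_pow, hθ,
    hr, hs]
  constructor <;> ring

/-- Converse of the second alternative of `exists_descent`: if θ³ has a fixed cube root, a point of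
ker √-3 already trivializes the cocycle. -/
theorem map_kernelPoint_eq_add {θ g z : F} (hθ0 : θ ≠ 0) (hz : z ^ 3 = 1) (e : θ ^ 3 = g ^ 3)
    (σ : F →ₐ[ℚ] F) (hθ : σ θ = z * θ) (hg : σ g = g) :
    Point.map (W' := cubeSumCurve n) σ (kernelPoint n (θ / g)) =
      kernelPoint n (θ / g) + kernelPoint n z := by
  have hg0 : g ≠ 0 := by
    rintro rfl
    exact hθ0 (by simpa using e)
  have h : (θ / g) ^ 3 = 1 := by rw [div_pow, e, div_self (pow_ne_zero 3 hg0)]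
  rw [map_kernelPoint σ h, ← kernelPoint_mul h hz, map_div₀, hθ, hg]
  congr 1
  ring

end Twist

/-! ### Hilbert 90 for infinite Galois extensions -/

theorem exists_finset_of_mem_nhds_one {k F : Type*} [Field k] [Field F] [Algebra k F]
    {U : Set Gal(F/k)} (hU : U ∈ nhds 1) :
    ∃ S : Finset F, ∀ σ : Gal(F/k), (∀ x ∈ S, σ x = x) → σ ∈ U := by
  rw [krullTopology_mem_nhds_one_iff] at hU
  obtain ⟨E, hE, hEU⟩ := hU
  obtain ⟨S, rfl⟩ := IntermediateField.essFiniteType_iff.mp (inferInstance : Algebra.EssFiniteType k E)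
  refine ⟨S, fun σ hσ => hEU ?_⟩
  have hle : IntermediateField.adjoin k (S : Set F) ≤
      IntermediateField.fixedField (Subgroup.zpowers σ) := by
    rw [IntermediateField.adjoin_le_iff]
    intro x hx
    have hx' : σ ∈ MulAction.stabilizer Gal(F/k) x := hσ x hx
    rintro ⟨g, hg⟩
    exact (Subgroup.zpowers_le.mpr hx') hg
  exact (IntermediateField.le_iff_le _ _).mp hle (Subgroup.mem_zpowers _)

/-- The cocycle is inflated from a finite level: with E the normal closure of k(S), it factors
through Gal(E/k) and has values in E, so the finite Hilbert 90 applies. -/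
theorem hilbert90 {k F : Type*} [Field k] [Field F] [Algebra k F] [IsGalois k F]
    (f : Gal(F/k) → F) (hf : ∀ σ τ, f (σ * τ) = f σ * σ (f τ)) (hf0 : ∀ σ, f σ ≠ 0)
    (S : Finset F) (hS : ∀ σ : Gal(F/k), (∀ x ∈ S, σ x = x) → f σ = 1) :
    ∃ β : F, β ≠ 0 ∧ ∀ σ, σ β = f σ * β := by
  classical
  let E₀ := IntermediateField.adjoin k (S : Set F)
  have : FiniteDimensional k E₀ := IntermediateField.finiteDimensional_adjoin fun x _ =>
    Algebra.IsIntegral.isIntegral x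
  let E := IntermediateField.normalClosure k E₀ F
  have hSE : ∀ x ∈ S, x ∈ E := fun x hx =>
    IntermediateField.le_normalClosure E₀ (IntermediateField.subset_adjoin k _ hx)
  have : Normal k E := normalClosure.normal k E₀ F
  have : IsGalois k E := ⟨⟩
  have h1 : ∀ σ τ : Gal(F/k), AlgEquiv.restrictNormalHom E σ = AlgEquiv.restrictNormalHom E τ →
      f σ = f τ := by
    intro σ τ h
    have hst : f (τ⁻¹ * σ) = 1 := by
      apply hS
      intro x hx
      have := AlgEquiv.restrictNormal_commutes (τ⁻¹ * σ) E ⟨x, hSE x hx⟩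
      have h' : (τ⁻¹ * σ).restrictNormal E = 1 := by
        change AlgEquiv.restrictNormalHom E (τ⁻¹ * σ) = 1
        rw [map_mul, map_inv, h, inv_mul_cancel]
      rw [h'] at this
      exact this.symm
    have := hf τ (τ⁻¹ * σ)
    rwa [hst, map_one, mul_one, mul_inv_cancel_left] at this
  -- If τ is trivial on E, then f τ = 1 and f (τ σ) = f σ, so the cocycle relation says that τ fixes
  -- f σ.
  have h2 : ∀ σ, f σ ∈ E := by
    intro σ
    rw [← InfiniteGalois.fixedField_fixingSubgroup E, IntermediateField.mem_fixedField_iff]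
    intro τ hτ
    have hτ1 : AlgEquiv.restrictNormalHom E τ = 1 := by
      ext x
      have := AlgEquiv.restrictNormal_commutes τ E x
      rw [AlgEquiv.one_apply]
      refine this.trans ?_
      exact (IntermediateField.mem_fixingSubgroup_iff _ _).mp hτ x x.2
    have e1 : f τ = 1 := by
      rw [h1 τ 1 (by rw [hτ1, map_one])]
      exact hS 1 fun _ _ => rfl
    have e2 : f (τ * σ) = f σ := h1 _ _ (by rw [map_mul, hτ1, one_mul])
    rw [hf, e1, one_mul] at e2
    exact e2
  have hsurj : Function.Surjective (AlgEquiv.restrictNormalHom (F := k) (K₁ := F) E) :=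
    AlgEquiv.restrictNormalHom_surjective F
  choose lift hlift using hsurj
  let f' : Gal(E/k) → Eˣ := fun σ => Units.mk0 ⟨f (lift σ), h2 _⟩ fun h => hf0 (lift σ)
    (congrArg Subtype.val h)
  have hcoc : groupCohomology.IsMulCocycle₁ f' := by
    intro σ τ
    ext
    change f (lift (σ * τ)) = (σ ⟨f (lift τ), h2 _⟩ : E) * f (lift σ)
    rw [h1 (lift (σ * τ)) (lift σ * lift τ) (by rw [map_mul, hlift, hlift, hlift]), hf, mul_comm]
    congr 1
    have := AlgEquiv.restrictNormal_commutes (lift σ) E ⟨f (lift τ), h2 _⟩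
    have h' : (lift σ).restrictNormal E = σ := hlift σ
    rw [h'] at this
    exact this.symm
  obtain ⟨β, hβ⟩ := groupCohomology.isMulCoboundary₁_of_isMulCocycle₁_of_aut_to_units f' hcoc
  refine ⟨((β : E) : F), fun h => β.ne_zero (Subtype.ext h), fun σ => ?_⟩
  have := hβ (AlgEquiv.restrictNormalHom E σ)
  rw [div_eq_iff_eq_mul] at this
  have h3 := congrArg (fun x : Eˣ => ((x : E) : F)) this
  have h4 := AlgEquiv.restrictNormal_commutes σ E (β : E)
  refine h4.symm.trans (h3.trans ?_)
  change f (lift _) * _ = _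
  rw [h1 (lift _) σ (hlift _)]

/-! ### Elements fixed by the stabilizer of a cube root of unity -/

section Fixed

variable {k F : Type*} [Field k] [Field F] [Algebra k F]

theorem conj_eq_or {w : F} (hw : w ^ 2 + w + 1 = 0) (σ : Gal(F/k)) : σ w = w ∨ σ w = w ^ 2 := by
  have h : (σ w) ^ 2 + σ w + 1 = 0 := by
    simpa only [map_add, map_pow, map_one, map_zero] using congrArg σ hw
  have : (σ w - w) * (σ w - w ^ 2) = 0 := by
    linear_combination h + (-σ w + w - 1) * hw
  rcases mul_eq_zero.mp this with h | h
  · exact .inl (sub_eq_zero.mp h)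
  · exact .inr (sub_eq_zero.mp h)

variable [IsGalois k F]

theorem exists_algebraMap_of_fixed {x : F} (h : ∀ σ : Gal(F/k), σ x = x) :
    ∃ y : k, algebraMap k F y = x := by
  have := (InfiniteGalois.mem_bot_iff_fixed (k := k) x).mpr h
  exact this

/-- The fixed field of the stabilizer of w is k(w), spanned by 1 and w. The coordinates are
recovered from x + τ x and (x - τ x)(w - w²), both in k, where τ conjugates w. -/
theorem exists_of_fixed_by_stabilizer [CharZero k] {w : F} (hw : w ^ 2 + w + 1 = 0) {x : F}
    (h : ∀ σ : Gal(F/k), σ w = w → σ x = x) :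
    ∃ a b : k, x = algebraMap k F a + algebraMap k F b * w := by
  have : CharZero F := charZero_of_injective_algebraMap (algebraMap k F).injective
  have hw3 := cube_eq_one_of_sq_add hw
  by_cases hτ : ∀ σ : Gal(F/k), σ w = w
  · obtain ⟨a, ha⟩ := exists_algebraMap_of_fixed (k := k) fun σ => h σ (hτ σ)
    exact ⟨a, 0, by simp [ha]⟩
  · push Not at hτ
    obtain ⟨τ, hτ⟩ := hτ
    have hτw : τ w = w ^ 2 := (conj_eq_or hw τ).resolve_left hτ
    have hττ : τ (τ x) = x := h (τ * τ) (by
      rw [AlgEquiv.mul_apply, hτw, map_pow, hτw]; linear_combination w * hw3)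
    have hor : ∀ σ : Gal(F/k), (σ w = w ∧ σ x = x ∧ σ (τ x) = τ x) ∨
        (σ w = w ^ 2 ∧ σ x = τ x ∧ σ (τ x) = x) := by
      intro σ
      rcases conj_eq_or hw σ with e | e
      · refine .inl ⟨e, h σ e, ?_⟩
        have := h (τ⁻¹ * σ * τ) (by
          rw [AlgEquiv.mul_apply, AlgEquiv.mul_apply, hτw, map_pow, e, ← hτw]
          exact τ.symm_apply_apply w)
        have h2 := congrArg τ this
        rw [AlgEquiv.mul_apply, AlgEquiv.mul_apply] at h2
        exact (τ.apply_symm_apply _).symm.trans h2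
      · have hs : σ (τ x) = x := h (σ * τ) (by
          rw [AlgEquiv.mul_apply, hτw, map_pow, e]; linear_combination w * hw3)
        refine .inr ⟨e, ?_, hs⟩
        have := h (τ * σ) (by
          rw [AlgEquiv.mul_apply, e, map_pow, hτw]; linear_combination w * hw3)
        rw [AlgEquiv.mul_apply] at this
        exact τ.injective (this.trans hττ.symm)
    obtain ⟨a, ha⟩ := exists_algebraMap_of_fixed (k := k) (x := x + τ x) fun σ => by
      rcases hor σ with ⟨-, e1, e2⟩ | ⟨-, e1, e2⟩ <;> rw [map_add, e1, e2]
      rw [add_comm]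
    obtain ⟨b, hb⟩ := exists_algebraMap_of_fixed (k := k) (x := (x - τ x) * (w - w ^ 2)) fun σ => by
      rcases hor σ with ⟨e0, e1, e2⟩ | ⟨e0, e1, e2⟩ <;>
        rw [map_mul, map_sub, e1, e2, map_sub, map_pow, e0]
      linear_combination (x - τ x) * w * hw3
    -- For x = a' + b' w the two traces are a = 2 a' - b' and b = b' (w - w²)² = -3 b'.
    refine ⟨a / 2 - b / 6, -b / 3, ?_⟩
    simp only [map_sub, map_div₀, map_neg, map_ofNat, ha, hb]
    linear_combination (x - τ x) * ((1 - w) / 3 + 1 / 6) * hw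

end Fixed

end CubeSum

namespace CubeSum

/-! ### Arithmetic of `p`-adic cubes -/

/-- Coordinates with respect to 1, w: one equation over the quadratic extension becomes two over the
base, which can be reduced modulo p. -/
theorem cube_add_mul_cube {R : Type*} [CommRing R] {w : R} (hw : w ^ 2 + w + 1 = 0) (a b c d : R) :
    (a + b * w) ^ 3 + w * (c + d * w) ^ 3 =
      (a ^ 3 + b ^ 3 - 3 * a * b ^ 2 - 3 * c * d * (c - d)) +
      (3 * a * b * (a - b) + (c ^ 3 + d ^ 3 - 3 * c * d ^ 2) - 3 * c * d * (c - d)) * w := by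
  grind

section PadicCubes

variable {ℓ : ℕ} [Fact ℓ.Prime]

theorem Padic.norm_eq_norm_iff_valuation {x y : ℚ_[ℓ]} (hx : x ≠ 0) (hy : y ≠ 0) :
    ‖x‖ = ‖y‖ ↔ x.valuation = y.valuation := by
  have h1 : (1 : ℝ) < ℓ := by exact_mod_cast (Fact.out : ℓ.Prime).one_lt
  rw [Padic.norm_eq_zpow_neg_valuation hx, Padic.norm_eq_zpow_neg_valuation hy,
    zpow_right_inj₀ (by positivity) h1.ne', neg_inj]

/-- An ultrametric triangle is isosceles. -/
theorem Padic.valuation_eq_or_of_add_eq {x y z : ℚ_[ℓ]} (hx : x ≠ 0) (hy : y ≠ 0) (hz : z ≠ 0)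
    (h : x + y = z) :
    x.valuation = y.valuation ∨ x.valuation = z.valuation ∨ y.valuation = z.valuation := by
  rw [← norm_eq_norm_iff_valuation hx hy, ← norm_eq_norm_iff_valuation hx hz,
    ← norm_eq_norm_iff_valuation hy hz]
  by_cases hxy : ‖x‖ = ‖y‖
  · exact .inl hxy
  · have := Padic.add_eq_max_of_ne hxy
    rw [h] at this
    rcases max_choice ‖x‖ ‖y‖ with e | e
    · exact .inr (.inl (by rw [this, e]))
    · exact .inr (.inr (by rw [this, e]))

/-- If `d r³ + d² s³ = N` is soluble over `ℚ_ℓ` and `3` divides the valuation of `N`, then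
`3` divides the valuation of `d`. -/
theorem three_dvd_valuation {d r s N : ℚ_[ℓ]} (hd : d ≠ 0) (hN : N ≠ 0) (hN3 : 3 ∣ N.valuation)
    (h : d * r ^ 3 + d ^ 2 * s ^ 3 = N) : 3 ∣ d.valuation := by
  by_cases hr : r = 0
  · subst hr
    by_cases hs : s = 0
    · subst hs; simp at h; exact absurd h.symm hN
    have h' : d ^ 2 * s ^ 3 = N := by rw [← h]; ring
    have := congrArg Padic.valuation h'
    rw [Padic.valuation_mul (pow_ne_zero _ hd) (pow_ne_zero _ hs), Padic.valuation_pow,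
      Padic.valuation_pow] at this
    push_cast at this
    omega
  have e1 : (d * r ^ 3).valuation = d.valuation + 3 * r.valuation := by
    rw [Padic.valuation_mul hd (pow_ne_zero _ hr), Padic.valuation_pow]; push_cast; ring
  by_cases hs : s = 0
  · subst hs
    have h' : d * r ^ 3 = N := by rw [← h]; ring
    rw [h'] at e1
    omega
  have e2 : (d ^ 2 * s ^ 3).valuation = 2 * d.valuation + 3 * s.valuation := by
    rw [Padic.valuation_mul (pow_ne_zero _ hd) (pow_ne_zero _ hs), Padic.valuation_pow,
      Padic.valuation_pow]
    push_cast; ring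
  -- Modulo 3 the three terms have valuations v, 2 v and 0 with v the valuation of d. Any two of
  -- these agree only if 3 divides v.
  have := Padic.valuation_eq_or_of_add_eq (mul_ne_zero hd (pow_ne_zero 3 hr))
    (mul_ne_zero (pow_ne_zero 2 hd) (pow_ne_zero 3 hs)) hN h
  rw [e1, e2] at this
  omega

/-! ### Local insolubility at p and at 3 -/

theorem exists_scale_to_primitive {ι : Type*} [Finite ι] [Nonempty ι] (a : ι → ℚ_[ℓ])
    (h : ∃ i, a i ≠ 0) : ∃ x : ℚ_[ℓ], x ≠ 0 ∧ (∀ i, ‖x * a i‖ ≤ 1) ∧ ∃ i, x * a i = 1 := by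
  -- Dividing by an entry of largest norm makes all entries integral and this one equal to 1.
  obtain ⟨i, hi⟩ := Finite.exists_max fun i => ‖a i‖
  have h0 : a i ≠ 0 := by
    obtain ⟨j, hj⟩ := h
    intro e
    have := hi j
    simp only [e, norm_zero] at this
    exact hj (norm_le_zero_iff.mp this)
  refine ⟨(a i)⁻¹, inv_ne_zero h0, fun j => ?_, i, inv_mul_cancel₀ h0⟩
  rw [norm_mul, norm_inv, inv_mul_le_one₀ (norm_pos_iff.mpr h0)]
  exact hi j

/-- `9` is the order of no element of `𝔽_{p²}ˣ`, expressed in an algebraic closure. -/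
theorem eq_zero_of_cube_add_cube_mul_eq_zero {p : ℕ} [Fact p.Prime] (hmod : p % 9 = 2 ∨ p % 9 = 5)
    {k : Type*} [Field k] [CharP k p] [Algebra (ZMod p) k] {w : k} (hw : w ^ 2 + w + 1 = 0)
    {a b c d : ZMod p}
    (h : (algebraMap _ k a + algebraMap _ k b * w) ^ 3 +
      w * (algebraMap _ k c + algebraMap _ k d * w) ^ 3 = 0) :
    a = 0 ∧ b = 0 ∧ c = 0 ∧ d = 0 := by
  have hp : p.Prime := Fact.out
  have hw3 : w ^ 3 = 1 := cube_eq_one_of_sq_add hw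
  have h3 : (3 : k) ≠ 0 := by
    intro e
    have : ((3 : ℕ) : k) = 0 := by exact_mod_cast e
    rw [CharP.cast_eq_zero_iff k p] at this
    have := (Nat.prime_dvd_prime_iff_eq hp Nat.prime_three).mp this
    omega
  have hw1 : w ≠ 1 := by
    rintro rfl
    apply h3
    linear_combination hw
  have hord : orderOf w = 3 := orderOf_eq_prime hw3 hw1
  -- The elements a + b w form a copy of 𝔽_{p²}; Frobenius sends w to w² because p ≡ 2 mod 3, so its
  -- square is the identity on them.
  have hFr : ∀ a b : ZMod p, (algebraMap _ k a + algebraMap _ k b * w) ^ p =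
      algebraMap _ k a + algebraMap _ k b * w ^ p := by
    intro a b
    rw [add_pow_char, mul_pow, ← map_pow, ← map_pow, ZMod.pow_card, ZMod.pow_card]
  have hwp : w ^ p = w ^ 2 := by
    rw [← pow_mod_orderOf, hord, show p % 3 = 2 by omega]
  have hFr2 : ∀ a b : ZMod p, (algebraMap _ k a + algebraMap _ k b * w) ^ (p ^ 2) =
      algebraMap _ k a + algebraMap _ k b * w := by
    intro a b
    rw [sq, pow_mul, hFr, add_pow_char, mul_pow, ← map_pow, ← map_pow, ZMod.pow_card, ZMod.pow_card,
      hwp, ← pow_mul, mul_comm 2 p, pow_mul, hwp]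
    linear_combination (algebraMap _ k b * w) * hw3
  have hind : ∀ a b : ZMod p, algebraMap _ k a + algebraMap _ k b * w = 0 → a = 0 ∧ b = 0 := by
    intro a b e
    have e' := hFr a b
    rw [e, zero_pow hp.ne_zero, hwp] at e'
    have hb : algebraMap _ k b * (w * (1 - w)) = 0 := by linear_combination e + e'
    have hw0 : w ≠ 0 := by rintro rfl; simp at hw3
    have hb0 : b = 0 := by
      have := (mul_eq_zero.mp hb).resolve_right (mul_ne_zero hw0 (sub_ne_zero.mpr hw1.symm))
      simpa using this
    subst hb0
    simpa using e
  set R := algebraMap _ k a + algebraMap _ k b * w with hR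
  set S := algebraMap _ k c + algebraMap _ k d * w with hS
  by_cases hS0 : S = 0
  · rw [hS0] at h
    have hR0 : R = 0 := by
      have : R ^ 3 = 0 := by linear_combination h
      exact pow_eq_zero_iff (by norm_num) |>.mp this
    exact ⟨(hind a b hR0).1, (hind a b hR0).2, (hind c d hS0).1, (hind c d hS0).2⟩
  · exfalso
    -- A cube root of w has order 9, yet it satisfies x^(p²) = x, so 9 would divide p² - 1. But p² ≡
    -- 4 or 7 mod 9.
    have hz3 : (-R / S) ^ 3 = w := by
      rw [div_pow, div_eq_iff (pow_ne_zero 3 hS0)]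
      linear_combination -h
    have hz9 : orderOf (-R / S) = 3 ^ 2 := by
      apply orderOf_eq_prime_pow
      · rw [pow_one, hz3]; exact hw1
      · rw [show 3 ^ (1 + 1) = 3 * 3 by norm_num, pow_mul, hz3, hw3]
    have hz0 : (-R / S) ≠ 0 := by
      intro e
      rw [e] at hz3
      have : w = 0 := by rw [← hz3]; norm_num
      rw [this] at hw3
      norm_num at hw3
    have hneg : (-R) = algebraMap _ k (-a) + algebraMap _ k (-b) * w := by
      rw [hR, map_neg, map_neg]; ring
    have hzp : (-R / S) ^ (p ^ 2) = -R / S := by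
      rw [div_pow, hFr2 c d, hneg, hFr2]
    have h1 : (-R / S) ^ (p ^ 2 - 1) = 1 := by
      apply mul_right_cancel₀ hz0
      rw [one_mul, ← pow_succ, Nat.sub_add_cancel (Nat.one_le_pow _ _ hp.pos), hzp]
    have hdvd := orderOf_dvd_of_pow_eq_one h1
    rw [hz9] at hdvd
    have hp2 : p ^ 2 % 9 = 4 ∨ p ^ 2 % 9 = 7 := by
      rw [Nat.pow_mod]
      rcases hmod with e | e <;> rw [e] <;> norm_num
    have := Nat.one_le_pow 2 p hp.pos
    omega

/-- Insolubility of `r³ + w s³ = N w²` over `ℚ_p(w)`, in coordinates. -/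
theorem padic_no_solution {p : ℕ} [Fact p.Prime] (hmod : p % 9 = 2 ∨ p % 9 = 5)
    {a b c d N : ℚ_[p]} (h0 : a ≠ 0 ∨ b ≠ 0 ∨ c ≠ 0 ∨ d ≠ 0) (hN : N = 0 ∨ ¬ 3 ∣ N.valuation)
    (h1 : a ^ 3 + b ^ 3 - 3 * a * b ^ 2 - 3 * c * d * (c - d) = -N)
    (h2 : 3 * a * b * (a - b) + (c ^ 3 + d ^ 3 - 3 * c * d ^ 2) - 3 * c * d * (c - d) = -N) :
    False := by
  obtain ⟨x, hx0, hx, i, hi⟩ := exists_scale_to_primitive ![a, b, c, d] (by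
    rcases h0 with h | h | h | h
    exacts [⟨0, h⟩, ⟨1, h⟩, ⟨2, h⟩, ⟨3, h⟩])
  let A : ℤ_[p] := ⟨x * a, hx 0⟩
  let B : ℤ_[p] := ⟨x * b, hx 1⟩
  let C : ℤ_[p] := ⟨x * c, hx 2⟩
  let D : ℤ_[p] := ⟨x * d, hx 3⟩
  have e1 : ((A ^ 3 + B ^ 3 - 3 * A * B ^ 2 - 3 * C * D * (C - D) : ℤ_[p]) : ℚ_[p]) =
      -(x ^ 3 * N) := by
    push_cast
    change (x * a) ^ 3 + (x * b) ^ 3 - 3 * (x * a) * (x * b) ^ 2 -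
      3 * (x * c) * (x * d) * (x * c - x * d) = _
    linear_combination x ^ 3 * h1
  have e2 : ((3 * A * B * (A - B) + (C ^ 3 + D ^ 3 - 3 * C * D ^ 2) - 3 * C * D * (C - D) : ℤ_[p])
      : ℚ_[p]) = -(x ^ 3 * N) := by
    push_cast
    change 3 * (x * a) * (x * b) * (x * a - x * b) +
      ((x * c) ^ 3 + (x * d) ^ 3 - 3 * (x * c) * (x * d) ^ 2) -
      3 * (x * c) * (x * d) * (x * c - x * d) = _
    linear_combination x ^ 3 * h2
  -- The number x³ N is integral by `e1`; it is not a unit, as N is zero or has valuation prime to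
  -- 3. So both coordinates vanish modulo p, which forces a primitive vector to be zero modulo p.
  have hlt : ‖-(x ^ 3 * N)‖ < 1 := by
    refine lt_of_le_of_ne (e1 ▸ PadicInt.norm_le_one _) ?_
    rcases hN with rfl | hN
    · simp
    · have hN0 : N ≠ 0 := by rintro rfl; simp at hN
      rw [norm_neg, ← norm_one (α := ℚ_[p]), Ne,
        Padic.norm_eq_norm_iff_valuation (mul_ne_zero (pow_ne_zero 3 hx0) hN0) one_ne_zero,
        Padic.valuation_mul (pow_ne_zero 3 hx0) hN0, Padic.valuation_pow, Padic.valuation_one]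
      push_cast
      omega
  have red : ∀ y : ℤ_[p], (y : ℚ_[p]) = -(x ^ 3 * N) → PadicInt.toZMod y = 0 := by
    intro y hy
    have : y ∈ RingHom.ker (PadicInt.toZMod : ℤ_[p] →+* ZMod p) := by
      rw [PadicInt.ker_toZMod, IsLocalRing.mem_maximalIdeal, PadicInt.mem_nonunits, PadicInt.norm_def,
        hy]
      exact hlt
    exact this
  have r1 := red _ e1
  have r2 := red _ e2
  simp only [map_sub, map_add, map_mul, map_pow, map_ofNat] at r1 r2
  obtain ⟨w, hw⟩ := IsAlgClosed.exists_root
    (Polynomial.X ^ 2 + Polynomial.X + 1 : Polynomial (AlgebraicClosure (ZMod p))) (by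
      have : (Polynomial.X ^ 2 + Polynomial.X + 1 : Polynomial (AlgebraicClosure (ZMod p))).degree = 2 := by
        compute_degree!
      rw [this]; norm_num)
  have hw' : w ^ 2 + w + 1 = 0 := by simpa using hw
  have : CharP (AlgebraicClosure (ZMod p)) p := charP_of_injective_algebraMap
    (algebraMap (ZMod p) (AlgebraicClosure (ZMod p))).injective p
  have key := eq_zero_of_cube_add_cube_mul_eq_zero hmod hw' (a := PadicInt.toZMod A)
    (b := PadicInt.toZMod B) (c := PadicInt.toZMod C) (d := PadicInt.toZMod D) (by
      have r1' := congrArg (algebraMap (ZMod p) (AlgebraicClosure (ZMod p))) r1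
      have r2' := congrArg (algebraMap (ZMod p) (AlgebraicClosure (ZMod p))) r2
      simp only [map_sub, map_add, map_mul, map_pow, map_ofNat, map_zero] at r1' r2'
      rw [cube_add_mul_cube hw', r1', r2']
      ring)
  obtain ⟨k1, k2, k3, k4⟩ := key
  have one : ∀ y : ℤ_[p], (y : ℚ_[p]) = 1 → PadicInt.toZMod y ≠ 0 := by
    intro y hy
    have : y = 1 := PadicInt.ext hy
    rw [this, map_one]
    exact one_ne_zero
  fin_cases i
  exacts [one A hi k1, one B hi k2, one C hi k3, one D hi k4]

/-- Modulo p a root would have order 3, which does not divide p - 1. -/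
theorem no_cube_root_of_unity {p : ℕ} [Fact p.Prime] (hmod : p % 3 = 2) (t : ℚ_[p]) :
    t ^ 2 + t + 1 ≠ 0 := by
  intro h
  have hp : p.Prime := Fact.out
  have ht3 : t ^ 3 = 1 := cube_eq_one_of_sq_add h
  have hn : ‖t‖ = 1 := by
    have := congrArg norm ht3
    rw [norm_pow, norm_one] at this
    exact (pow_eq_one_iff_of_nonneg (norm_nonneg t) (by norm_num)).mp this
  let T : ℤ_[p] := ⟨t, hn.le⟩
  have hT : T ^ 2 + T + 1 = 0 := PadicInt.ext (by push_cast; exact h)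
  have h' := congrArg PadicInt.toZMod hT
  simp only [map_add, map_pow, map_one, map_zero] at h'
  have h3 : (PadicInt.toZMod T) ^ 3 = 1 := cube_eq_one_of_sq_add h'
  have h1 : PadicInt.toZMod T ≠ 1 := by
    intro e
    rw [e] at h'
    have : ((3 : ℕ) : ZMod p) = 0 := by push_cast; linear_combination h'
    rw [ZMod.natCast_eq_zero_iff] at this
    have := (Nat.prime_dvd_prime_iff_eq hp Nat.prime_three).mp this
    omega
  have hT0 : PadicInt.toZMod T ≠ 0 := by intro e; rw [e] at h3; simp at h3
  have := orderOf_dvd_of_pow_eq_one (ZMod.pow_card_sub_one_eq_one hT0)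
  rw [orderOf_eq_prime h3 h1] at this
  have := hp.two_le
  omega

/-- A primitive solution of R³ + 3 S³ = 3 N X³ has 3 ∣ R, and then S³ ≡ N X³ mod 9. The unit cubes
modulo 9 are ± 1, so neither S nor X can be the coordinate equal to 1, and R cannot either. -/
theorem padic_three_no_solution {N : ℕ} (hN : N % 9 = 2 ∨ N % 9 = 4 ∨ N % 9 = 5 ∨ N % 9 = 7)
    {r s : ℚ_[3]} (h : 3 * r ^ 3 + 3 ^ 2 * s ^ 3 = 9 * N) : False := by
  obtain ⟨x, hx0, hx, i, hi⟩ := exists_scale_to_primitive ![r, s, 1] ⟨2, by simp⟩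
  let R : ℤ_[3] := ⟨x * r, hx 0⟩
  let S : ℤ_[3] := ⟨x * s, hx 1⟩
  let X : ℤ_[3] := ⟨x * 1, hx 2⟩
  have e1 : R ^ 3 + 3 * S ^ 3 = 3 * N * X ^ 3 := PadicInt.ext (by
    push_cast
    change (x * r) ^ 3 + 3 * (x * s) ^ 3 = 3 * N * (x * 1) ^ 3
    linear_combination x ^ 3 / 3 * h)
  have hR : (3 : ℤ_[3]) ∣ R := by
    have : (3 : ℤ_[3]) ∣ R ^ 3 := ⟨N * X ^ 3 - S ^ 3, by linear_combination e1⟩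
    exact (PadicInt.prime_p (p := 3)).dvd_of_dvd_pow (by exact_mod_cast this)
  obtain ⟨R', hR'⟩ := hR
  have e2 : 9 * R' ^ 3 + S ^ 3 = N * X ^ 3 := by
    have h3 : (3 : ℤ_[3]) ≠ 0 := by norm_num
    apply mul_left_cancel₀ h3
    rw [hR'] at e1
    linear_combination e1
  have e3 := congrArg (PadicInt.toZModPow (p := 3) 2) e2
  simp only [map_add, map_mul, map_pow, map_natCast, map_ofNat] at e3
  have e4 : ∀ s t M : ZMod 9, (M = 2 ∨ M = 4 ∨ M = 5 ∨ M = 7) → s ^ 3 = M * t ^ 3 →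
    s ≠ 1 ∧ t ≠ 1 := by decide
  have hM : ((N : ZMod 9) = 2 ∨ (N : ZMod 9) = 4 ∨ (N : ZMod 9) = 5 ∨ (N : ZMod 9) = 7) := by
    rw [← Nat.mod_add_div N 9]
    push_cast
    rw [show (9 : ZMod 9) = 0 by rfl]
    rcases hN with e | e | e | e <;> rw [e] <;> simp
  have e5 : (9 : ZMod (3 ^ 2)) = 0 := by rfl
  rw [e5, zero_mul, zero_add] at e3
  have e6 := e4 _ _ _ hM e3
  fin_cases i
  · have hR1 : R = 1 := PadicInt.ext hi
    rw [hR1] at hR'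
    exact (PadicInt.prime_p (p := 3)).not_isUnit (IsUnit.of_mul_eq_one R' (by exact_mod_cast hR'.symm))
  · have : S = 1 := PadicInt.ext hi
    exact e6.1 (by rw [this, map_one])
  · have : X = 1 := PadicInt.ext hi
    exact e6.2 (by rw [this, map_one])

theorem coe_padicInt_three : ((3 : ℤ_[ℓ]) : ℚ_[ℓ]) = 3 :=
  map_ofNat (PadicInt.Coe.ringHom (p := ℓ)) 3

/-! #### Lifting cubes by Hensel's lemma -/

theorem exists_cube_of_norm_sub_lt {a x : ℤ_[ℓ]} (h : ‖a ^ 3 - x‖ < ‖3 * a ^ 2‖ ^ 2) :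
    ∃ y : ℤ_[ℓ], y ^ 3 = x ∧ ‖y - a‖ < ‖3 * a ^ 2‖ := by
  obtain ⟨y, hy, hya, -⟩ := hensels_lemma (p := ℓ) (R := ℤ_[ℓ]) (F := Polynomial.X ^ 3 - Polynomial.C x)
    (a := a) (by simpa [show (2 : ℤ_[ℓ]) + 1 = 3 by norm_num] using h)
  exact ⟨y, by simpa [sub_eq_zero] using hy,
    by simpa [show (2 : ℤ_[ℓ]) + 1 = 3 by norm_num] using hya⟩

theorem exists_cube_of_toZMod (hℓ : ℓ ≠ 3) {x : ℤ_[ℓ]} {y : ZMod ℓ} (hy : y ≠ 0)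
    (h : PadicInt.toZMod x = y ^ 3) : ∃ z : ℤ_[ℓ], z ^ 3 = x ∧ PadicInt.toZMod z = y := by
  obtain ⟨a, rfl⟩ := ZMod.ringHom_surjective (PadicInt.toZMod : ℤ_[ℓ] →+* ZMod ℓ) y
  have hunit : ∀ b : ℤ_[ℓ], PadicInt.toZMod b ≠ 0 → ‖b‖ = 1 := by
    intro b hb
    by_contra hne
    have : b ∈ RingHom.ker (PadicInt.toZMod : ℤ_[ℓ] →+* ZMod ℓ) := by
      rw [PadicInt.ker_toZMod, IsLocalRing.mem_maximalIdeal, PadicInt.mem_nonunits]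
      exact lt_of_le_of_ne (PadicInt.norm_le_one b) hne
    exact hb this
  have h3 : ‖(3 : ℤ_[ℓ])‖ = 1 := by
    apply hunit
    rw [map_ofNat]
    intro e
    have : ((3 : ℕ) : ZMod ℓ) = 0 := by exact_mod_cast e
    rw [ZMod.natCast_eq_zero_iff] at this
    exact hℓ ((Nat.prime_dvd_prime_iff_eq Fact.out Nat.prime_three).mp this)
  have hmem : ∀ b : ℤ_[ℓ], ‖b‖ < 1 ↔ PadicInt.toZMod b = 0 := fun b => by
    rw [← PadicInt.mem_nonunits, ← IsLocalRing.mem_maximalIdeal, ← PadicInt.ker_toZMod,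
      RingHom.mem_ker]
  have h1 : ‖3 * a ^ 2‖ = 1 := by
    rw [norm_mul, norm_pow, h3, hunit a hy]
    norm_num
  obtain ⟨z, hz, hza⟩ := exists_cube_of_norm_sub_lt (a := a) (x := x) (by
    rw [h1, one_pow, hmem, map_sub, map_pow, h, sub_self])
  rw [h1, hmem, map_sub, sub_eq_zero] at hza
  exact ⟨z, hz, hza⟩

/-- For a unit y the derivative has |3 y²|² = 1/9, so agreement modulo 27 satisfies the strict
inequality in Hensel's lemma. -/
theorem exists_cube_of_toZModPow_three {x : ℤ_[3]} {y : ℤ} (hy : ¬ (3 : ℤ) ∣ y)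
    (h : PadicInt.toZModPow 3 x = (y : ZMod (3 ^ 3)) ^ 3) : ∃ z : ℤ_[3], z ^ 3 = x := by
  suffices h : ‖(y : ℤ_[3]) ^ 3 - x‖ < ‖3 * (y : ℤ_[3]) ^ 2‖ ^ 2 by
    obtain ⟨z, hz, -⟩ := exists_cube_of_norm_sub_lt h
    exact ⟨z, hz⟩
  have h1 : ‖(y : ℤ_[3])‖ = 1 := by
    refine le_antisymm (PadicInt.norm_le_one _) (not_lt.mp fun hlt => hy ?_)
    exact_mod_cast (PadicInt.norm_int_lt_one_iff_dvd (p := 3) y).mp hlt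
  have h3 : ‖(3 : ℤ_[3])‖ = 3⁻¹ := by
    have := PadicInt.norm_p (p := 3)
    exact_mod_cast this
  rw [norm_mul, norm_pow, h1, h3]
  have hmem : (y : ℤ_[3]) ^ 3 - x ∈ RingHom.ker (PadicInt.toZModPow (p := 3) 3) := by
    rw [RingHom.mem_ker, map_sub, map_pow, h, map_intCast, sub_self]
  rw [PadicInt.ker_toZModPow, ← PadicInt.norm_le_pow_iff_mem_span_pow] at hmem
  refine lt_of_le_of_lt hmem ?_
  norm_num

/-- Since 3 divides ℓ - 1 there is an element of order 3 modulo ℓ, and it lifts. -/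
theorem exists_cube_root_of_unity (hℓ : ℓ % 3 = 1) : ∃ t : ℚ_[ℓ], t ^ 2 + t + 1 = 0 := by
  have hp : ℓ.Prime := Fact.out
  obtain ⟨y, hy⟩ : ∃ y : (ZMod ℓ)ˣ, orderOf y = 3 := by
    apply exists_prime_orderOf_dvd_card 3
    rw [ZMod.card_units_eq_totient, Nat.totient_prime hp]
    have := hp.two_le
    omega
  have hy3 : (y : ZMod ℓ) ^ 3 = 1 := by
    have := pow_orderOf_eq_one y
    rw [hy] at this
    rw [← Units.val_pow_eq_pow_val, this, Units.val_one]
  have hy1 : (y : ZMod ℓ) ≠ 1 := by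
    intro e
    have : y = 1 := Units.ext e
    rw [this, orderOf_one] at hy
    omega
  obtain ⟨z, hz, hzy⟩ := exists_cube_of_toZMod (by omega) (x := 1) y.ne_zero (by rw [map_one, hy3])
  refine ⟨z, sq_add_of_cube_eq_one (by exact_mod_cast congrArg ((↑) : ℤ_[ℓ] → ℚ_[ℓ]) hz) ?_⟩
  intro e
  have : z = 1 := PadicInt.ext e
  exact hy1 (by rw [← hzy, this, map_one])

/-! #### A cubic over a finite field -/

/-- An elementary count. If both alternatives fail, 1, A and B represent the classes modulo the
group C of nonzero cubes, and every a + A b with a, b ∈ C lies in C or in A C. This yields an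
injection of the finite set C × C into itself whose image contains no pair with sum zero, although
(1, -1) is such a pair. -/
theorem exists_cube_add_mul_cube {k : Type*} [Field k] [Finite k] {A B : k} (hA : A ≠ 0)
    (hB : B ≠ 0) : (∃ g : k, g ^ 3 = A) ∨ ∃ r s : k, r ^ 3 + A * s ^ 3 = B := by
  classical
  by_contra hcon
  push Not at hcon
  obtain ⟨hA3, hno⟩ := hcon
  obtain ⟨g, hg⟩ := IsCyclic.exists_generator (α := kˣ)
  have hcyc : ∀ x : k, x ≠ 0 → ∃ i : ℤ, x = (g ^ i : kˣ) := by
    intro x hx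
    obtain ⟨i, hi⟩ := Subgroup.mem_zpowers_iff.mp (hg (Units.mk0 x hx))
    exact ⟨i, by rw [hi]; rfl⟩
  have hg0 : (g : k) ≠ 0 := g.ne_zero
  obtain ⟨i, hi⟩ := hcyc A hA
  obtain ⟨j, hj⟩ := hcyc B hB
  push_cast at hi hj
  have hi3 : ¬ 3 ∣ i := by
    rintro ⟨m, rfl⟩
    exact hA3 ((g : k) ^ m) (by rw [hi, mul_comm, zpow_mul]; norm_cast)
  have hj3 : ¬ 3 ∣ j := by
    rintro ⟨m, rfl⟩
    exact hno ((g : k) ^ m) 0 (by rw [hj, mul_comm 3 m, zpow_mul]; norm_cast; ring)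
  have hji : ¬ 3 ∣ j - i := by
    rintro ⟨m, hm⟩
    refine hno 0 ((g : k) ^ m) ?_
    rw [hi, hj, show j = i + m * 3 by omega, zpow_add₀ hg0, zpow_mul]
    norm_cast
    ring
  -- The exponents 0, i, j of 1, A, B are pairwise distinct modulo 3, so they represent all classes.
  have hco : ∀ x : k, x ≠ 0 → ∃ c : k, c ≠ 0 ∧ (x = c ^ 3 ∨ x = A * c ^ 3 ∨ x = B * c ^ 3) := by
    intro x hx
    obtain ⟨l, hl⟩ := hcyc x hx
    push_cast at hl
    have : (3 : ℤ) ∣ l ∨ 3 ∣ l - i ∨ 3 ∣ l - j := by omega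
    rcases this with ⟨m, hm⟩ | ⟨m, hm⟩ | ⟨m, hm⟩
    · refine ⟨(g : k) ^ m, zpow_ne_zero _ hg0, .inl ?_⟩
      rw [hl, show l = m * 3 by omega, zpow_mul]; norm_cast
    · refine ⟨(g : k) ^ m, zpow_ne_zero _ hg0, .inr (.inl ?_)⟩
      rw [hl, hi, show l = i + m * 3 by omega, zpow_add₀ hg0, zpow_mul]; norm_cast
    · refine ⟨(g : k) ^ m, zpow_ne_zero _ hg0, .inr (.inr ?_)⟩
      rw [hl, hj, show l = j + m * 3 by omega, zpow_add₀ hg0, zpow_mul]; norm_cast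
  -- If A² were a cube, so would be A = A³ / A². This separates the cosets A C and A⁻¹ C.
  have hA2 : ∀ c : k, c ≠ 0 → A ^ 2 ≠ c ^ 3 := by
    intro c hc e
    refine hA3 (A / c) ?_
    rw [div_pow, ← e]
    field_simp
  -- The nonzero cubes.
  let C := {x : k // ∃ c : k, c ≠ 0 ∧ x = c ^ 3}
  have hC0 : ∀ x : C, x.1 ≠ 0 := by
    rintro ⟨x, c, hc, rfl⟩
    exact pow_ne_zero 3 hc
  have hsum : ∀ a b : C, (∃ c : k, c ≠ 0 ∧ a.1 + A * b.1 = c ^ 3) ∨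
      ∃ c : k, c ≠ 0 ∧ a.1 + A * b.1 = A * c ^ 3 := by
    rintro ⟨a, a', ha', rfl⟩ ⟨b, b', hb', rfl⟩
    have hne : a' ^ 3 + A * b' ^ 3 ≠ 0 := by
      intro e
      refine hA3 (-a' / b') ?_
      rw [div_pow, div_eq_iff (pow_ne_zero 3 hb')]
      linear_combination -e
    obtain ⟨c, hc, e | e | e⟩ := hco _ hne
    · exact .inl ⟨c, hc, e⟩
    · exact .inr ⟨c, hc, e⟩
    · refine absurd ?_ (hno (a' / c) (b' / c))
      rw [div_pow, div_pow]
      field_simp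
      linear_combination e
  have negC : ∀ a : C, ∃ c : k, c ≠ 0 ∧ -a.1 = c ^ 3 := by
    rintro ⟨a, a', ha', rfl⟩
    exact ⟨-a', neg_ne_zero.mpr ha', by ring⟩
  -- The value is (a + A b, -a) if a + A b is a cube and ((a + A b) / A, -b) otherwise. The class of
  -- the sum of its components tells which case occurred, and then a and b can be recovered.
  let f : C × C → C × C := fun x =>
    if h : ∃ c : k, c ≠ 0 ∧ x.1.1 + A * x.2.1 = c ^ 3 then (⟨_, h⟩, ⟨_, negC x.1⟩)
    else (⟨(x.1.1 + A * x.2.1) / A, by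
      obtain ⟨c, hc, e⟩ := (hsum x.1 x.2).resolve_left h
      exact ⟨c, hc, by rw [e]; field_simp⟩⟩, ⟨_, negC x.2⟩)
  -- The sum of the two components of `f x` lies in `A C` in the first case and in `A⁻¹ C` in the second.
  have hf : ∀ x : C × C, ((f x).1.1 + (f x).2.1 = A * x.2.1 ∧ (f x).2.1 = -x.1.1) ∨
      (A * ((f x).1.1 + (f x).2.1) = x.1.1 ∧ (f x).2.1 = -x.2.1) := by
    intro x
    by_cases h : ∃ c : k, c ≠ 0 ∧ x.1.1 + A * x.2.1 = c ^ 3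
    · left
      simp only [f, dif_pos h]
      exact ⟨by ring, trivial⟩
    · right
      simp only [f, dif_neg h]
      refine ⟨?_, trivial⟩
      field_simp
      ring
  have hinj : Function.Injective f := by
    intro x y hxy
    have hx := hf x
    rw [hxy] at hx
    rcases hx with ⟨h1, h2⟩ | ⟨h1, h2⟩ <;> rcases hf y with ⟨h3, h4⟩ | ⟨h3, h4⟩
    · refine Prod.ext (Subtype.ext ?_) (Subtype.ext ?_)
      · linear_combination h2 - h4
      · exact mul_left_cancel₀ hA (by rw [← h1, ← h3])
    · exfalso
      rw [h1] at h3
      obtain ⟨b, hb, e⟩ := x.2.2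
      obtain ⟨c, hc, e'⟩ := y.1.2
      refine hA2 (c / b) (div_ne_zero hc hb) ?_
      rw [div_pow, eq_div_iff (pow_ne_zero 3 hb), ← e, ← e', ← h3]
      ring
    · exfalso
      rw [h3] at h1
      obtain ⟨b, hb, e⟩ := y.2.2
      obtain ⟨c, hc, e'⟩ := x.1.2
      refine hA2 (c / b) (div_ne_zero hc hb) ?_
      rw [div_pow, eq_div_iff (pow_ne_zero 3 hb), ← e, ← e', ← h1]
      ring
    · refine Prod.ext (Subtype.ext ?_) (Subtype.ext ?_)
      · rw [← h1, ← h3]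
      · linear_combination h2 - h4
  have hsurj := Finite.injective_iff_surjective.mp hinj
  obtain ⟨x, hx⟩ := hsurj (⟨1, 1, one_ne_zero, by ring⟩, ⟨-1, -1, neg_ne_zero.mpr one_ne_zero, by ring⟩)
  have := hf x
  rw [hx] at this
  rcases this with ⟨h, -⟩ | ⟨h, -⟩
  · exact mul_ne_zero hA (hC0 x.2) (by rw [← h]; ring)
  · exact hC0 x.1 (by rw [← h]; ring)

/-- Everywhere local solubility of `3 r³ + 9 s³ = 3 N`, up to the places where `3` is a cube. -/
theorem padic_exists_solution {N : ℕ} (hN : N % 9 = 2 ∨ N % 9 = 4 ∨ N % 9 = 5 ∨ N % 9 = 7)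
    (hNℓ : ℓ ∣ N → ℓ % 3 = 2) :
    (∃ r s : ℚ_[ℓ], 3 * r ^ 3 + 3 ^ 2 * s ^ 3 = 3 * N) ∨ ∃ g : ℚ_[ℓ], 3 = g ^ 3 := by
  have hℓ : ℓ.Prime := Fact.out
  by_cases h3 : ℓ = 3
  · subst h3
    left
    -- A finite search for s such that N - 3 s³ is the cube of a unit modulo 27, which then lifts to
    -- ℤ₃.
    have key : ∀ x : ZMod 27, (x.val % 9 = 2 ∨ x.val % 9 = 4 ∨ x.val % 9 = 5 ∨ x.val % 9 = 7) →
        ∃ s y : ZMod 27, x - 3 * s ^ 3 = y ^ 3 ∧ ¬ 3 ∣ y.val := by decide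
    obtain ⟨s, y, hsy, hy⟩ := key (N : ZMod 27) (by rw [ZMod.val_natCast]; omega)
    have hs' : ((s.val : ℕ) : ZMod 27) = s := ZMod.natCast_zmod_val s
    have hy' : ((y.val : ℕ) : ZMod 27) = y := ZMod.natCast_zmod_val y
    obtain ⟨z, hz⟩ := exists_cube_of_toZModPow_three (x := (N : ℤ_[3]) - 3 * (s.val : ℤ_[3]) ^ 3)
      (y := (y.val : ℤ)) (by exact_mod_cast hy) (by
        simp only [map_sub, map_mul, map_pow, map_natCast, map_ofNat, Int.cast_natCast]
        change (N : ZMod 27) - 3 * (s.val : ZMod 27) ^ 3 = (y.val : ZMod 27) ^ 3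
        rw [hs', hy', hsy])
    refine ⟨z, (s.val : ℕ), ?_⟩
    have := congrArg ((↑) : ℤ_[3] → ℚ_[3]) hz
    push_cast [coe_padicInt_three] at this
    linear_combination 3 * this
  · have h30 : (3 : ZMod ℓ) ≠ 0 := by
      intro e
      have : ((3 : ℕ) : ZMod ℓ) = 0 := by exact_mod_cast e
      rw [ZMod.natCast_eq_zero_iff] at this
      exact h3 ((Nat.prime_dvd_prime_iff_eq hℓ Nat.prime_three).mp this)
    have hcube3 : (∃ g : ZMod ℓ, g ^ 3 = 3) → ∃ g : ℚ_[ℓ], 3 = g ^ 3 := by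
      rintro ⟨g, hg⟩
      have hg0 : g ≠ 0 := by rintro rfl; exact h30 (by rw [← hg]; ring)
      obtain ⟨z, hz, -⟩ := exists_cube_of_toZMod h3 (x := (3 : ℤ_[ℓ])) hg0 (by rw [map_ofNat, hg])
      refine ⟨z, ?_⟩
      have := congrArg ((↑) : ℤ_[ℓ] → ℚ_[ℓ]) hz
      push_cast at this
      exact this.symm
    by_cases h2 : ℓ % 3 = 2
    · right
      apply hcube3
      -- For ℓ ≡ 2 mod 3 the number 2 ℓ - 1 is divisible by 3, and 3^(2 ℓ - 1) = 3 by Fermat.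
      refine ⟨3 ^ ((2 * ℓ - 1) / 3), ?_⟩
      have h1 : (3 : ZMod ℓ) ^ (ℓ - 1) = 1 := ZMod.pow_card_sub_one_eq_one h30
      rw [← pow_mul, show (2 * ℓ - 1) / 3 * 3 = (ℓ - 1) + (ℓ - 1) + 1 by omega, pow_add, pow_add,
        h1, one_mul, one_mul, pow_one]
    · have hN0 : (N : ZMod ℓ) ≠ 0 := by
        rw [Ne, ZMod.natCast_eq_zero_iff]
        exact fun e => h2 (hNℓ e)
      rcases exists_cube_add_mul_cube h30 hN0 with h | ⟨r, s, hrs⟩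
      · exact .inr (hcube3 h)
      · left
        obtain ⟨R, rfl⟩ := ZMod.ringHom_surjective (PadicInt.toZMod : ℤ_[ℓ] →+* ZMod ℓ) r
        obtain ⟨S, rfl⟩ := ZMod.ringHom_surjective (PadicInt.toZMod : ℤ_[ℓ] →+* ZMod ℓ) s
        -- Hensel's lemma needs a nonzero residue. If r vanishes modulo ℓ, put r = 0 and extract the
        -- cube root s of N / 3, with t the inverse of 3; otherwise keep S and solve for r.
        by_cases hR : PadicInt.toZMod R = 0
        · have h3u : IsUnit (3 : ℤ_[ℓ]) := by
            by_contra hnu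
            have hk : (3 : ℤ_[ℓ]) ∈ RingHom.ker (PadicInt.toZMod : ℤ_[ℓ] →+* ZMod ℓ) := by
              rw [PadicInt.ker_toZMod]
              exact (IsLocalRing.mem_maximalIdeal _).mpr hnu
            rw [RingHom.mem_ker, map_ofNat] at hk
            exact h30 hk
          obtain ⟨t, ht⟩ := h3u.exists_left_inv
          have ht' := congrArg PadicInt.toZMod ht
          rw [map_mul, map_one, map_ofNat] at ht'
          have hS : PadicInt.toZMod S ≠ 0 := by
            intro e
            rw [hR, e] at hrs
            exact hN0 (by rw [← hrs]; ring)
          obtain ⟨z, hz, -⟩ := exists_cube_of_toZMod h3 (x := t * (N : ℤ_[ℓ])) hS (by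
            rw [map_mul, map_natCast, ← hrs, hR]
            linear_combination PadicInt.toZMod S ^ 3 * ht')
          refine ⟨0, z, ?_⟩
          have h1 := congrArg ((↑) : ℤ_[ℓ] → ℚ_[ℓ]) hz
          have h2 := congrArg ((↑) : ℤ_[ℓ] → ℚ_[ℓ]) ht
          push_cast [coe_padicInt_three] at h1 h2
          linear_combination 9 * h1 + 3 * N * h2
        · obtain ⟨z, hz, -⟩ := exists_cube_of_toZMod h3 (x := (N : ℤ_[ℓ]) - 3 * S ^ 3) hR (by
            simp only [map_sub, map_mul, map_natCast, map_pow, map_ofNat, ← hrs]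
            ring)
          refine ⟨z, S, ?_⟩
          have h1 := congrArg ((↑) : ℤ_[ℓ] → ℚ_[ℓ]) hz
          push_cast [coe_padicInt_three] at h1
          linear_combination 3 * h1

end PadicCubes

end CubeSum

namespace CubeSum

open NumberField

/-! ### Cubes in the Eisenstein field -/

/-- Cubes of primes are split off one at a time. The setting of monoids covers both the ring of
integers of ℚ(ζ₃) and ℕ. -/
theorem exists_unit_mul_cube {R : Type*} [CommMonoidWithZero R]
    [UniqueFactorizationMonoid R]
    (x : R) (hx : x ≠ 0) (h : ∀ π : R, Prime π → 3 ∣ multiplicity π x) :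
    ∃ (u : Rˣ) (y : R), x = u * y ^ 3 := by
  induction x using (wellFounded_dvdNotUnit (α := R)).induction with
  | _ x ih =>
    by_cases hu : IsUnit x
    · exact ⟨hu.unit, 1, by simp⟩
    · obtain ⟨π, hπ, hπx⟩ := WfDvdMonoid.exists_irreducible_factor hu hx
      have hp : Prime π := hπ.prime
      have hfin : FiniteMultiplicity π x := FiniteMultiplicity.of_prime_left hp hx
      have h1 : 1 ≤ multiplicity π x := hfin.le_multiplicity_of_pow_dvd (by simpa using hπx)
      have h3 : 3 ≤ multiplicity π x := Nat.le_of_dvd h1 (h π hp)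
      obtain ⟨x', hx'⟩ := pow_dvd_of_le_multiplicity h3
      have hx'0 : x' ≠ 0 := by rintro rfl; simp at hx'; exact hx hx'
      have hπ3 : π ^ 3 ≠ 0 := pow_ne_zero 3 hp.ne_zero
      obtain ⟨u, y, hy⟩ := ih x' ⟨hx'0, π ^ 3, fun e => hp.not_isUnit
        ((isUnit_pow_iff (by norm_num)).mp e), by rw [hx', mul_comm]⟩ hx'0 fun q hq => by
          have := h q hq
          rw [hx', multiplicity_mul hq (hx' ▸ FiniteMultiplicity.of_prime_left hq hx),
            (FiniteMultiplicity.of_prime_left hq hp.ne_zero).multiplicity_pow hq] at this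
          omega
      exact ⟨u, π * y, by rw [hx', hy, mul_pow, mul_left_comm]⟩

section Eisenstein

variable {K : Type*} [Field K] {ζ : K}

theorem zeta_sq_add (hζ : IsPrimitiveRoot ζ 3) : ζ ^ 2 + ζ + 1 = 0 :=
  sq_add_of_cube_eq_one hζ.pow_eq_one (hζ.ne_one (by norm_num))

theorem coe_integer_mul (x y : 𝓞 K) : ((x * y : 𝓞 K) : K) = x * y := rfl

theorem coe_toInteger (hζ : IsPrimitiveRoot ζ 3) : (hζ.toInteger : K) = ζ := rfl

theorem toInteger_sq_add (hζ : IsPrimitiveRoot ζ 3) : hζ.toInteger ^ 2 + hζ.toInteger + 1 = 0 := by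
  apply RingOfIntegers.ext
  simpa [coe_toInteger hζ] using zeta_sq_add hζ

theorem exists_prime_of_dvd {π : 𝓞 K} (hπ : Prime π) (m : ℕ) (hm : m ≠ 0) (h : π ∣ (m : 𝓞 K)) :
    ∃ ℓ : ℕ, ℓ.Prime ∧ π ∣ (ℓ : 𝓞 K) := by
  induction m using induction_on_primes with
  | zero => exact absurd rfl hm
  | one => exact absurd (isUnit_of_dvd_one (by simpa using h)) hπ.not_isUnit
  | prime_mul p a hp ih =>
    rw [Nat.cast_mul] at h
    rcases hπ.dvd_or_dvd h with h | h
    · exact ⟨p, hp, h⟩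
    · exact ih (by rintro rfl; simp at hm) h

/-- The action of an automorphism on the ring of integers. -/
abbrev intConj (τ : K ≃+* K) : 𝓞 K ≃+* 𝓞 K := RingOfIntegers.mapRingEquiv τ

variable {τ : K ≃+* K}

theorem intConj_toInteger (hζ : IsPrimitiveRoot ζ 3) (hτ : τ ζ = ζ ^ 2) :
    intConj τ hζ.toInteger = hζ.toInteger ^ 2 := by
  apply RingOfIntegers.ext
  simpa [coe_toInteger hζ] using hτ

theorem intConj_coords (hζ : IsPrimitiveRoot ζ 3) (hτ : τ ζ = ζ ^ 2) (a b : ℤ) :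
    intConj τ (a + b * hζ.toInteger) = a + b * hζ.toInteger ^ 2 := by
  rw [map_add, map_mul, map_intCast, map_intCast, intConj_toInteger hζ hτ]

theorem coords_mul_conj (hζ : IsPrimitiveRoot ζ 3) (hτ : τ ζ = ζ ^ 2) (a b : ℤ) :
    (a + b * hζ.toInteger) * intConj τ (a + b * hζ.toInteger) =
      ((a ^ 2 - a * b + b ^ 2 : ℤ) : 𝓞 K) := by
  rw [intConj_coords hζ hτ]
  push_cast
  linear_combination (b ^ 2 * (hζ.toInteger - 1) + a * b : 𝓞 K) * toInteger_sq_add hζ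

variable [NumberField K] [IsCyclotomicExtension {3} ℚ K]

theorem exists_int_coords (hζ : IsPrimitiveRoot ζ 3)
    (x : 𝓞 K) : ∃ a b : ℤ, x = a + b * hζ.toInteger := by
  have hx : x ∈ Algebra.adjoin ℤ {hζ.toInteger} := by
    have := hζ.integralPowerBasis.adjoin_gen_eq_top
    rw [hζ.integralPowerBasis_gen] at this
    rw [this]
    trivial
  induction hx using Algebra.adjoin_induction with
  | mem x hx =>
    rw [Set.mem_singleton_iff] at hx
    exact ⟨0, 1, by simp [hx]⟩
  | algebraMap r => exact ⟨r, 0, by simp⟩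
  | add x y _ _ hx hy =>
    obtain ⟨a, b, rfl⟩ := hx
    obtain ⟨c, d, rfl⟩ := hy
    exact ⟨a + c, b + d, by push_cast; ring⟩
  | mul x y _ _ hx hy =>
    obtain ⟨a, b, rfl⟩ := hx
    obtain ⟨c, d, rfl⟩ := hy
    refine ⟨a * c - b * d, a * d + b * c - b * d, ?_⟩
    push_cast
    linear_combination (b * d : 𝓞 K) * toInteger_sq_add hζ

theorem intConj_intConj (hζ : IsPrimitiveRoot ζ 3) (hτ : τ ζ = ζ ^ 2)
    (x : 𝓞 K) : intConj τ (intConj τ x) = x := by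
  obtain ⟨a, b, rfl⟩ := exists_int_coords hζ x
  rw [intConj_coords hζ hτ, map_add, map_mul, map_pow, map_intCast, map_intCast,
    intConj_toInteger hζ hτ]
  have h3 : hζ.toInteger ^ 3 = 1 := by
    linear_combination (hζ.toInteger - 1) * toInteger_sq_add hζ
  linear_combination (b * hζ.toInteger : 𝓞 K) * h3

theorem exists_int_mul_conj (hζ : IsPrimitiveRoot ζ 3) (hτ : τ ζ = ζ ^ 2)
    (x : 𝓞 K) : ∃ m : ℤ, x * intConj τ x = m := by
  obtain ⟨a, b, rfl⟩ := exists_int_coords hζ x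
  exact ⟨_, coords_mul_conj hζ hτ a b⟩

/-- Taking norms gives m² ∣ k². -/
theorem int_dvd_of_cast_dvd (hζ : IsPrimitiveRoot ζ 3) (hτ : τ ζ = ζ ^ 2)
    {m k : ℤ} (h : (m : 𝓞 K) ∣ (k : 𝓞 K)) : m ∣ k := by
  obtain ⟨y, hy⟩ := h
  obtain ⟨N, hN⟩ := exists_int_mul_conj hζ hτ y
  have h' := congrArg (intConj τ) hy
  rw [map_mul, map_intCast, map_intCast] at h'
  have : ((k ^ 2 : ℤ) : 𝓞 K) = ((m ^ 2 * N : ℤ) : 𝓞 K) := by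
    push_cast
    rw [← hN]
    linear_combination (k : 𝓞 K) * hy + (m * y : 𝓞 K) * h'
  have := Int.cast_injective (α := 𝓞 K) this
  exact (Int.pow_dvd_pow_iff two_ne_zero).mp ⟨N, this⟩

/-- A prime of `ℤ[ζ₃]` not associated to its conjugate lies over a rational prime `ℓ ≡ 1 mod 3`. -/
theorem mul_conj_eq_prime (hζ : IsPrimitiveRoot ζ 3) (hτ : τ ζ = ζ ^ 2)
    {π : 𝓞 K} (hπ : Prime π) (hna : ¬ π ∣ intConj τ π) :
    ∃ ℓ : ℕ, ℓ.Prime ∧ ℓ % 3 = 1 ∧ π * intConj τ π = ℓ := by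
  have hπ' : Prime (intConj τ π) := (MulEquiv.prime_iff (intConj τ).toMulEquiv).mpr hπ
  have hna' : ¬ intConj τ π ∣ π := by
    rintro ⟨c, hc⟩
    exact hna ⟨intConj τ c, by
      conv_rhs => rw [← intConj_intConj hζ hτ π]
      rw [← map_mul, ← hc]⟩
  -- A rational integer divisible by π is divisible by the conjugate too, hence by the product of
  -- these two non-associated primes.
  have hmul : ∀ m : ℤ, π ∣ (m : 𝓞 K) → π * intConj τ π ∣ (m : 𝓞 K) := by
    rintro m ⟨c, hc⟩
    have h2 : intConj τ π ∣ π * c := by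
      refine ⟨intConj τ c, ?_⟩
      rw [← map_mul, ← hc, map_intCast]
    obtain ⟨e, he⟩ := (hπ'.dvd_or_dvd h2).resolve_left hna'
    exact ⟨e, by rw [hc, he]; ring⟩
  obtain ⟨a, b, hab⟩ := exists_int_coords hζ π
  have hN := coords_mul_conj hζ hτ a b
  rw [← hab] at hN
  set M : ℤ := a ^ 2 - a * b + b ^ 2 with hM
  have hM0 : 0 ≤ M := by nlinarith [sq_nonneg (a - b), sq_nonneg (a + b), sq_nonneg a, sq_nonneg b]
  have hMne : M ≠ 0 := by
    intro e
    rw [e, Int.cast_zero] at hN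
    rcases mul_eq_zero.mp hN with h | h
    exacts [hπ.ne_zero h, hπ'.ne_zero h]
  -- π divides its norm M, hence some rational prime ℓ. Then M divides ℓ, and M ≠ 1.
  obtain ⟨ℓ, hℓ, hdvd⟩ := exists_prime_of_dvd hπ M.toNat (by omega) (by
    refine ⟨intConj τ π, ?_⟩
    rw [hN, ← Int.cast_natCast, Int.toNat_of_nonneg hM0])
  have hdvd' := hmul ℓ (by simpa using hdvd)
  rw [hN] at hdvd'
  have hMℓ : M.toNat ∣ ℓ := by
    have := int_dvd_of_cast_dvd hζ hτ hdvd'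
    rw [← Int.toNat_of_nonneg hM0] at this
    exact_mod_cast this
  rcases (Nat.dvd_prime hℓ).mp hMℓ with h1 | h1
  · exfalso
    have : M = 1 := by omega
    rw [this, Int.cast_one] at hN
    exact hπ.not_isUnit (IsUnit.of_mul_eq_one _ hN)
  have hMℓ' : M = ℓ := by omega
  refine ⟨ℓ, hℓ, ?_, by rw [hN, hMℓ', Int.cast_natCast]⟩
  -- The prime 3 ramifies as 3 = -ζ² (ζ - 1)². Both π and its conjugate would divide ζ - 1, so 3
  -- would divide ζ - 1, whose norm is only 3.
  have hℓ3 : ℓ ≠ 3 := by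
    rintro rfl
    have h3 : (3 : 𝓞 K) = -hζ.toInteger ^ 2 * (hζ.toInteger - 1) ^ 2 := by
      linear_combination (hζ.toInteger ^ 2 - 3 * hζ.toInteger + 3) * toInteger_sq_add hζ
    have hd1 : π ∣ hζ.toInteger - 1 := by
      have : π ∣ -hζ.toInteger ^ 2 * (hζ.toInteger - 1) ^ 2 := by rw [← h3]; exact_mod_cast hdvd
      refine hπ.dvd_of_dvd_pow ((hπ.dvd_or_dvd this).resolve_left fun h => hπ.not_isUnit ?_)
      refine isUnit_of_dvd_unit h (IsUnit.neg (IsUnit.pow 2 ?_))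
      exact IsUnit.of_mul_eq_one (hζ.toInteger ^ 2) (by
        linear_combination (hζ.toInteger - 1) * toInteger_sq_add hζ)
    obtain ⟨c, hc⟩ := hd1
    have hd2 : intConj τ π ∣ π * c := by
      rw [← hc]
      refine ⟨-hζ.toInteger * intConj τ c, ?_⟩
      have := congrArg (intConj τ) hc
      rw [map_sub, map_one, map_mul, intConj_toInteger hζ hτ] at this
      linear_combination (-hζ.toInteger) * this + (hζ.toInteger - 1) * toInteger_sq_add hζ
    obtain ⟨e, he⟩ := (hπ'.dvd_or_dvd hd2).resolve_left hna'
    have h4 : hζ.toInteger - 1 = 3 * e := by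
      rw [hMℓ'] at hN
      push_cast at hN
      rw [hc, he, ← hN]; ring
    obtain ⟨N, hN'⟩ := exists_int_mul_conj hζ hτ e
    have h5 := congrArg (intConj τ) h4
    rw [map_sub, map_one, map_mul, intConj_toInteger hζ hτ, map_ofNat] at h5
    have h6 : ((3 : ℤ) : 𝓞 K) = ((9 * N : ℤ) : 𝓞 K) := by
      push_cast
      rw [← hN']
      linear_combination (hζ.toInteger ^ 2 - 1) * h4 + 3 * e * h5 -
        (hζ.toInteger - 2) * toInteger_sq_add hζ
    have := Int.cast_injective (α := 𝓞 K) h6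
    omega
  have hnd : ¬ (3 ∣ ℓ) := fun h => hℓ3 ((Nat.prime_dvd_prime_iff_eq Nat.prime_three hℓ).mp h).symm
  -- The norm form a² - a b + b² never takes the value 2 modulo 3.
  have hmod : (ℓ : ℤ) % 3 ≠ 2 := by
    rw [← hMℓ', hM]
    have ha : a % 3 = 0 ∨ a % 3 = 1 ∨ a % 3 = 2 := by omega
    have hb : b % 3 = 0 ∨ b % 3 = 1 ∨ b % 3 = 2 := by omega
    rcases ha with ha | ha | ha <;> rcases hb with hb | hb | hb <;>
      simp [Int.add_emod, Int.sub_emod, Int.mul_emod, pow_two, ha, hb]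
  omega

theorem norm_embedding_le_one (hζ : IsPrimitiveRoot ζ 3)
    {ℓ : ℕ} [Fact ℓ.Prime] (ι : K →+* ℚ_[ℓ]) (x : 𝓞 K) :
    ‖ι x‖ ≤ 1 := by
  obtain ⟨a, b, rfl⟩ := exists_int_coords hζ x
  have h1 : ‖ι ζ‖ = 1 := by
    have := congrArg (fun x => ‖ι x‖) hζ.pow_eq_one
    simp only [map_pow, norm_pow, map_one, norm_one] at this
    exact (pow_eq_one_iff_of_nonneg (norm_nonneg _) (by norm_num)).mp this
  have h2 : ((a + b * hζ.toInteger : 𝓞 K) : K) = a + b * ζ := by simp [coe_toInteger hζ]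
  rw [h2, map_add, map_mul, map_intCast, map_intCast]
  refine (Padic.nonarchimedean _ _).trans (max_le (Padic.norm_int_le_one a) ?_)
  rw [norm_mul, h1, mul_one]
  exact Padic.norm_int_le_one b

/-- The part of x prime to π becomes a unit of ℤ_ℓ by a Bézout relation with π, as all integers of K
have norm at most 1 in ℚ_ℓ. -/
theorem valuation_embedding_eq_multiplicity (hζ : IsPrimitiveRoot ζ 3)
    {ℓ : ℕ} [Fact ℓ.Prime] (ι : K →+* ℚ_[ℓ])
    {π : 𝓞 K} (hπ : Prime π) (h1 : (ι π).valuation = 1) {x : 𝓞 K} (hx : x ≠ 0) :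
    (ι x).valuation = multiplicity π x := by
  have : IsPrincipalIdealRing (𝓞 K) := IsCyclotomicExtension.Rat.three_pid K
  obtain ⟨y, hy, hndvd⟩ := (FiniteMultiplicity.of_prime_left hπ hx).exists_eq_pow_mul_and_not_dvd
  have hy0 : y ≠ 0 := by rintro rfl; simp at hndvd
  have hinj : ∀ z : 𝓞 K, z ≠ 0 → ι z ≠ 0 := fun z hz => by simpa using hz
  have hnormπ : ‖ι π‖ < 1 := by
    rw [Padic.norm_eq_zpow_neg_valuation (hinj π hπ.ne_zero), h1]
    have : (1 : ℝ) < ℓ := by exact_mod_cast (Fact.out : ℓ.Prime).one_lt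
    simpa using inv_lt_one_of_one_lt₀ this
  have hvy : ‖ι y‖ = 1 := by
    refine le_antisymm (norm_embedding_le_one hζ ι y) (not_lt.mp fun hlt => ?_)
    obtain ⟨c, d, hcd⟩ := (hπ.irreducible.coprime_iff_not_dvd).mpr hndvd
    have := congrArg (fun z : 𝓞 K => ι z) hcd
    simp only [map_add, map_mul, map_one] at this
    have h2 : ‖ι c * ι π + ι d * ι y‖ < 1 := by
      refine (Padic.nonarchimedean _ _).trans_lt (max_lt ?_ ?_)
      · rw [norm_mul]
        exact (mul_le_of_le_one_left (norm_nonneg _) (norm_embedding_le_one hζ ι c)).trans_lt hnormπ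
      · rw [norm_mul]
        exact (mul_le_of_le_one_left (norm_nonneg _) (norm_embedding_le_one hζ ι d)).trans_lt hlt
    rw [this, norm_one] at h2
    exact lt_irrefl _ h2
  have hvy' : (ι y).valuation = 0 := by
    have := (Padic.norm_eq_norm_iff_valuation (hinj y hy0) one_ne_zero).mp (by rw [hvy, norm_one])
    rwa [Padic.valuation_one] at this
  have hxy : ι x = ι π ^ multiplicity π x * ι y := by
    conv_lhs => rw [hy]
    simp
  rw [hxy, Padic.valuation_mul (pow_ne_zero _ (hinj π hπ.ne_zero)) (hinj y hy0), Padic.valuation_pow,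
    h1, hvy']
  ring

/-- Since the norm of x is a cube, the multiplicities of π and of its conjugate in x add up to a
multiple of 3. If the two are associated, twice the multiplicity is divisible by 3. Otherwise they
lie over a split prime, and the local hypothesis at one of them settles both. -/
theorem three_dvd_multiplicity (hζ : IsPrimitiveRoot ζ 3) (hτ : τ ζ = ζ ^ 2)
    {x B : 𝓞 K} (hx : x ≠ 0) (hB : x * intConj τ x = B ^ 3)
    (hloc : ∀ (ℓ : ℕ) [Fact ℓ.Prime], ℓ % 3 = 1 → ∃ ι : K →+* ℚ_[ℓ], 3 ∣ (ι x).valuation)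
    {π : 𝓞 K} (hπ : Prime π) : 3 ∣ multiplicity π x := by
  have hx' : intConj τ x ≠ 0 := by simpa using hx
  have hB0 : B ≠ 0 := by rintro rfl; simp [hx] at hB
  have hπ' : Prime (intConj τ π) := (MulEquiv.prime_iff (intConj τ).toMulEquiv).mpr hπ
  have hsum : multiplicity π x + multiplicity π (intConj τ x) = 3 * multiplicity π B := by
    rw [← multiplicity_mul hπ (FiniteMultiplicity.of_prime_left hπ (mul_ne_zero hx hx')), hB,
      (FiniteMultiplicity.of_prime_left hπ hB0).multiplicity_pow hπ]
  have hconj : multiplicity π (intConj τ x) = multiplicity (intConj τ π) x := by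
    have := multiplicity_map_eq (intConj τ) (a := intConj τ π) (b := x)
    rw [intConj_intConj hζ hτ] at this
    exact this
  by_cases hd : π ∣ intConj τ π
  · have : Associated π (intConj τ π) := (hπ.dvd_prime_iff_associated hπ').mp hd
    have := multiplicity_eq_of_emultiplicity_eq (emultiplicity_eq_of_associated_left this (c := x))
    omega
  · obtain ⟨ℓ, hℓ, hmod, hmul⟩ := mul_conj_eq_prime hζ hτ hπ hd
    have : Fact ℓ.Prime := ⟨hℓ⟩
    obtain ⟨ι, hι⟩ := hloc ℓ hmod
    have hinj : ∀ z : 𝓞 K, z ≠ 0 → ι z ≠ 0 := fun z hz => by simpa using hz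
    have hv := congrArg (fun z : 𝓞 K => (ι z).valuation) hmul
    simp only [map_mul, map_natCast] at hv
    rw [Padic.valuation_mul (hinj π hπ.ne_zero) (hinj _ hπ'.ne_zero), Padic.valuation_p] at hv
    have n1 := (Padic.norm_le_one_iff_val_nonneg _).mp (norm_embedding_le_one hζ ι π)
    have n2 := (Padic.norm_le_one_iff_val_nonneg _).mp (norm_embedding_le_one hζ ι (intConj τ π))
    -- The valuations of π and its conjugate under ι are nonnegative with sum 1, so ι realizes
    -- exactly one of the two primes.
    by_cases h1 : (ι π).valuation = 1
    · rw [valuation_embedding_eq_multiplicity hζ ι hπ h1 hx] at hι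
      exact_mod_cast hι
    · rw [valuation_embedding_eq_multiplicity hζ ι hπ' (by omega) hx, ← hconj] at hι
      have : 3 ∣ multiplicity π (intConj τ x) := by exact_mod_cast hι
      omega

/-- An element of `ℚ(ζ₃)` whose norm is a cube, and that has valuation divisible by `3` at one place
above every rational prime `ℓ ≡ 1 mod 3`, is the product of a power of `ζ₃` and a cube. -/
theorem exists_zeta_pow_mul_cube (hζ : IsPrimitiveRoot ζ 3) (hτ : τ ζ = ζ ^ 2)
    {a b : K} (ha : a ≠ 0) (hab : a * τ a = b ^ 3)
    (hloc : ∀ (ℓ : ℕ) [Fact ℓ.Prime], ℓ % 3 = 1 → ∃ ι : K →+* ℚ_[ℓ], 3 ∣ (ι a).valuation) :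
    ∃ (i : ℕ) (c : K), a = ζ ^ i * c ^ 3 := by
  have : IsPrincipalIdealRing (𝓞 K) := IsCyclotomicExtension.Rat.three_pid K
  obtain ⟨x, y, hy, hxy⟩ := IsFractionRing.div_surjective (A := 𝓞 K) a
  have hy0 : (y : K) ≠ 0 := by
    simpa using nonZeroDivisors.ne_zero hy
  -- Multiplying a = x / y by y³ gives an integral element of the same cube class.
  have hz : ((x * y ^ 2 : 𝓞 K) : K) = a * (y : K) ^ 3 := by
    rw [← hxy]
    push_cast
    change (x : K) * (y : K) ^ 2 = (x : K) / (y : K) * _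
    field_simp
  have hz0 : (x * y ^ 2 : 𝓞 K) ≠ 0 := by
    intro e
    rw [e] at hz
    have : a * (y : K) ^ 3 = 0 := by rw [← hz]; rfl
    exact mul_ne_zero ha (pow_ne_zero 3 hy0) this
  have hBint : IsIntegral ℤ (b * y * τ y) := by
    refine IsIntegral.of_pow (n := 3) (by norm_num) ?_
    have : (b * (y : K) * τ y) ^ 3 =
        (((x * y ^ 2) * intConj τ (x * y ^ 2) : 𝓞 K) : K) := by
      have h2 : ((intConj τ (x * y ^ 2) : 𝓞 K) : K) = τ (a * (y : K) ^ 3) := by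
        rw [← hz]
        rfl
      rw [coe_integer_mul, h2, hz, map_mul, map_pow, mul_pow, mul_pow, ← hab]
      ring
    rw [this]
    exact RingOfIntegers.isIntegral_coe _
  have hB : (x * y ^ 2) * intConj τ (x * y ^ 2) = (⟨_, hBint⟩ : 𝓞 K) ^ 3 := by
    apply RingOfIntegers.ext
    have h2 : ((intConj τ (x * y ^ 2) : 𝓞 K) : K) = τ (a * (y : K) ^ 3) := by
      rw [← hz]
      rfl
    rw [coe_integer_mul, h2, hz, map_mul, map_pow]
    change _ = (b * (y : K) * τ y) ^ 3
    rw [mul_pow, mul_pow, ← hab]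
    ring
  obtain ⟨u, v, huv⟩ := exists_unit_mul_cube (x * y ^ 2) hz0 fun π hπ =>
    three_dvd_multiplicity hζ hτ hz0 hB (fun ℓ _ hℓ => by
      obtain ⟨ι, hι⟩ := hloc ℓ hℓ
      refine ⟨ι, ?_⟩
      rw [hz, map_mul, map_pow, Padic.valuation_mul (by simpa using ha)
        (pow_ne_zero 3 (by simpa using hy0)), Padic.valuation_pow]
      push_cast
      omega) hπ
  -- The units are ± ζⁱ, and the sign is a cube.
  obtain ⟨i, ε, hu⟩ : ∃ (i : ℕ) (ε : K), ((u : 𝓞 K) : K) = ζ ^ i * ε ^ 3 := by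
    have hmem := IsCyclotomicExtension.Rat.Three.Units.mem hζ u
    simp only [List.mem_cons, List.not_mem_nil, or_false] at hmem
    rcases hmem with h | h | h | h | h | h
    · exact ⟨0, 1, by simp [h]⟩
    · exact ⟨0, -1, by rw [h]; norm_num [coe_toInteger hζ]⟩
    · exact ⟨1, 1, by simp [h, coe_toInteger hζ]⟩
    · exact ⟨1, -1, by rw [h]; norm_num [coe_toInteger hζ]⟩
    · exact ⟨2, 1, by simp [h, coe_toInteger hζ]⟩
    · exact ⟨2, -1, by rw [h]; norm_num [coe_toInteger hζ]⟩
  refine ⟨i, ε * v / y, ?_⟩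
  have h3 := congrArg (fun z : 𝓞 K => (z : K)) huv
  simp only [hz] at h3
  rw [coe_integer_mul, hu] at h3
  rw [div_pow, mul_pow]
  field_simp
  rw [h3]
  simp

end Eisenstein

end CubeSum

namespace CubeSum

open WeierstrassCurve.Affine NumberField IntermediateField

/-! ### Cocycles that are locally trivial -/

section Core

theorem eq_of_cube_eq_one {Q : Type*} [Field Q] {w z : Q} (hw : w ^ 2 + w + 1 = 0) (hz : z ^ 3 = 1) :
    z = 1 ∨ z = w ∨ z = w ^ 2 := by
  have : (z - 1) * ((z - w) * (z - w ^ 2)) = 0 := by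
    linear_combination hz + (-z ^ 2 + z + (w - 1) * (z - 1)) * hw
  rcases mul_eq_zero.mp this with h | h
  · exact .inl (sub_eq_zero.mp h)
  rcases mul_eq_zero.mp h with h | h
  · exact .inr (.inl (sub_eq_zero.mp h))
  · exact .inr (.inr (sub_eq_zero.mp h))

theorem rat_sq_add_ne_zero (t : ℚ) : t ^ 2 + t + 1 ≠ 0 := by
  nlinarith [sq_nonneg (t + 1 / 2)]

section

variable {Q : Type*} [Field Q] [Algebra ℚ Q]

theorem exists_conj [IsGalois ℚ Q] {w : Q} (hw : w ^ 2 + w + 1 = 0) : ∃ τ : Gal(Q/ℚ), τ w = w ^ 2 := by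
  by_contra hcon
  push Not at hcon
  obtain ⟨t, rfl⟩ := exists_algebraMap_of_fixed (k := ℚ) fun σ =>
    (conj_eq_or hw σ).resolve_right (hcon σ)
  refine rat_sq_add_ne_zero t ((algebraMap ℚ Q).injective ?_)
  simpa only [map_add, map_pow, map_one, map_zero] using hw

theorem mem_adjoin_of_fixed [IsGalois ℚ Q] {w : Q} (hw : w ^ 2 + w + 1 = 0) {x : Q}
    (h : ∀ σ : Gal(Q/ℚ), σ w = w → σ x = x) : x ∈ ℚ⟮w⟯ := by
  obtain ⟨a, b, rfl⟩ := exists_of_fixed_by_stabilizer hw h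
  exact add_mem (IntermediateField.algebraMap_mem _ a) (mul_mem (IntermediateField.algebraMap_mem _ b) (mem_adjoin_simple_self ℚ w))

theorem fixed_of_mem_adjoin {w x : Q} (hx : x ∈ ℚ⟮w⟯) {ρ : Gal(Q/ℚ)} (hρ : ρ w = w) : ρ x = x := by
  induction hx using IntermediateField.adjoin_induction with
  | mem x hx => rwa [Set.mem_singleton_iff.mp hx]
  | algebraMap q => exact ρ.commutes q
  | add x y _ _ hx hy => rw [map_add, hx, hy]
  | inv x _ hx => rw [map_inv₀, hx]
  | mul x y _ _ hx hy => rw [map_mul, hx, hy]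

/-- A character of `Gal(Q/ℚ)` with values in `μ₃` is given by Kummer theory over `ℚ(w)`. -/
theorem exists_kummer_of_hom [IsGalois ℚ Q] {w : Q} (hw : w ^ 2 + w + 1 = 0) {z : Gal(Q/ℚ) → Q}
    (hz : ∀ σ, z σ ^ 3 = 1) (hmul : ∀ σ τ, z (σ * τ) = z σ * z τ)
    (hS : ∃ S : Finset Q, ∀ σ : Gal(Q/ℚ), (∀ x ∈ S, σ x = x) → z σ = 1) :
    ∃ α : Q, α ≠ 0 ∧ ∀ ρ : Gal(Q/ℚ), ρ w = w → ρ α = z ρ * α := by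
  obtain ⟨S, hS⟩ := hS
  have : IsGalois ℚ⟮w⟯ Q := inferInstance
  have hfix : ∀ σ : Gal(Q/ℚ⟮w⟯), σ w = w := fun σ =>
    σ.commutes ⟨w, mem_adjoin_simple_self ℚ w⟩
  -- Over ℚ(w) Galois acts trivially on μ₃, so the homomorphism z is also a multiplicative cocycle.
  obtain ⟨α, hα, h⟩ := hilbert90 (k := ℚ⟮w⟯) (F := Q) (fun σ => z (σ.restrictScalars ℚ)) (by
      intro σ τ
      have e1 : (σ * τ).restrictScalars ℚ = σ.restrictScalars ℚ * τ.restrictScalars ℚ := rfl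
      rw [e1, hmul]
      congr 1
      rcases eq_of_cube_eq_one hw (hz (τ.restrictScalars ℚ)) with e | e | e <;>
        simp only [e, map_one, map_pow, hfix])
    (fun σ e => by
      have := hz (σ.restrictScalars ℚ)
      rw [e] at this
      norm_num at this) S (fun σ hσ => hS _ hσ)
  refine ⟨α, hα, fun ρ hρ => ?_⟩
  have hρK : ρ ∈ ℚ⟮w⟯.fixingSubgroup :=
    (IntermediateField.mem_fixingSubgroup_iff _ _).mpr fun _ hx => fixed_of_mem_adjoin hx hρ
  have := h (fixingSubgroupEquiv ℚ⟮w⟯ ⟨ρ, hρK⟩)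
  exact this

end

variable {n : ℚ} [NeZero n] {Q : Type*} [Field Q] [Algebra ℚ Q] [DecidableEq Q]

/-- An automorphism of `F/L`, considered over `ℚ`. -/
abbrev ratHom {L F : Type*} [Field L] [Field F] [Algebra ℚ L] [Algebra L F] [Algebra ℚ F]
    [IsScalarTower ℚ L F] (σ : Gal(F/L)) : F →ₐ[ℚ] F :=
  σ.toAlgHom.restrictScalars ℚ

/-- The cochain `c` becomes a coboundary with values in the `F`-points over the Galois extension
`F/L`, where `F` contains `Q` by means of `ι`. -/
def TrivializedBy (c : Gal(Q/ℚ) → EPoint n Q) (L F : Type*) [Field L] [Field F] [Algebra ℚ L]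
    [Algebra L F] [Algebra ℚ F] [IsScalarTower ℚ L F] [DecidableEq F] (ι : Q →ₐ[ℚ] F)
    (P : EPoint n F) : Prop :=
  ∀ σ : Gal(F/L), ∃ ρ : Gal(Q/ℚ), (∀ x, ι (ρ x) = σ (ι x)) ∧
    Point.map (W' := cubeSumCurve n) ι (c ρ) =
      Point.map (W' := cubeSumCurve n) (ratHom σ) P - P

/-- The cochain `c` becomes a coboundary over some Galois extension of `L` that contains `Q`. -/
def LocallyTrivialAt (c : Gal(Q/ℚ) → EPoint n Q) (L : Type) [Field L] [Algebra ℚ L] : Prop :=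
  ∃ (F : Type) (_ : Field F) (_ : Algebra ℚ F) (_ : Algebra L F) (_ : IsScalarTower ℚ L F)
    (_ : IsGalois L F) (_ : DecidableEq F) (ι : Q →ₐ[ℚ] F) (P : EPoint n F),
    TrivializedBy c L F ι P

theorem exists_kernelPoint_sqrtNegThree {w : Q} (hw : w ^ 2 + w + 1 = 0) {T : EPoint n Q}
    (hT : (3 : ℤ) • T = 0) : ∃ z : Q, z ^ 3 = 1 ∧ sqrtNegThree w hw T = kernelPoint n z :=
  exists_kernelPoint_of_sqrtNegThree_eq_zero hw (by
    rw [sqrtNegThree_sqrtNegThree, hT, neg_zero])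

/-- An automorphism conjugating w negates √-3 and also inverts μ₃ ≅ ker √-3; the two signs cancel.
So √-3 identifies E[3]/ker √-3 with a module with trivial action. -/
theorem sqrtNegThree_map {w : Q} (hw : w ^ 2 + w + 1 = 0) {T : EPoint n Q} (hT : (3 : ℤ) • T = 0)
    (σ : Gal(Q/ℚ)) :
    sqrtNegThree w hw (Point.map (W' := cubeSumCurve n) σ.toAlgHom T) = sqrtNegThree w hw T := by
  obtain ⟨z, hz, hT'⟩ := exists_kernelPoint_sqrtNegThree hw hT
  have hz3 := hz
  rcases conj_eq_or hw σ with e | e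
  · rw [← map_sqrtNegThree σ.toAlgHom hw hw e, hT', map_kernelPoint _ hz]
    congr 1
    rcases eq_of_cube_eq_one hw hz with rfl | rfl | rfl
    · exact map_one σ
    · exact e
    · exact (map_pow σ w 2).trans (by rw [e])
  · have h := map_sqrtNegThree_of_conj σ.toAlgHom hw hw e T
    rw [← neg_eq_iff_eq_neg] at h
    rw [← h, hT', map_kernelPoint _ hz, neg_eq_iff_eq_neg, ← kernelPoint_sq hz]
    congr 1
    have hw3 := cube_eq_one_of_sq_add hw
    rcases eq_of_cube_eq_one hw hz with rfl | rfl | rfl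
    · exact (map_one σ).trans (by ring)
    · exact e
    · exact (map_pow σ w 2).trans (by rw [e])

/-- The local consequence of triviality for the cocycle `√-3 ∘ c`. -/
theorem TrivializedBy.descent_sqrtNegThree {c : Gal(Q/ℚ) → EPoint n Q} {L F : Type*} [Field L]
    [Field F] [Algebra ℚ L] [Algebra L F] [Algebra ℚ F] [IsScalarTower ℚ L F] [DecidableEq F]
    {ι : Q →ₐ[ℚ] F} {P : EPoint n F} (h : TrivializedBy c L F ι P) {w : Q}
    (hw : w ^ 2 + w + 1 = 0) {α : Q} (hα : α ≠ 0)
    (hc : ∀ ρ : Gal(Q/ℚ), ρ w = w →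
      ∃ z : Q, z ^ 3 = 1 ∧ sqrtNegThree w hw (c ρ) = kernelPoint n z ∧ ρ α = z * α) :
    (∃ r s : F, ι (α ^ 3) * r ^ 3 + ι (α ^ 3) ^ 2 * s ^ 3 = algebraMap ℚ F n ∧
      (∀ σ : Gal(F/L), σ (ι w) = ι w → σ r = r) ∧ ∀ σ : Gal(F/L), σ (ι w) = ι w → σ s = s) ∨
    ∃ g : F, ι (α ^ 3) = g ^ 3 ∧ ∀ σ : Gal(F/L), σ (ι w) = ι w → σ g = g := by
  have hw' : (ι w) ^ 2 + ι w + 1 = 0 := by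
    simpa only [map_add, map_pow, map_one, map_zero] using congrArg ι hw
  -- The point √-3 P trivializes √-3 ∘ c. Only automorphisms fixing w commute with √-3, so the
  -- descent goes down to L(w) rather than L.
  have key := exists_descent hw' {φ | ∃ σ : Gal(F/L), σ (ι w) = ι w ∧ φ = ratHom σ}
    (sqrtNegThree (ι w) hw' P) (θ := ι α) (by simpa using hα) (by
      rintro φ ⟨σ, hσ, rfl⟩
      obtain ⟨ρ, hρ, hP⟩ := h σ
      have hρw : ρ w = w := ι.injective ((hρ w).trans hσ)
      obtain ⟨z, hz, h1, h2⟩ := hc ρ hρw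
      refine ⟨ι z, by rw [← map_pow, hz, map_one], ?_, ?_⟩
      · rw [← map_kernelPoint ι hz, ← h1, map_sqrtNegThree ι hw hw' rfl, hP, map_sub,
          map_sqrtNegThree (ratHom σ) hw' hw' hσ]
        abel
      · exact (hρ α).symm.trans (by rw [h2, map_mul]))
  rcases key with ⟨r, s, e, -, hr, hs⟩ | ⟨g, hg, hg'⟩
  · refine .inl ⟨r, s, ?_, fun σ hσ => hr _ ⟨σ, hσ, rfl⟩, fun σ hσ => hs _ ⟨σ, hσ, rfl⟩⟩
    rw [← e, map_pow]
    ring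
  · exact .inr ⟨g, by rw [map_pow, hg], fun σ hσ => hg' _ ⟨σ, hσ, rfl⟩⟩

/-- The local consequence of triviality for a cocycle with values in `ker √-3`. -/
theorem LocallyTrivialAt.descent {c : Gal(Q/ℚ) → EPoint n Q} {L : Type} [Field L]
    [Algebra ℚ L] (h : LocallyTrivialAt c L) {w : Q} (hw : w ^ 2 + w + 1 = 0) {θ : Q} (hθ : θ ≠ 0)
    {d : ℚ} (hd : algebraMap ℚ Q d = θ ^ 3)
    (hc : ∀ ρ : Gal(Q/ℚ), ∃ z : Q, z ^ 3 = 1 ∧ c ρ = kernelPoint n z ∧ ρ θ = z * θ) :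
    (∃ r s : L, algebraMap ℚ L d * r ^ 3 + algebraMap ℚ L d ^ 2 * s ^ 3 = algebraMap ℚ L n) ∨
    ∃ g : L, algebraMap ℚ L d = g ^ 3 := by
  obtain ⟨F, _, _, _, _, _, _, ι, P, h⟩ := h
  have hw' : (ι w) ^ 2 + ι w + 1 = 0 := by
    simpa only [map_add, map_pow, map_one, map_zero] using congrArg ι hw
  have hd' : algebraMap L F (algebraMap ℚ L d) = ι θ ^ 3 := by
    rw [← IsScalarTower.algebraMap_apply, ← map_pow, ← hd, AlgHom.commutes]
  have key := exists_descent hw' {φ | ∃ σ : Gal(F/L), φ = ratHom σ} P (θ := ι θ)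
    (by simpa using hθ) (by
      rintro φ ⟨σ, rfl⟩
      obtain ⟨ρ, hρ, hP⟩ := h σ
      obtain ⟨z, hz, h1, h2⟩ := hc ρ
      refine ⟨ι z, by rw [← map_pow, hz, map_one], ?_, ?_⟩
      · rw [← map_kernelPoint ι hz, ← h1, hP]
        abel
      · exact (hρ θ).symm.trans (by rw [h2, map_mul]))
  rcases key with ⟨r, s, e, -, hr, hs⟩ | ⟨g, hg, hg'⟩
  · obtain ⟨r', rfl⟩ := exists_algebraMap_of_fixed (k := L) fun σ => hr _ ⟨σ, rfl⟩
    obtain ⟨s', rfl⟩ := exists_algebraMap_of_fixed (k := L) fun σ => hs _ ⟨σ, rfl⟩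
    refine .inl ⟨r', s', (algebraMap L F).injective ?_⟩
    simp only [map_add, map_mul, map_pow, hd', ← IsScalarTower.algebraMap_apply ℚ L F n, ← e]
    ring
  · obtain ⟨g', rfl⟩ := exists_algebraMap_of_fixed (k := L) fun σ => hg' _ ⟨σ, rfl⟩
    exact .inr ⟨g', (algebraMap L F).injective (by rw [map_pow, hd', hg])⟩

/-- Converse of `LocallyTrivialAt.descent`. -/
theorem exists_trivializedBy {c : Gal(Q/ℚ) → EPoint n Q} {L F : Type*} [Field L]
    [Field F] [Algebra ℚ L] [Algebra L F] [Algebra ℚ F] [IsScalarTower ℚ L F] [DecidableEq F]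
    (ι : Q →ₐ[ℚ] F) (hres : ∀ σ : Gal(F/L), ∃ ρ : Gal(Q/ℚ), ∀ x, ι (ρ x) = σ (ι x))
    {θ : Q} (hθ : θ ≠ 0) {d : ℚ} (hd : algebraMap ℚ Q d = θ ^ 3)
    (hc : ∀ ρ : Gal(Q/ℚ), ∃ z : Q, z ^ 3 = 1 ∧ c ρ = kernelPoint n z ∧ ρ θ = z * θ)
    (h : (∃ r s : L, algebraMap ℚ L d * r ^ 3 + algebraMap ℚ L d ^ 2 * s ^ 3 = algebraMap ℚ L n) ∨
      ∃ g : L, algebraMap ℚ L d = g ^ 3) :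
    ∃ P : EPoint n F, TrivializedBy c L F ι P := by
  have hd' : algebraMap L F (algebraMap ℚ L d) = ι θ ^ 3 := by
    rw [← IsScalarTower.algebraMap_apply, ← map_pow, ← hd, AlgHom.commutes]
  have hθ' : ι θ ≠ 0 := by simpa using hθ
  rcases h with ⟨r, s, h⟩ | ⟨g, h⟩
  · have e : (ι θ * algebraMap L F r) ^ 3 + (ι θ ^ 2 * algebraMap L F s) ^ 3 = algebraMap ℚ F n := by
      rw [IsScalarTower.algebraMap_apply ℚ L F n, ← h]
      simp only [map_add, map_mul, map_pow, hd']
      ring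
    refine ⟨cubicPoint _ _ e, fun σ => ?_⟩
    obtain ⟨ρ, hρ⟩ := hres σ
    obtain ⟨z, hz, h1, h2⟩ := hc ρ
    refine ⟨ρ, hρ, ?_⟩
    rw [h1, map_kernelPoint ι hz, map_cubicPoint_eq_add (z := ι z) (by rw [← map_pow, hz, map_one]) e
      (ratHom σ) ((hρ θ).symm.trans (by rw [h2, map_mul])) (σ.commutes r) (σ.commutes s),
      add_sub_cancel_left]
  · have e : ι θ ^ 3 = algebraMap L F g ^ 3 := by rw [← hd', h, map_pow]
    refine ⟨kernelPoint n (ι θ / algebraMap L F g), fun σ => ?_⟩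
    obtain ⟨ρ, hρ⟩ := hres σ
    obtain ⟨z, hz, h1, h2⟩ := hc ρ
    refine ⟨ρ, hρ, ?_⟩
    rw [h1, map_kernelPoint ι hz, map_kernelPoint_eq_add (z := ι z) hθ'
      (by rw [← map_pow, hz, map_one]) e (ratHom σ) ((hρ θ).symm.trans (by rw [h2, map_mul]))
      (σ.commutes g), add_sub_cancel_left]

/-! ### The image of a Selmer cocycle under `√-3` -/

/-- At a prime `ℓ ≡ 1 mod 3` not dividing `n`. -/
theorem TrivializedBy.exists_embedding {c : Gal(Q/ℚ) → EPoint n Q} {ℓ : ℕ} [Fact ℓ.Prime]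
    (hℓ : ℓ % 3 = 1) (hn : 3 ∣ (algebraMap ℚ ℚ_[ℓ] n).valuation)
    {F : Type*} [Field F] [Algebra ℚ_[ℓ] F] [Algebra ℚ F]
    [IsScalarTower ℚ ℚ_[ℓ] F] [IsGalois ℚ_[ℓ] F] [DecidableEq F]
    {ι : Q →ₐ[ℚ] F} {P : EPoint n F} (h : TrivializedBy c ℚ_[ℓ] F ι P) {w : Q}
    (hw : w ^ 2 + w + 1 = 0) {α : Q} (hα : α ≠ 0)
    (hc : ∀ ρ : Gal(Q/ℚ), ρ w = w →
      ∃ z : Q, z ^ 3 = 1 ∧ sqrtNegThree w hw (c ρ) = kernelPoint n z ∧ ρ α = z * α)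
    (hαw : α ^ 3 ∈ ℚ⟮w⟯) :
    ∃ κ : ℚ⟮w⟯ →+* ℚ_[ℓ], 3 ∣ (κ ⟨α ^ 3, hαw⟩).valuation := by
  -- As ℚ_ℓ contains the cube roots of unity, ℚ(w) embeds in it by means of ι and the twisted cubic
  -- descends to ℚ_ℓ.
  obtain ⟨t, ht⟩ := exists_cube_root_of_unity hℓ
  have hw' : (ι w) ^ 2 + ι w + 1 = 0 := by
    simpa only [map_add, map_pow, map_one, map_zero] using congrArg ι hw
  have ht' : (algebraMap ℚ_[ℓ] F t) ^ 2 + algebraMap ℚ_[ℓ] F t + 1 = 0 := by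
    simpa only [map_add, map_pow, map_one, map_zero] using congrArg (algebraMap ℚ_[ℓ] F) ht
  obtain ⟨t', ht'w⟩ : ∃ t', algebraMap ℚ_[ℓ] F t' = ι w := by
    rcases eq_of_cube_eq_one ht' (cube_eq_one_of_sq_add hw') with e | e | e
    · exact ⟨1, by rw [e, map_one]⟩
    · exact ⟨t, e.symm⟩
    · exact ⟨t ^ 2, by rw [e, map_pow]⟩
  have hfix : ∀ σ : Gal(F/ℚ_[ℓ]), σ (ι w) = ι w := fun σ => by rw [← ht'w]; exact σ.commutes t'
  have hrange : ∀ x : ℚ⟮w⟯, ∃ y : ℚ_[ℓ], algebraMap ℚ_[ℓ] F y = ι x := by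
    rintro ⟨x, hx⟩
    induction hx using IntermediateField.adjoin_induction with
    | mem x hx =>
      rw [Set.mem_singleton_iff] at hx
      exact ⟨t', by simp only [ht'w, hx]⟩
    | algebraMap q => exact ⟨algebraMap ℚ ℚ_[ℓ] q, by
        rw [← IsScalarTower.algebraMap_apply, AlgHom.commutes]⟩
    | add x y _ _ hx hy =>
      obtain ⟨a, ha⟩ := hx
      obtain ⟨b, hb⟩ := hy
      exact ⟨a + b, by rw [map_add, ha, hb, ← map_add]⟩
    | inv x _ hx =>
      obtain ⟨a, ha⟩ := hx
      exact ⟨a⁻¹, by rw [map_inv₀, ha, ← map_inv₀]⟩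
    | mul x y _ _ hx hy =>
      obtain ⟨a, ha⟩ := hx
      obtain ⟨b, hb⟩ := hy
      exact ⟨a * b, by rw [map_mul, ha, hb, ← map_mul]⟩
  choose κ hκ using hrange
  have hinj := (algebraMap ℚ_[ℓ] F).injective
  let κ' : ℚ⟮w⟯ →+* ℚ_[ℓ] :=
    { toFun := κ
      map_one' := hinj (by rw [hκ, map_one]; exact map_one ι)
      map_mul' := fun x y => hinj (by rw [hκ, map_mul, hκ, hκ]; exact map_mul ι _ _)
      map_zero' := hinj (by rw [hκ, map_zero]; exact map_zero ι)
      map_add' := fun x y => hinj (by rw [hκ, map_add, hκ, hκ]; exact map_add ι _ _) }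
  refine ⟨κ', ?_⟩
  have hκa : algebraMap ℚ_[ℓ] F (κ' ⟨α ^ 3, hαw⟩) = ι (α ^ 3) := hκ _
  have hκ0 : κ' ⟨α ^ 3, hαw⟩ ≠ 0 := by
    intro e
    rw [e, map_zero] at hκa
    exact pow_ne_zero 3 hα (ι.injective (hκa.symm.trans (map_zero ι).symm))
  rcases h.descent_sqrtNegThree hw hα hc with ⟨r, s, e, hr, hs⟩ | ⟨g, hg, hg'⟩
  · obtain ⟨r', rfl⟩ := exists_algebraMap_of_fixed (k := ℚ_[ℓ]) fun σ => hr σ (hfix σ)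
    obtain ⟨s', rfl⟩ := exists_algebraMap_of_fixed (k := ℚ_[ℓ]) fun σ => hs σ (hfix σ)
    refine three_dvd_valuation (r := r') (s := s') hκ0 algebraMap_rat_ne_zero hn (hinj ?_)
    simp only [map_add, map_mul, map_pow, hκa] at e ⊢
    rw [e, ← IsScalarTower.algebraMap_apply]
  · obtain ⟨g', rfl⟩ := exists_algebraMap_of_fixed (k := ℚ_[ℓ]) fun σ => hg' σ (hfix σ)
    have : κ' ⟨α ^ 3, hαw⟩ = g' ^ 3 := hinj (by rw [hκa, hg, map_pow])
    rw [this, Padic.valuation_pow]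
    exact ⟨g'.valuation, by push_cast; ring⟩

/-- At the prime `p`: `α³` is no primitive cube root of unity. -/
theorem TrivializedBy.cube_ne {c : Gal(Q/ℚ) → EPoint n Q} {p : ℕ} [Fact p.Prime]
    (hp : p % 9 = 2 ∨ p % 9 = 5) (hn : ¬ 3 ∣ (algebraMap ℚ ℚ_[p] n).valuation)
    {F : Type*} [Field F] [Algebra ℚ_[p] F] [Algebra ℚ F]
    [IsScalarTower ℚ ℚ_[p] F] [IsGalois ℚ_[p] F] [DecidableEq F]
    {ι : Q →ₐ[ℚ] F} {P : EPoint n F} (h : TrivializedBy c ℚ_[p] F ι P) {w : Q}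
    (hw : w ^ 2 + w + 1 = 0) {α : Q} (hα : α ≠ 0)
    (hc : ∀ ρ : Gal(Q/ℚ), ρ w = w →
      ∃ z : Q, z ^ 3 = 1 ∧ sqrtNegThree w hw (c ρ) = kernelPoint n z ∧ ρ α = z * α) :
    (α ^ 3) ^ 2 + α ^ 3 + 1 ≠ 0 := by
  intro hη
  have hη' : (ι (α ^ 3)) ^ 2 + ι (α ^ 3) + 1 = 0 := by
    simpa only [map_add, map_pow, map_one, map_zero] using congrArg ι hη
  -- w is α³ or its square, so fixing α³ amounts to fixing w, and η = α³ can serve as generator of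
  -- the quadratic extension.
  have hfix : ∀ σ : Gal(F/ℚ_[p]), σ (ι (α ^ 3)) = ι (α ^ 3) → σ (ι w) = ι w := by
    intro σ hσ
    have : CharZero Q := algebraRat.charZero Q
    rcases eq_of_cube_eq_one hη (cube_eq_one_of_sq_add hw) with e | e | e
    · exact absurd e (ne_one_of_sq_add hw)
    · rw [e, hσ]
    · rw [e, map_pow ι, map_pow σ, hσ]
  have hdesc := h.descent_sqrtNegThree hw hα hc
  generalize ι (α ^ 3) = η at *
  have hη3 := cube_eq_one_of_sq_add hη'
  have hinj := (algebraMap ℚ_[p] F).injective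
  have hind : ∀ a b : ℚ_[p], algebraMap ℚ_[p] F a + algebraMap ℚ_[p] F b * η = 0 → a = 0 ∧ b = 0 := by
    intro a b e
    by_cases hb : b = 0
    · subst hb
      exact ⟨by simpa using e, rfl⟩
    · exfalso
      refine no_cube_root_of_unity (p := p) (by omega) (-a / b) (hinj ?_)
      have hb' : algebraMap ℚ_[p] F b ≠ 0 := by simpa using hb
      have : algebraMap ℚ_[p] F (-a / b) = η := by
        rw [map_div₀, map_neg, div_eq_iff hb']
        linear_combination -e
      rw [map_add, map_add, map_pow, this, map_one, map_zero, hη']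
  have hcoord : ∀ r : F, (∀ σ : Gal(F/ℚ_[p]), σ (ι w) = ι w → σ r = r) →
      ∃ a b : ℚ_[p], r = algebraMap ℚ_[p] F a + algebraMap ℚ_[p] F b * η := fun r hr =>
    exists_of_fixed_by_stabilizer hη' fun σ hσ => hr σ (hfix σ hσ)
  have hno : ∀ a b c d N : ℚ_[p], (a ≠ 0 ∨ b ≠ 0 ∨ c ≠ 0 ∨ d ≠ 0) → (N = 0 ∨ ¬ 3 ∣ N.valuation) →
      (algebraMap ℚ_[p] F a + algebraMap ℚ_[p] F b * η) ^ 3 +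
        η * (algebraMap ℚ_[p] F c + algebraMap ℚ_[p] F d * η) ^ 3 ≠ algebraMap ℚ_[p] F N * η ^ 2 := by
    intro a b c d N h0 hN e
    rw [cube_add_mul_cube hη'] at e
    have e' := hind (a ^ 3 + b ^ 3 - 3 * a * b ^ 2 - 3 * c * d * (c - d) + N)
      (3 * a * b * (a - b) + (c ^ 3 + d ^ 3 - 3 * c * d ^ 2) - 3 * c * d * (c - d) + N) (by
        simp only [map_add, map_sub, map_mul, map_pow, map_ofNat]
        linear_combination e + algebraMap ℚ_[p] F N * hη')
    exact padic_no_solution hp h0 hN (eq_neg_of_add_eq_zero_left e'.1)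
      (eq_neg_of_add_eq_zero_left e'.2)
  rcases hdesc with ⟨r, s, e, hr, hs⟩ | ⟨g, hg, hg'⟩
  · obtain ⟨a, b, rfl⟩ := hcoord r hr
    obtain ⟨c', d, rfl⟩ := hcoord s hs
    refine hno a b c' d (algebraMap ℚ ℚ_[p] n) ?_ (.inr hn) ?_
    · by_contra hcon
      push Not at hcon
      obtain ⟨rfl, rfl, rfl, rfl⟩ := hcon
      refine (algebraMap_rat_ne_zero : algebraMap ℚ F n ≠ 0) ?_
      rw [← e]
      simp
    -- Multiplying η r³ + η² s³ = n by η² gives r³ + η s³ = n η².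
    · rw [← IsScalarTower.algebraMap_apply, ← e]
      generalize algebraMap ℚ_[p] F a + algebraMap ℚ_[p] F b * η = r
      generalize algebraMap ℚ_[p] F c' + algebraMap ℚ_[p] F d * η = s
      linear_combination -(r ^ 3 + η * s ^ 3) * hη3
  · obtain ⟨a, b, rfl⟩ := hcoord g hg'
    -- A cube root g of η is the case N = 0, in the form (-g)³ + η · 1³ = 0.
    refine hno (-a) (-b) 1 0 0 (.inr (.inr (.inl one_ne_zero))) (.inl rfl) ?_
    simp only [map_neg, map_one, map_zero, zero_mul, add_zero]
    linear_combination hg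

/-- The data of a continuous cocycle of `Gal(Q/ℚ)` with values in the `3`-torsion. -/
structure IsTorsionCocycle (c : Gal(Q/ℚ) → EPoint n Q) : Prop where
  cocycle : ∀ σ τ, c (σ * τ) = c σ + Point.map (W' := cubeSumCurve n) σ.toAlgHom (c τ)
  torsion : ∀ σ, (3 : ℤ) • c σ = 0
  exists_finset : ∃ S : Finset Q, ∀ σ : Gal(Q/ℚ), (∀ x ∈ S, σ x = x) → c σ = 0

/-- The composite √-3 ∘ c is a character of the full group Gal(Q/ℚ). Over ℚ(w) it is the Kummer
character of an α³ which, by the norm condition and the primes ℓ ≡ 1 mod 3, is a power of w up to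
cubes, and is then a cube because of the prime p. A character of order dividing 3 that is trivial on
a subgroup of index 2 is trivial. -/
theorem IsTorsionCocycle.sqrtNegThree_eq_zero [IsGalois ℚ Q] {c : Gal(Q/ℚ) → EPoint n Q}
    (hc : IsTorsionCocycle c) {p : ℕ} [Fact p.Prime] (hp : p % 9 = 2 ∨ p % 9 = 5)
    (hnp : ¬ 3 ∣ (algebraMap ℚ ℚ_[p] n).valuation)
    (hn : ∀ (ℓ : ℕ) [Fact ℓ.Prime], ℓ % 3 = 1 → 3 ∣ (algebraMap ℚ ℚ_[ℓ] n).valuation)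
    (hloc : ∀ (ℓ : ℕ) [Fact ℓ.Prime], LocallyTrivialAt c ℚ_[ℓ]) {w : Q}
    (hw : w ^ 2 + w + 1 = 0) (σ : Gal(Q/ℚ)) : sqrtNegThree w hw (c σ) = 0 := by
  have : CharZero Q := algebraRat.charZero Q
  choose z hz hzc using fun σ => exists_kernelPoint_sqrtNegThree hw (hc.torsion σ)
  have hmul : ∀ σ τ, z (σ * τ) = z σ * z τ := fun σ τ => by
    refine kernelPoint_injective (n := n) (hz _) (by rw [mul_pow, hz, hz, one_mul]) ?_
    rw [← hzc, hc.cocycle, map_add, sqrtNegThree_map hw (hc.torsion τ), hzc, hzc,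
      kernelPoint_mul (hz σ) (hz τ)]
  obtain ⟨α, hα, hρα⟩ := exists_kummer_of_hom hw hz hmul (by
    obtain ⟨S, hS⟩ := hc.exists_finset
    refine ⟨S, fun σ hσ => kernelPoint_injective (n := n) (hz σ) (one_pow 3) ?_⟩
    rw [← hzc, hS σ hσ, map_zero, kernelPoint_one])
  have hαw : α ^ 3 ∈ ℚ⟮w⟯ := mem_adjoin_of_fixed hw fun ρ hρ => by
    rw [map_pow, hρα ρ hρ, mul_pow, hz, one_mul]
  have hcα : ∀ ρ : Gal(Q/ℚ), ρ w = w →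
      ∃ z : Q, z ^ 3 = 1 ∧ sqrtNegThree w hw (c ρ) = kernelPoint n z ∧ ρ α = z * α :=
    fun ρ hρ => ⟨z ρ, hz ρ, hzc ρ, hρα ρ hρ⟩
  obtain ⟨τ, hτ⟩ := exists_conj hw
  have hw3 := cube_eq_one_of_sq_add hw
  -- The character z is invariant under conjugation by τ, whereas τ inverts μ₃. So ρ multiplies τ α
  -- by (z ρ)², the inverse of its factor on α, and fixes the product. Thus the norm of α³ is the
  -- cube of an element of ℚ(w).
  have hβ : α * τ α ∈ ℚ⟮w⟯ := mem_adjoin_of_fixed hw fun ρ hρ => by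
    have h1 : (τ⁻¹ * ρ * τ) w = w := by
      rw [AlgEquiv.mul_apply, AlgEquiv.mul_apply, hτ, map_pow, hρ, ← hτ]
      exact τ.symm_apply_apply w
    have hz1 : z 1 = 1 := by
      have := hmul 1 1
      rw [mul_one] at this
      refine mul_left_cancel₀ (fun e => ?_) (this.symm.trans (mul_one _).symm)
      have := hz 1
      rw [e] at this
      norm_num at this
    have h2 : z (τ⁻¹ * ρ * τ) = z ρ := by
      rw [hmul, hmul, mul_right_comm, ← hmul, inv_mul_cancel, hz1, one_mul]
    have h3 := congrArg τ (hρα _ h1)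
    rw [h2, AlgEquiv.mul_apply, AlgEquiv.mul_apply] at h3
    have h4 : ρ (τ α) = τ (z ρ) * τ α := by
      rw [← map_mul, ← h3]
      exact (τ.apply_symm_apply _).symm
    have h5 : τ (z ρ) = z ρ ^ 2 := by
      rcases eq_of_cube_eq_one hw (hz ρ) with e | e | e <;>
        simp only [e, map_one, map_pow, hτ, one_pow]
    rw [map_mul, hρα ρ hρ, h4, h5]
    linear_combination α * τ α * hz ρ
  have hprim : IsPrimitiveRoot w 3 := 
    IsPrimitiveRoot.iff_orderOf.mpr (orderOf_eq_prime hw3 (ne_one_of_sq_add hw))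
  have : IsCyclotomicExtension {3} ℚ ℚ⟮w⟯ := by
    convert hprim.intermediateField_adjoin_isCyclotomicExtension ℚ
    · rfl
    · exact Subsingleton.elim _ _
  have : NumberField ℚ⟮w⟯ := IsCyclotomicExtension.numberField {3} ℚ _
  have : IsGalois ℚ ℚ⟮w⟯ := IsCyclotomicExtension.isGalois {3} ℚ _
  have hprim' : IsPrimitiveRoot (⟨w, mem_adjoin_simple_self ℚ w⟩ : ℚ⟮w⟯) 3 :=
    IsPrimitiveRoot.coe_submonoidClass_iff.mp hprim
  have hτK : ∀ x : ℚ⟮w⟯, ((τ.restrictNormal ℚ⟮w⟯ x : ℚ⟮w⟯) : Q) = τ x :=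
    fun x => AlgEquiv.restrictNormal_commutes τ ℚ⟮w⟯ x
  obtain ⟨i, b, hib⟩ := exists_zeta_pow_mul_cube hprim' (τ := (τ.restrictNormal ℚ⟮w⟯).toRingEquiv)
    (Subtype.ext ((hτK _).trans hτ)) (a := ⟨α ^ 3, hαw⟩) (b := ⟨_, hβ⟩)
    (fun e => pow_ne_zero 3 hα (congrArg Subtype.val e))
    (Subtype.ext (by
      change α ^ 3 * ((τ.restrictNormal ℚ⟮w⟯ _ : ℚ⟮w⟯) : Q) = (α * τ α) ^ 3
      rw [hτK, mul_pow, map_pow]))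
    (fun ℓ _ hℓ => by
      obtain ⟨F, _, _, _, _, _, _, ι, P, h⟩ := hloc ℓ
      exact h.exists_embedding hℓ (hn ℓ hℓ) hw hα hcα hαw)
  have hib' : α ^ 3 = w ^ i * (b : Q) ^ 3 := congrArg Subtype.val hib
  have hb0 : (b : Q) ≠ 0 := by
    intro e
    rw [e] at hib'
    exact pow_ne_zero 3 hα (by rw [hib']; ring)
  have hbfix : ∀ ρ : Gal(Q/ℚ), ρ w = w → ρ (b : Q) = b := fun ρ hρ => fixed_of_mem_adjoin b.2 hρ
  have hα' : (α / b) ^ 3 = w ^ i := by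
    rw [div_pow, hib']
    field_simp
  have hρα' : ∀ ρ : Gal(Q/ℚ), ρ w = w → ρ (α / b) = z ρ * (α / b) := fun ρ hρ => by
    rw [map_div₀, hρα ρ hρ, hbfix ρ hρ, mul_div_assoc]
  -- Dividing α by b ∈ ℚ(w) does not change its Kummer character; it remains to exclude that the
  -- cube is a primitive cube root of unity.
  have hα'1 : (α / b) ^ 3 = 1 := by
    by_contra hne
    obtain ⟨F, _, _, _, _, _, _, ι, P, h⟩ := hloc p
    refine h.cube_ne hp hnp hw (div_ne_zero hα hb0)
      (fun ρ hρ => ⟨z ρ, hz ρ, hzc ρ, hρα' ρ hρ⟩) (sq_add_of_cube_eq_one ?_ hne)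
    rw [hα', ← pow_mul, mul_comm, pow_mul, hw3, one_pow]
  have hz1 : ∀ ρ : Gal(Q/ℚ), ρ w = w → z ρ = 1 := fun ρ hρ => by
    have h1 : ρ (α / b) = α / b := by
      rcases eq_of_cube_eq_one hw hα'1 with e | e | e <;> simp only [e, map_one, map_pow, hρ]
    have h2 := hρα' ρ hρ
    rw [h1] at h2
    exact (mul_right_cancel₀ (div_ne_zero hα hb0) (by rw [one_mul, ← h2])) 
  have hσ2 : z (σ * σ) = 1 := hz1 _ (by
    rw [AlgEquiv.mul_apply]
    rcases conj_eq_or hw σ with e | e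
    · rw [e, e]
    · rw [e, map_pow, e]
      linear_combination w * hw3)
  have hσ1 : z σ = 1 := by
    rw [hmul] at hσ2
    have := hz σ
    linear_combination this - z σ * hσ2
  rw [hzc, hσ1, kernelPoint_one]

/-- A cocycle that is killed by `√-3` is given by Kummer theory over `ℚ`. -/
theorem IsTorsionCocycle.exists_kummer [IsGalois ℚ Q] {c : Gal(Q/ℚ) → EPoint n Q}
    (hc : IsTorsionCocycle c) {w : Q} (hw : w ^ 2 + w + 1 = 0)
    (h0 : ∀ σ, sqrtNegThree w hw (c σ) = 0) :
    ∃ θ : Q, θ ≠ 0 ∧ (∃ d : ℚ, algebraMap ℚ Q d = θ ^ 3) ∧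
      ∀ ρ : Gal(Q/ℚ), ∃ z : Q, z ^ 3 = 1 ∧ c ρ = kernelPoint n z ∧ ρ θ = z * θ := by
  choose z hz hzc using fun σ => exists_kernelPoint_of_sqrtNegThree_eq_zero hw (h0 σ)
  obtain ⟨S, hS⟩ := hc.exists_finset
  obtain ⟨θ, hθ, h⟩ := hilbert90 (k := ℚ) (F := Q) z (fun σ τ => by
      have e : (σ (z τ)) ^ 3 = 1 := by rw [← map_pow, hz, map_one]
      refine kernelPoint_injective (n := n) (hz _) (by rw [mul_pow, hz, e, one_mul]) ?_
      rw [← hzc, hc.cocycle, hzc, hzc, kernelPoint_mul (hz σ) e]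
      congr 1
      exact map_kernelPoint σ.toAlgHom (hz τ))
    (fun σ e => by
      have := hz σ
      rw [e] at this
      norm_num at this) S (fun σ hσ => by
      refine kernelPoint_injective (n := n) (hz σ) (one_pow 3) ?_
      rw [← hzc, hS σ hσ, kernelPoint_one])
  refine ⟨θ, hθ, exists_algebraMap_of_fixed fun σ => ?_, fun ρ => ⟨z ρ, hz ρ, hzc ρ, h ρ⟩⟩
  rw [map_pow, h, mul_pow, hz, one_mul]

end Core

end CubeSum

namespace CubeSum

open WeierstrassCurve.Affine NumberField IntermediateField

/-! ### Rational numbers that are cubes up to powers of two primes -/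

/-- In absolute value d has the cube class of |num| · den², to which `exists_unit_mul_cube` applies
in ℕ; the sign is a cube. -/
theorem rat_eq_cube_of_three_dvd {d : ℚ} (hd : d ≠ 0)
    (h : ∀ (ℓ : ℕ) [Fact ℓ.Prime], 3 ∣ padicValRat ℓ d) : ∃ q : ℚ, d = q ^ 3 := by
  have hden : (d.den : ℚ) ≠ 0 := by exact_mod_cast d.den_ne_zero
  have hnum : d.num.natAbs ≠ 0 := by simpa using hd
  have hm0 : d.num.natAbs * d.den ^ 2 ≠ 0 := mul_ne_zero hnum (pow_ne_zero 2 d.den_ne_zero)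
  obtain ⟨u, y, hy⟩ := exists_unit_mul_cube (d.num.natAbs * d.den ^ 2) hm0 fun ℓ hℓ => by
    have hℓ' := Nat.prime_iff.mpr hℓ
    have : Fact ℓ.Prime := ⟨hℓ'⟩
    have hv := h ℓ
    rw [padicValRat_def, padicValInt] at hv
    rw [← padicValNat_def' hℓ'.ne_one hm0, padicValNat.mul hnum (pow_ne_zero 2 d.den_ne_zero),
      padicValNat.pow]
    omega
  rw [Nat.units_eq_one u, Units.val_one, one_mul] at hy
  have hy' : (d.num.natAbs : ℚ) * d.den ^ 2 = y ^ 3 := by exact_mod_cast hy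
  have hd' : d = d.num / d.den := (Rat.num_div_den d).symm
  rcases Int.natAbs_eq d.num with e | e
  · refine ⟨y / d.den, ?_⟩
    have e' : (d.num : ℚ) = d.num.natAbs := congrArg (Int.cast (R := ℚ)) e
    rw [div_pow, ← hy', ← e']
    conv_lhs => rw [hd']
    field_simp
  · refine ⟨-y / d.den, ?_⟩
    have e' : (d.num : ℚ) = -d.num.natAbs :=
      (congrArg (Int.cast (R := ℚ)) e).trans (by rw [Int.cast_neg, Int.cast_natCast])
    rw [div_pow, neg_pow, ← hy', ← neg_eq_iff_eq_neg.mpr e']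
    conv_lhs => rw [hd']
    field_simp

theorem rat_eq_prime_pow_mul_cube {p : ℕ} [Fact p.Prime] (hp3 : p ≠ 3) {d : ℚ} (hd : d ≠ 0)
    (h : ∀ (ℓ : ℕ) [Fact ℓ.Prime], ℓ ≠ 3 → ℓ ≠ p → 3 ∣ padicValRat ℓ d) :
    ∃ (i j : ℕ) (q : ℚ), d = 3 ^ i * (p : ℚ) ^ j * q ^ 3 := by
  have hp : p.Prime := Fact.out
  set i : ℕ := (padicValRat 3 d % 3).toNat with hi
  set j : ℕ := (padicValRat p d % 3).toNat with hj
  have h3 : ((3 : ℕ) : ℚ) ≠ 0 := by norm_num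
  have hpQ : (p : ℚ) ≠ 0 := by exact_mod_cast hp.ne_zero
  have hne : ((3 : ℕ) : ℚ) ^ i * (p : ℚ) ^ j ≠ 0 := mul_ne_zero (pow_ne_zero _ h3) (pow_ne_zero _ hpQ)
  obtain ⟨q, hq⟩ := rat_eq_cube_of_three_dvd (div_ne_zero hd hne) (by
    intro ℓ _
    have hℓ : ℓ.Prime := Fact.out
    rw [padicValRat.div hd hne, padicValRat.mul (pow_ne_zero _ h3) (pow_ne_zero _ hpQ),
      padicValRat.pow, padicValRat.pow, padicValRat.of_nat, padicValRat.of_nat]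
    by_cases e3 : ℓ = 3
    · subst e3
      rw [padicValNat.self (by norm_num), padicValNat_primes (Ne.symm hp3)]
      omega
    by_cases ep : ℓ = p
    · subst ep
      have : Fact (Nat.Prime 3) := ⟨Nat.prime_three⟩
      rw [padicValNat.self hp.one_lt, padicValNat_primes hp3]
      omega
    · have : Fact (Nat.Prime 3) := ⟨Nat.prime_three⟩
      have := h ℓ e3 ep
      rw [padicValNat_primes e3, padicValNat_primes ep]
      omega)
  refine ⟨i, j, q, ?_⟩
  rw [← hq]
  push_cast at hne ⊢
  field_simp

/-- Reformulation with `n = 3 ^ A * p ^ B` in place of `p`. -/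
theorem rat_eq_pow_mul_pow_mul_cube {p : ℕ} [Fact p.Prime] (hp3 : p ≠ 3) {d : ℚ} (hd : d ≠ 0)
    (h : ∀ (ℓ : ℕ) [Fact ℓ.Prime], ℓ ≠ 3 → ℓ ≠ p → 3 ∣ padicValRat ℓ d) (A : ℕ) {B : ℕ}
    (hB : B = 1 ∨ B = 2) :
    ∃ (m k : ℕ) (q : ℚ), d = 3 ^ m * (3 ^ A * (p : ℚ) ^ B) ^ k * q ^ 3 := by
  obtain ⟨i, j, q, hq⟩ := rat_eq_prime_pow_mul_cube hp3 hd h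
  have hpQ : (p : ℚ) ≠ 0 := by exact_mod_cast (Fact.out : p.Prime).ne_zero
  rcases hB with rfl | rfl
  · refine ⟨i + 2 * A * j, j, q / 3 ^ (A * j), ?_⟩
    rw [hq]
    field_simp
    ring
  · refine ⟨i + 2 * A * (2 * j), 2 * j, q / (3 ^ (A * (2 * j)) * p ^ j), ?_⟩
    rw [hq]
    field_simp
    ring

theorem padic_valuation_algebraMap {ℓ : ℕ} [Fact ℓ.Prime] (q : ℚ) :
    (algebraMap ℚ ℚ_[ℓ] q).valuation = padicValRat ℓ q := by
  rw [eq_ratCast, Padic.valuation_ratCast]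

theorem padicValRat_three_pow_mul {p ℓ : ℕ} [Fact p.Prime] [Fact ℓ.Prime] (A B : ℕ) :
    padicValRat ℓ (3 ^ A * (p : ℚ) ^ B) =
      A * (if ℓ = 3 then 1 else 0) + B * (if ℓ = p then 1 else 0) := by
  have hp : p.Prime := Fact.out
  have hℓ : ℓ.Prime := Fact.out
  have : Fact (Nat.Prime 3) := ⟨Nat.prime_three⟩
  have h3 : ((3 : ℕ) : ℚ) ≠ 0 := by norm_num
  have hpQ : (p : ℚ) ≠ 0 := by exact_mod_cast hp.ne_zero
  have key : ∀ (q : ℕ) [Fact q.Prime], padicValNat ℓ q = if ℓ = q then 1 else 0 := fun q hq => by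
    split_ifs with e
    · rw [e, padicValNat.self hq.out.one_lt]
    · exact padicValNat_primes e
  have := padicValRat.mul (p := ℓ) (pow_ne_zero A h3) (pow_ne_zero B hpQ)
  rw [padicValRat.pow, padicValRat.pow, padicValRat.of_nat, padicValRat.of_nat, key 3,
    key p] at this
  push_cast at this
  exact this

end CubeSum

namespace CubeSum

open WeierstrassCurve.Affine NumberField IntermediateField

/-! ### Kummer cocycles -/

section Kummer

theorem conj_div_cube {Q : Type*} [Field Q] [Algebra ℚ Q] {θ : Q} (hθ : θ ≠ 0) {d : ℚ}
    (hd : algebraMap ℚ Q d = θ ^ 3) (σ : Gal(Q/ℚ)) : (σ θ / θ) ^ 3 = 1 := by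
  rw [div_pow, ← map_pow, ← hd, AlgEquiv.commutes, hd, div_self (pow_ne_zero 3 hθ)]

variable {n : ℚ} [NeZero n] {Q : Type*} [Field Q] [Algebra ℚ Q] [DecidableEq Q]

/-- The cochain `c` has values in `ker √-3` and describes the action of `Gal(Q/ℚ)` on `θ`. -/
def IsKummer (c : Gal(Q/ℚ) → EPoint n Q) (θ : Q) : Prop :=
  ∀ ρ : Gal(Q/ℚ), ∃ z : Q, z ^ 3 = 1 ∧ c ρ = kernelPoint n z ∧ ρ θ = z * θ

theorem kernelPoint_pow {z : Q} (hz : z ^ 3 = 1) (m : ℕ) :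
    kernelPoint n (z ^ m) = m • kernelPoint n z := by
  induction m with
  | zero => rw [pow_zero, kernelPoint_one, zero_smul]
  | succ m ih =>
    rw [pow_succ, kernelPoint_mul (by rw [← pow_mul, mul_comm, pow_mul, hz, one_pow]) hz, ih,
      succ_nsmul]

theorem three_zsmul_kernelPoint {z : Q} (hz : z ^ 3 = 1) : (3 : ℤ) • kernelPoint n z = 0 := by
  rw [← Nat.cast_ofNat (R := ℤ), natCast_zsmul, ← kernelPoint_pow hz, hz, kernelPoint_one]

/-- The action of `Gal(Q/ℚ)` on `θ`, as a cochain with values in `ker √-3`. -/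
def kummerCochain (n : ℚ) [NeZero n] (θ : Q) : Gal(Q/ℚ) → EPoint n Q :=
  fun σ => kernelPoint n (σ θ / θ)

theorem isKummer_kummerCochain {θ : Q} (hθ : θ ≠ 0) {d : ℚ} (hd : algebraMap ℚ Q d = θ ^ 3) :
    IsKummer (kummerCochain n θ) θ := fun ρ =>
  ⟨ρ θ / θ, conj_div_cube hθ hd ρ, rfl, (div_mul_cancel₀ _ hθ).symm⟩

theorem kummerCochain_mul {θ : Q} (hθ : θ ≠ 0) {d : ℚ} (hd : algebraMap ℚ Q d = θ ^ 3)
    (σ τ : Gal(Q/ℚ)) :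
    kummerCochain n θ (σ * τ) = kummerCochain n θ σ +
      Point.map (W' := cubeSumCurve n) σ.toAlgHom (kummerCochain n θ τ) := by
  have h := conj_div_cube hθ hd τ
  have hσ : σ θ ≠ 0 := by simpa using hθ
  have h' : (σ.toAlgHom (τ θ / θ)) ^ 3 = 1 := by rw [← map_pow, h, map_one]
  rw [kummerCochain, kummerCochain, kummerCochain, map_kernelPoint _ h,
    ← kernelPoint_mul (conj_div_cube hθ hd σ) h', AlgEquiv.mul_apply]
  congr 1
  change _ = _ * σ (τ θ / θ)
  rw [map_div₀]
  field_simp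

/-- Two Kummer cocycles for the same cube class, up to powers of `n`, are cohomologous. -/
theorem IsKummer.exists_torsion_sub {c κ : Gal(Q/ℚ) → EPoint n Q} {θ θ' t : Q} (hc : IsKummer c θ)
    (hκ : IsKummer κ θ') (hθ : θ ≠ 0) (ht : t ^ 3 = algebraMap ℚ Q n) {m k : ℕ} {q : ℚ}
    (h : θ ^ 3 = (θ' ^ m * t ^ k * algebraMap ℚ Q q) ^ 3) :
    ∃ T : EPoint n Q, (3 : ℤ) • T = 0 ∧
      ∀ σ : Gal(Q/ℚ), c σ = m • κ σ + (Point.map (W' := cubeSumCurve n) σ.toAlgHom T - T) := by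
  have h0 : θ' ^ m * t ^ k * algebraMap ℚ Q q ≠ 0 := fun e =>
    hθ (pow_eq_zero_iff three_ne_zero |>.mp (by rw [h, e]; ring))
  set e := θ / (θ' ^ m * t ^ k * algebraMap ℚ Q q) with he
  have he3 : e ^ 3 = 1 := by rw [he, div_pow, h, div_self (pow_ne_zero 3 h0)]
  have hθe : θ = θ' ^ m * t ^ k * algebraMap ℚ Q q * e := by rw [he, mul_div_cancel₀ _ h0]
  have ht0 : t ≠ 0 := by
    rintro rfl
    exact (algebraMap_rat_ne_zero : algebraMap ℚ Q n ≠ 0) (by rw [← ht]; ring)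
  have ht' : t ^ 3 + 0 ^ 3 = algebraMap ℚ Q n := by rw [ht]; ring
  -- The coboundary of the torsion point (t, 0) is the Kummer cocycle of t = ∛n, and e accounts for
  -- the choice of the cube root θ.
  refine ⟨k • cubicPoint t 0 ht' + kernelPoint n e, ?_, fun σ => ?_⟩
  · rw [smul_add, three_zsmul_kernelPoint he3, smul_comm, three_zsmul_cubicPoint, smul_zero,
      add_zero]
  obtain ⟨z, hz, h1, h2⟩ := hc σ
  obtain ⟨z', hz', h1', h2'⟩ := hκ σ
  have hy := conj_div_cube ht0 ht.symm σ
  set y := σ t / t with hyt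
  have hσt : σ t = y * t := (div_mul_cancel₀ _ ht0).symm
  have hσe3 : (σ e) ^ 3 = 1 := by rw [← map_pow, he3, map_one]
  have hmapT : Point.map (W' := cubeSumCurve n) σ.toAlgHom (cubicPoint t 0 ht') =
      cubicPoint t 0 ht' + kernelPoint n y := by
    rw [map_cubicPoint, cubicPoint_add_kernelPoint hy, cubicPoint_inj]
    exact ⟨hσt, (map_zero σ).trans (by ring)⟩
  have hmapE : Point.map (W' := cubeSumCurve n) σ.toAlgHom (kernelPoint n e) = kernelPoint n (σ e) :=
    map_kernelPoint _ he3
  have hz3 : z * e = z' ^ m * y ^ k * σ e := by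
    have e1 := h2
    rw [hθe] at e1
    simp only [map_mul, map_pow, h2', hσt, AlgEquiv.commutes, mul_pow] at e1
    apply mul_left_cancel₀ h0
    linear_combination -e1
  have hpow : ∀ {x : Q} (i : ℕ), x ^ 3 = 1 → (x ^ i) ^ 3 = 1 := fun i hx => by
    rw [← pow_mul, mul_comm, pow_mul, hx, one_pow]
  have key := congrArg (kernelPoint n) hz3
  rw [kernelPoint_mul hz he3, kernelPoint_mul (by rw [mul_pow, hpow m hz', hpow k hy, one_mul]) hσe3,
    kernelPoint_mul (hpow m hz') (hpow k hy), kernelPoint_pow hz', kernelPoint_pow hy] at key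
  rw [h1, h1', map_add, map_nsmul, hmapT, hmapE, smul_add, ← sub_eq_zero, ← sub_eq_zero.mpr key]
  abel

/-- A Kummer cocycle is a coboundary of a `3`-torsion point only if its cube class is a power of that
of `n`. -/
theorem IsKummer.cube_class_of_coboundary [IsGalois ℚ Q] {c : Gal(Q/ℚ) → EPoint n Q} {θ : Q}
    (hc : IsKummer c θ) {w : Q} (hw : w ^ 2 + w + 1 = 0) (hθ : θ ≠ 0) {d : ℚ}
    (hd : algebraMap ℚ Q d = θ ^ 3) {T : EPoint n Q} (hT : (3 : ℤ) • T = 0)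
    (h : ∀ σ : Gal(Q/ℚ), c σ = Point.map (W' := cubeSumCurve n) σ.toAlgHom T - T) :
    (∃ r : ℚ, d * r ^ 3 = n) ∨ (∃ s : ℚ, d ^ 2 * s ^ 3 = n) ∨ ∃ g : ℚ, d = g ^ 3 := by
  -- T descends over ℚ to the twisted cubic; being 3-torsion and affine there, it has one coordinate
  -- zero.
  have key := exists_descent hw {φ | ∃ σ : Gal(Q/ℚ), φ = σ.toAlgHom} T hθ (by
    rintro φ ⟨σ, rfl⟩
    obtain ⟨z, hz, h1, h2⟩ := hc σ
    exact ⟨z, hz, by rw [← h1, h σ, add_sub_cancel], h2⟩)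
  have hinj := (algebraMap ℚ Q).injective
  rcases key with ⟨r, s, e, rfl, hr, hs⟩ | ⟨g, hg, hg'⟩
  · obtain ⟨r', rfl⟩ := exists_algebraMap_of_fixed (k := ℚ) fun σ => hr _ ⟨σ, rfl⟩
    obtain ⟨s', rfl⟩ := exists_algebraMap_of_fixed (k := ℚ) fun σ => hs _ ⟨σ, rfl⟩
    rcases eq_zero_or_eq_zero_of_three_zsmul e hT with h0 | h0
    · refine .inr (.inl ⟨s', hinj ?_⟩)
      rw [← e, h0, map_mul, map_pow, map_pow, hd]
      ring
    · refine .inl ⟨r', hinj ?_⟩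
      rw [← e, h0, map_mul, map_pow, hd]
      ring
  · obtain ⟨g', rfl⟩ := exists_algebraMap_of_fixed (k := ℚ) fun σ => hg' _ ⟨σ, rfl⟩
    exact .inr (.inr ⟨g', hinj (by rw [hd, hg, map_pow])⟩)

/-- The cube class of a Kummer cocycle that is locally trivial away from `3` and `p`. -/
theorem IsKummer.three_dvd_padicValRat {c : Gal(Q/ℚ) → EPoint n Q} {θ : Q}
    (hc : IsKummer c θ) {w : Q} (hw : w ^ 2 + w + 1 = 0) (hθ : θ ≠ 0) {d : ℚ}
    (hd : algebraMap ℚ Q d = θ ^ 3) {ℓ : ℕ} [Fact ℓ.Prime] (hloc : LocallyTrivialAt c ℚ_[ℓ])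
    (hn : 3 ∣ padicValRat ℓ n) : 3 ∣ padicValRat ℓ d := by
  rw [← padic_valuation_algebraMap] at hn ⊢
  have hd0 : d ≠ 0 := by
    rintro rfl
    exact pow_ne_zero 3 hθ (hd.symm.trans (map_zero _))
  rcases hloc.descent hw hθ hd hc with ⟨r, s, h⟩ | ⟨g, h⟩
  · exact three_dvd_valuation (by simpa using hd0) algebraMap_rat_ne_zero hn h
  · rw [h, Padic.valuation_pow]
    exact ⟨g.valuation, by push_cast; ring⟩

end Kummer

end CubeSum

namespace CubeSum

open WeierstrassCurve.Affine NumberField IntermediateField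

/-! ### Selmer classes as cocycles -/

section Selmer

open scoped Classical

theorem localization_mk_eq_zero_iff {K : Type*} [Field K] (W : WeierstrassCurve K) (m : ℕ)
    (L : Type*) [Field L] [Algebra K L]
    (c : cocycles Gal(AlgebraicClosure K/K)
      (AddSubgroup.torsionBy (W.baseChange (AlgebraicClosure K)).toAffine.Point (m : ℤ))) :
    localization W m L (QuotientAddGroup.mk c) = 0 ↔
      ∃ P : (W.baseChange (AlgebraicClosure L)).toAffine.Point,
        ∀ σ : Gal(AlgebraicClosure L/L),
          Point.map (W' := W) (closureEmbedding K L) (c.1 (galoisRestrictionHom K L σ)).1 =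
            Point.map (W' := W) (σ.toAlgHom.restrictScalars K) P - P := by
  change QuotientAddGroup.mk (cocyclesMap _ _ _ c) = _ ↔ _
  rw [QuotientAddGroup.eq_zero_iff, AddSubgroup.mem_addSubgroupOf]
  have key : ∀ (σ : Gal(AlgebraicClosure L/L)) (P : (W.baseChange (AlgebraicClosure L)).toAffine.Point),
      Point.map (W' := W) (σ.toAlgHom.restrictScalars K) P = σ • P := by
    intro σ P
    cases P <;> rfl
  simp only [key]
  rfl

theorem mk_eq_zero_iff {K : Type*} [Field K] (W : WeierstrassCurve K) (m : ℕ)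
    (c : cocycles Gal(AlgebraicClosure K/K)
      (AddSubgroup.torsionBy (W.baseChange (AlgebraicClosure K)).toAffine.Point (m : ℤ))) :
    (QuotientAddGroup.mk c : torsionH1 W m) = 0 ↔
      ∃ T : (W.baseChange (AlgebraicClosure K)).toAffine.Point, (m : ℤ) • T = 0 ∧
        ∀ σ : Gal(AlgebraicClosure K/K),
          (c.1 σ).1 = Point.map (W' := W) σ.toAlgHom T - T := by
  rw [QuotientAddGroup.eq_zero_iff, AddSubgroup.mem_addSubgroupOf]
  constructor
  · rintro ⟨⟨T, hT⟩, h⟩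
    exact ⟨T, hT, fun σ => congrArg Subtype.val (h σ)⟩
  · rintro ⟨T, hT, h⟩
    exact ⟨⟨T, hT⟩, fun σ => Subtype.ext (h σ)⟩

/-- The `ℚ`-algebra structure on `AlgebraicClosure L` that comes from the one on `L`. -/
abbrev ratAlgebraAlgebraicClosure (L : Type*) [Field L] [Algebra ℚ L] :
    Algebra ℚ (AlgebraicClosure L) :=
  AlgebraicClosure.instAlgebra L

attribute [local instance] ratAlgebraAlgebraicClosure

/-- The continuous cocycles of `Gal(ℚ̄/ℚ)` with values in the `3`-torsion of `Eₙ`. -/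
abbrev torsionCocycles (n : ℚ) : AddSubgroup (Gal(AlgebraicClosure ℚ/ℚ) →
    AddSubgroup.torsionBy ((cubeSumCurve n).baseChange (AlgebraicClosure ℚ)).toAffine.Point
      ((3 : ℕ) : ℤ)) :=
  cocycles Gal(AlgebraicClosure ℚ/ℚ) (AddSubgroup.torsionBy
    ((cubeSumCurve n).baseChange (AlgebraicClosure ℚ)).toAffine.Point ((3 : ℕ) : ℤ))

/-- The cohomology class of a cocycle. -/
abbrev toH1 {n : ℚ} (c : torsionCocycles n) : torsionH1 (cubeSumCurve n) 3 := QuotientAddGroup.mk c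

/-- The underlying function of a cocycle with values in the `3`-torsion. -/
abbrev cochain {n : ℚ} (c : torsionCocycles n) :
    Gal(AlgebraicClosure ℚ/ℚ) → EPoint n (AlgebraicClosure ℚ) :=
  fun σ => (c.1 σ).1

theorem isTorsionCocycle_cochain {n : ℚ} (c : torsionCocycles n) : IsTorsionCocycle (cochain c) where
  cocycle σ τ := congrArg Subtype.val (c.2.2 σ τ)
  torsion σ := (c.1 σ).2
  exists_finset := by
    have h1 : cochain c 1 = 0 := by
      have := congrArg Subtype.val (c.2.2 1 1)
      rw [one_mul, one_smul] at this
      exact left_eq_add.mp this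
    obtain ⟨S, hS⟩ := exists_finset_of_mem_nhds_one
      ((c.2.1.isOpen_fiber (c.1 1)).mem_nhds (rfl : c.1 1 = c.1 1))
    exact ⟨S, fun σ hσ => (congrArg Subtype.val (hS σ hσ)).trans h1⟩

theorem locallyTrivialAt_of_localization_eq_zero {n : ℚ} {c : torsionCocycles n} {L : Type} [Field L]
    [Algebra ℚ L] [CharZero L] (h : localization (cubeSumCurve n) 3 L (toH1 c) = 0) :
    LocallyTrivialAt (cochain c) L := by
  obtain ⟨P, hP⟩ := (localization_mk_eq_zero_iff _ _ _ _).mp h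
  exact ⟨AlgebraicClosure L, inferInstance, inferInstance, inferInstance, inferInstance,
    inferInstance, inferInstance, closureEmbedding ℚ L, P, fun σ => ⟨galoisRestrictionHom ℚ L σ,
      closureEmbedding_restriction ℚ L σ, hP σ⟩⟩

theorem torsionH1_three_nsmul {n : ℚ} (x : torsionH1 (cubeSumCurve n) 3) : 3 • x = 0 :=
  H1.nsmul_eq_zero (fun y => AddSubgroup.torsionBy.nsmul y) x

variable {n : ℚ} [NeZero n]

theorem localization_eq_zero_of_isKummer {c : torsionCocycles n} {L : Type} [Field L] [Algebra ℚ L]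
    {θ : AlgebraicClosure ℚ} (hθ : θ ≠ 0) {d : ℚ} (hd : algebraMap ℚ (AlgebraicClosure ℚ) d = θ ^ 3)
    (hc : IsKummer (cochain c) θ)
    (h : (∃ r s : L, algebraMap ℚ L d * r ^ 3 + algebraMap ℚ L d ^ 2 * s ^ 3 = algebraMap ℚ L n) ∨
      ∃ g : L, algebraMap ℚ L d = g ^ 3) :
    localization (cubeSumCurve n) 3 L (toH1 c) = 0 := by
  obtain ⟨P, hP⟩ := exists_trivializedBy (closureEmbedding ℚ L)
    (fun σ => ⟨_, closureEmbedding_restriction ℚ L σ⟩) hθ hd hc h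
  refine (localization_mk_eq_zero_iff _ _ _ _).mpr ⟨P, fun σ => ?_⟩
  obtain ⟨ρ, hρ, e⟩ := hP σ
  have : ρ = galoisRestrictionHom ℚ L σ := AlgEquiv.ext fun x => (closureEmbedding ℚ L).injective
    ((hρ x).trans (closureEmbedding_restriction ℚ L σ x).symm)
  rw [← this]
  exact e

/-! ### The Kummer class of 3 and the Selmer group -/

theorem isLocallyConstant_apply {k F : Type*} [Field k] [Field F] [Algebra k F]
    [Algebra.IsIntegral k F] (x : F) : IsLocallyConstant fun σ : Gal(F/k) => σ x := by
  refine (IsLocallyConstant.iff_exists_open _).mpr fun σ =>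
    ⟨(fun τ => σ⁻¹ * τ) ⁻¹' (MulAction.stabilizer Gal(F/k) x : Set Gal(F/k)),
      (stabilizer_isOpen_of_isIntegral x).preimage (continuous_const_mul _), ?_, fun τ hτ => ?_⟩
  · simp
  · have h : (σ⁻¹ * τ) x = x := hτ
    rw [AlgEquiv.mul_apply] at h
    have := congrArg σ h
    rwa [← AlgEquiv.mul_apply, mul_inv_cancel] at this

/-- The Kummer cocycle of a cube root `θ` of a rational number. -/
def kummerCocycle {θ : AlgebraicClosure ℚ} (hθ : θ ≠ 0) {d : ℚ}
    (hd : algebraMap ℚ (AlgebraicClosure ℚ) d = θ ^ 3) : torsionCocycles n :=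
  ⟨fun σ => ⟨kummerCochain n θ σ, three_zsmul_kernelPoint (conj_div_cube hθ hd σ)⟩, by
    refine ⟨?_, fun σ τ => Subtype.ext (kummerCochain_mul hθ hd σ τ)⟩
    refine (IsLocallyConstant.iff_exists_open _).mpr fun σ => ?_
    obtain ⟨U, hU, hσU, h⟩ := (IsLocallyConstant.iff_exists_open _).mp
      (isLocallyConstant_apply (k := ℚ) θ) σ
    refine ⟨U, hU, hσU, fun τ hτ => Subtype.ext ?_⟩
    change kernelPoint n (τ θ / θ) = kernelPoint n (σ θ / θ)
    rw [h τ hτ]⟩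

theorem isKummer_kummerCocycle {θ : AlgebraicClosure ℚ} (hθ : θ ≠ 0) {d : ℚ}
    (hd : algebraMap ℚ (AlgebraicClosure ℚ) d = θ ^ 3) :
    IsKummer (cochain (kummerCocycle (n := n) hθ hd)) θ :=
  isKummer_kummerCochain hθ hd

theorem exists_sq_add_eq_zero : ∃ w : AlgebraicClosure ℚ, w ^ 2 + w + 1 = 0 := by
  obtain ⟨w, hw⟩ := IsAlgClosed.exists_aeval_eq_zero (AlgebraicClosure ℚ)
    (Polynomial.X ^ 2 + Polynomial.X + 1 : Polynomial ℚ) (by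
      have : (Polynomial.X ^ 2 + Polynomial.X + 1 : Polynomial ℚ).degree = 2 := by
        compute_degree!
      rw [this]
      norm_num)
  exact ⟨w, by simpa using hw⟩

/-- Selmer classes are multiples of the class of `∛3`. -/
theorem exists_nsmul_of_mem_selmerGroup {p A B : ℕ} [Fact p.Prime] (hp : p % 9 = 2 ∨ p % 9 = 5)
    (hB : B = 1 ∨ B = 2) (hn : n = 3 ^ A * (p : ℚ) ^ B) {θ : AlgebraicClosure ℚ} (hθ : θ ≠ 0)
    (hd : algebraMap ℚ (AlgebraicClosure ℚ) 3 = θ ^ 3) {x : torsionH1 (cubeSumCurve n) 3}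
    (hx : x ∈ selmerGroup (cubeSumCurve n) 3) :
    ∃ m : ℕ, x = m • toH1 (kummerCocycle (n := n) hθ hd) := by
  have hp3 : p ≠ 3 := by rintro rfl; omega
  obtain ⟨c, rfl⟩ := QuotientAddGroup.mk_surjective x
  have hloc : ∀ (ℓ : ℕ) [Fact ℓ.Prime], LocallyTrivialAt (cochain c) ℚ_[ℓ] := fun ℓ hℓ =>
    locallyTrivialAt_of_localization_eq_zero (AddSubgroup.mem_iInf.mp (AddSubgroup.mem_iInf.mp
      (AddSubgroup.mem_inf.mp hx).1 ℓ) hℓ)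
  have hval : ∀ (ℓ : ℕ) [Fact ℓ.Prime], ℓ ≠ 3 → ℓ ≠ p → padicValRat ℓ n = 0 := fun ℓ _ h3 hℓp => by
    rw [hn, padicValRat_three_pow_mul, if_neg h3, if_neg hℓp, mul_zero, mul_zero, add_zero]
  obtain ⟨w, hw⟩ := exists_sq_add_eq_zero
  have hc := isTorsionCocycle_cochain c
  obtain ⟨η, hη, ⟨d, hdη⟩, hcη⟩ := hc.exists_kummer hw (hc.sqrtNegThree_eq_zero hp (by
      rw [padic_valuation_algebraMap, hn, padicValRat_three_pow_mul, if_neg hp3, if_pos rfl]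
      omega)
    (fun ℓ _ hℓ => by
      rw [padic_valuation_algebraMap, hval ℓ (by rintro rfl; omega) (by rintro rfl; omega)]
      exact dvd_zero _) hloc hw)
  have hd0 : d ≠ 0 := by
    rintro rfl
    exact pow_ne_zero 3 hη (hdη.symm.trans (map_zero _))
  obtain ⟨m, k, q, hdq⟩ := rat_eq_pow_mul_pow_mul_cube hp3 hd0 (fun ℓ _ h3 hℓp =>
    IsKummer.three_dvd_padicValRat hcη hw hη hdη (hloc ℓ) (by
      rw [hval ℓ h3 hℓp]
      exact dvd_zero _)) A hB
  obtain ⟨t, ht⟩ := IsAlgClosed.exists_pow_nat_eq (algebraMap ℚ (AlgebraicClosure ℚ) n)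
    (n := 3) (by norm_num)
  obtain ⟨T, hT, h⟩ := IsKummer.exists_torsion_sub hcη (isKummer_kummerCocycle (n := n) hθ hd) hη ht
    (m := m) (k := k) (q := q) (by
      rw [← hdη, hdq, ← hn]
      simp only [map_mul, map_pow, hd, ← ht]
      ring)
  refine ⟨m, sub_eq_zero.mp ((mk_eq_zero_iff (cubeSumCurve n) 3
    (c - m • kummerCocycle (n := n) hθ hd)).mpr ⟨T, hT, fun σ => ?_⟩)⟩
  exact sub_eq_iff_eq_add'.mpr (h σ)

/-- At the finite places this is `padic_exists_solution` with N = p^B, whose only prime factor p is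
2 modulo 3. At the real place 3 is a cube. -/
theorem kummerCocycle_three_mem_selmerGroup {p B : ℕ} [Fact p.Prime] (hp : p % 9 = 2 ∨ p % 9 = 5)
    (hB : B = 1 ∨ B = 2) (hn : n = 3 * (p : ℚ) ^ B) {θ : AlgebraicClosure ℚ} (hθ : θ ≠ 0)
    (hd : algebraMap ℚ (AlgebraicClosure ℚ) 3 = θ ^ 3) :
    toH1 (kummerCocycle (n := n) hθ hd) ∈ selmerGroup (cubeSumCurve n) 3 := by
  have hN : p ^ B % 9 = 2 ∨ p ^ B % 9 = 4 ∨ p ^ B % 9 = 5 ∨ p ^ B % 9 = 7 := by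
    rcases hB with rfl | rfl <;> rcases hp with h | h <;> simp [Nat.pow_mod, h]
  refine AddSubgroup.mem_inf.mpr ⟨AddSubgroup.mem_iInf.mpr fun ℓ => AddSubgroup.mem_iInf.mpr
    fun hℓ => ?_, ?_⟩
  · refine localization_eq_zero_of_isKummer hθ hd (isKummer_kummerCocycle hθ hd) ?_
    have h := padic_exists_solution (ℓ := ℓ) hN fun h => by
      have := (Nat.prime_dvd_prime_iff_eq hℓ.out (Fact.out : p.Prime)).mp
        (hℓ.out.dvd_of_dvd_pow h)
      omega
    rw [hn]
    simpa using h
  · refine localization_eq_zero_of_isKummer hθ hd (isKummer_kummerCocycle hθ hd) (.inr ?_)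
    refine ⟨(3 : ℝ) ^ (3⁻¹ : ℝ), ?_⟩
    rw [← Real.rpow_natCast, ← Real.rpow_mul (by norm_num)]
    norm_num

theorem padicValRat_mul_cube {ℓ : ℕ} [Fact ℓ.Prime] {a s N : ℚ} (hN : N ≠ 0) (h : a * s ^ 3 = N) :
    padicValRat ℓ a + 3 * padicValRat ℓ s = padicValRat ℓ N := by
  have ha : a ≠ 0 := by rintro rfl; exact hN (by rw [← h, zero_mul])
  have hs : s ≠ 0 := by rintro rfl; exact hN (by rw [← h]; ring)
  rw [← h, padicValRat.mul ha (pow_ne_zero 3 hs), padicValRat.pow]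
  rfl

/-- Otherwise n / 3, n / 9 or 3 would be a rational cube. The valuation at p excludes the first, the
valuation at 3 the other two. -/
theorem kummerCocycle_three_ne_zero {p B : ℕ} [Fact p.Prime] (hp : p % 9 = 2 ∨ p % 9 = 5)
    (hB : B = 1 ∨ B = 2) (hn : n = 3 * (p : ℚ) ^ B) {θ : AlgebraicClosure ℚ} (hθ : θ ≠ 0)
    (hd : algebraMap ℚ (AlgebraicClosure ℚ) 3 = θ ^ 3) :
    toH1 (kummerCocycle (n := n) hθ hd) ≠ 0 := by
  intro h
  have hp3 : p ≠ 3 := by rintro rfl; omega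
  have : Fact (Nat.Prime 3) := ⟨Nat.prime_three⟩
  obtain ⟨w, hw⟩ := exists_sq_add_eq_zero
  obtain ⟨T, hT, hσ⟩ := (mk_eq_zero_iff _ _ _).mp h
  have v1 : ∀ (ℓ : ℕ) [Fact ℓ.Prime], padicValRat ℓ n =
      (if ℓ = 3 then 1 else 0) + B * (if ℓ = p then 1 else 0) := fun ℓ _ => by
    have := padicValRat_three_pow_mul (p := p) (ℓ := ℓ) 1 B
    rw [pow_one, ← hn, Nat.cast_one, one_mul] at this
    exact this
  have v3 : padicValRat 3 (3 : ℚ) = 1 := padicValRat.self (p := 3) (by norm_num)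
  have vp : padicValRat p (3 : ℚ) = 0 := by
    have := padicValRat.of_nat (p := p) (n := 3)
    rw [padicValNat_primes hp3] at this
    exact this
  rcases (isKummer_kummerCocycle hθ hd).cube_class_of_coboundary hw hθ hd hT hσ with
    ⟨r, hr⟩ | ⟨s, hs⟩ | ⟨g, hg⟩
  · have := padicValRat_mul_cube (ℓ := p) (NeZero.ne n) hr
    rw [v1, vp, if_neg hp3, if_pos rfl] at this
    omega
  · have := padicValRat_mul_cube (ℓ := 3) (NeZero.ne n) hs
    rw [v1, padicValRat.pow, v3, if_pos rfl, if_neg (Ne.symm hp3)] at this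
    push_cast at this
    omega
  · have := congrArg (padicValRat 3) hg
    rw [v3, padicValRat.pow] at this
    push_cast at this
    omega

/-- The obstruction is at 3: the twisted cubic has no point over ℚ₃, and 3 is not a cube there by
its valuation. -/
theorem kummerCocycle_three_notMem_selmerGroup {p B : ℕ} (hp : p % 9 = 2 ∨ p % 9 = 5)
    (hB : B = 1 ∨ B = 2) (hn : n = 9 * (p : ℚ) ^ B) {θ : AlgebraicClosure ℚ} (hθ : θ ≠ 0)
    (hd : algebraMap ℚ (AlgebraicClosure ℚ) 3 = θ ^ 3) :
    toH1 (kummerCocycle (n := n) hθ hd) ∉ selmerGroup (cubeSumCurve n) 3 := by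
  intro hx
  have hN : p ^ B % 9 = 2 ∨ p ^ B % 9 = 4 ∨ p ^ B % 9 = 5 ∨ p ^ B % 9 = 7 := by
    rcases hB with rfl | rfl <;> rcases hp with h | h <;> simp [Nat.pow_mod, h]
  have h3 : Fact (Nat.Prime 3) := ⟨Nat.prime_three⟩
  obtain ⟨w, hw⟩ := exists_sq_add_eq_zero
  have hloc : LocallyTrivialAt (cochain (kummerCocycle (n := n) hθ hd)) ℚ_[3] :=
    locallyTrivialAt_of_localization_eq_zero (AddSubgroup.mem_iInf.mp (AddSubgroup.mem_iInf.mp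
      (AddSubgroup.mem_inf.mp hx).1 3) h3)
  rcases hloc.descent hw hθ hd (isKummer_kummerCocycle hθ hd) with ⟨r, s, h⟩ | ⟨g, h⟩
  · rw [hn] at h
    exact padic_three_no_solution hN (r := r) (s := s) (by simpa using h)
  · have := congrArg Padic.valuation h
    rw [Padic.valuation_pow, padic_valuation_algebraMap,
      show padicValRat 3 (3 : ℚ) = 1 from padicValRat.self (p := 3) (by norm_num)] at this
    push_cast at this
    omega

theorem exists_cube_eq_three : ∃ θ : AlgebraicClosure ℚ, θ ≠ 0 ∧
    algebraMap ℚ (AlgebraicClosure ℚ) 3 = θ ^ 3 := by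
  obtain ⟨θ, h⟩ := IsAlgClosed.exists_pow_nat_eq (algebraMap ℚ (AlgebraicClosure ℚ) 3) (n := 3)
    (by norm_num)
  refine ⟨θ, ?_, h.symm⟩
  rintro rfl
  have := h.symm.trans (zero_pow three_ne_zero)
  simp at this

/-! ### The dimensions of the Selmer groups -/

theorem rank_selmerGroup_eq_one {p B : ℕ} [Fact p.Prime] (hp : p % 9 = 2 ∨ p % 9 = 5)
    (hB : B = 1 ∨ B = 2) (hn : n = 3 * (p : ℚ) ^ B) :
    Module.rank (ZMod 3) (selmerGroup (cubeSumCurve n) 3) = 1 := by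
  have : Fact (Nat.Prime 3) := ⟨Nat.prime_three⟩
  obtain ⟨θ, hθ, hd⟩ := exists_cube_eq_three
  refine rank_eq_one (⟨_, kummerCocycle_three_mem_selmerGroup hp hB hn hθ hd⟩ :
    selmerGroup (cubeSumCurve n) 3)
    (fun e => kummerCocycle_three_ne_zero hp hB hn hθ hd (congrArg Subtype.val e)) ?_
  rintro ⟨x, hx⟩
  obtain ⟨m, hm⟩ := exists_nsmul_of_mem_selmerGroup (A := 1) hp hB (by rw [hn, pow_one]) hθ hd hx
  refine ⟨(m : ZMod 3), ?_⟩
  rw [Nat.cast_smul_eq_nsmul]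
  exact Subtype.ext hm.symm

theorem rank_selmerGroup_eq_zero {p B : ℕ} [Fact p.Prime] (hp : p % 9 = 2 ∨ p % 9 = 5)
    (hB : B = 1 ∨ B = 2) (hn : n = 9 * (p : ℚ) ^ B) :
    Module.rank (ZMod 3) (selmerGroup (cubeSumCurve n) 3) = 0 := by
  obtain ⟨θ, hθ, hd⟩ := exists_cube_eq_three
  have hzero : ∀ x ∈ selmerGroup (cubeSumCurve n) 3, x = 0 := fun x hx => by
    obtain ⟨m, hm⟩ := exists_nsmul_of_mem_selmerGroup (A := 2) hp hB (by rw [hn]; norm_num) hθ hd hx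
    have h3 : 3 • toH1 (kummerCocycle (n := n) hθ hd) = 0 := torsionH1_three_nsmul _
    by_cases hm3 : 3 ∣ m
    · obtain ⟨k, rfl⟩ := hm3
      rw [hm, mul_comm, mul_smul, h3, smul_zero]
    · refine absurd ?_ (kummerCocycle_three_notMem_selmerGroup hp hB hn hθ hd)
      -- For m prime to 3, m is its own inverse modulo 3, so m • x is the class of 3 itself and
      -- would lie in the Selmer group.
      have hmm : m * m % 3 = 1 := by
        have : m % 3 = 1 ∨ m % 3 = 2 := by omega
        rcases this with h | h <;> simp [Nat.mul_mod, h]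
      have : m • x = toH1 (kummerCocycle (n := n) hθ hd) := by
        rw [hm, ← mul_smul, ← Nat.div_add_mod (m * m) 3, hmm, add_smul, one_smul, mul_comm,
          mul_smul, h3, smul_zero, zero_add]
      rw [← this]
      exact nsmul_mem hx m
  have : Subsingleton (selmerGroup (cubeSumCurve n) 3) :=
    ⟨fun x y => Subtype.ext ((hzero x x.2).trans (hzero y y.2).symm)⟩
  have : Nontrivial (ZMod 3) := ⟨0, 1, by decide⟩
  exact rank_subsingleton' _ _

end Selmer

end CubeSum

end

theorem mainTheorem7 (p : ℕ) (hp : p.Prime) (hodd : Odd p) (hmod : p % 9 = 2 ∨ p % 9 = 5) :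
    Module.rank (ZMod 3) (CubeSum.selmerGroup (CubeSum.cubeSumCurve (3 * (p : ℚ))) 3) = 1 ∧
    Module.rank (ZMod 3) (CubeSum.selmerGroup (CubeSum.cubeSumCurve (9 * (p : ℚ) ^ 2)) 3) = 0 ∧
    Module.rank (ZMod 3) (CubeSum.selmerGroup (CubeSum.cubeSumCurve (3 * (p : ℚ) ^ 2)) 3) = 1 ∧
    Module.rank (ZMod 3) (CubeSum.selmerGroup (CubeSum.cubeSumCurve (9 * (p : ℚ))) 3) = 0 := by
  have : Fact p.Prime := ⟨hp⟩
  have hp0 : (p : ℚ) ≠ 0 := by exact_mod_cast hp.ne_zero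
  have : NeZero (3 * (p : ℚ)) := ⟨by positivity⟩
  have : NeZero (9 * (p : ℚ)) := ⟨by positivity⟩
  have : NeZero (3 * (p : ℚ) ^ 2) := ⟨by positivity⟩
  have : NeZero (9 * (p : ℚ) ^ 2) := ⟨by positivity⟩
  exact ⟨CubeSum.rank_selmerGroup_eq_one hmod (.inl rfl) (by rw [pow_one]),
    CubeSum.rank_selmerGroup_eq_zero hmod (.inr rfl) rfl,
    CubeSum.rank_selmerGroup_eq_one hmod (.inr rfl) rfl,
    CubeSum.rank_selmerGroup_eq_zero hmod (.inl rfl) (by rw [pow_one])⟩
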